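/- Let $n\ge 1$ and let $(X,U)$, $U=(U_1,\dots,U_n)$, have density proportional to $\sigma^{-(n+1)} f\big(\frac{(x-\mu)^2+\|u\|^2}{\sigma^2}\big)$ on $\mathbb R\times\mathbb R^n$, with known $f:(0,\infty)\to(0,\infty)$ and unknown $(\mu,\sigma)\in\Theta=\{\mu\ge 0,\ \sigma>0\}$. Put $S=\|U\|$, so that $(X,S)$ has density proportional to $s^{n-1}\sigma^{-(n+1)} f\big(\frac{(x-\mu)^2+s^2}{\sigma^2}\big)$ on $\mathbb R\times(0,\infty)$. The mean $\mu$ is estimated under the loss $\rho\big(\frac{d-\mu}{\sigma}\big)$. Suppose that either (a) $f$ is normal, i.e. $f(t)=C e^{-t/2}$ for $t>0$ with a constant $C>0$, and $\rho$ is even, convex and strictly bowl-shaped (that is, locally absolutely continuous with $\rho\ge\rho(0)=0$, $\rho'<0$ a.e. on $(-\infty,0)$ and $\rho'>0$ a.e. on $(0,\infty)$); or (b) $f'<0$ and $t f'(t)/f(t)$ is decreasing in $t>0$ (and $f$ generates a density, i.e. $\int_0^\infty\int_{\mathbb R} s^{n-1}f(x^2+s^2)\,dx\,ds<\infty$), and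 $\rho(t)=|t|^p$ for some $p>0$. Assume that $c\mapsto E_{0,1}[\rho(X+cS)]$ has a minimizer $c_0$ at which it is finite, and let $\delta_0=X+c_0S$ be the minimum risk equivariant estimator. Let $-(n-1)\le l<0$, and let $\delta_{\pi_l}$ be a generalized Bayes estimator with respect to the prior measure with density $\sigma^{-(l+1)}$ on $\Theta$, i.e. a measurable function of the observation which at almost every observation has finite (unnormalized) expected posterior loss and minimizes it. Then, both when $(X,U)$ and when only $(X,S)$ is observed, the risk at the boundary $\mu=0$ satisfies $R((0,\sigma),\delta_{\pi_l})>R((0,\sigma),\delta_0)$ for every $\sigma>0$, and $\delta_{\pi_l}$ is not minimax: there is an estimator $\delta'$ with $\sup_{\Theta}R(\theta,\delta')<\sup_{\Theta}R(\theta,\delta_{\pi_l})$. -/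

import Mathlib

open MeasureTheory Set
open scoped ENNReal

noncomputable section

namespace BoundedMean

/-! ### Densities, losses, priors -/

/-- The monotonicity assumption on the generator `f : (0,∞) → (0,∞)` of the spherical density:
`f' < 0` (in particular `f` is differentiable) and `t f'(t) / f(t)` is decreasing in `t > 0`,
together with the fact that `f` generates a density of `(X, S)`, i.e. that
`s ^ (n-1) f (x² + s²)` has finite integral over `ℝ × (0,∞)`.
Values of `f` outside `(0,∞)` play no role. -/
structure IsGenerator (n : ℕ) (f : ℝ → ℝ) : Prop where
  pos : ∀ t, 0 < t → 0 < f t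
  deriv_neg : ∀ t, 0 < t → deriv f t < 0
  antitone : AntitoneOn (fun t => t * deriv f t / f t) (Ioi 0)
  integrable : ∫⁻ ω in (univ : Set ℝ) ×ˢ Ioi (0 : ℝ),
    ENNReal.ofReal (ω.2 ^ (n - 1) * f (ω.1 ^ 2 + ω.2 ^ 2)) < ∞

/-- `f` is the generator of the normal model: `f t ∝ exp (-t/2)`. -/
def IsNormalGenerator (f : ℝ → ℝ) : Prop :=
  ∃ C : ℝ, 0 < C ∧ ∀ t, 0 < t → f t = C * Real.exp (-t / 2)

/-- Strictly bowl-shaped losses: `ρ` is (locally) absolutely continuous, `ρ ≥ ρ 0 = 0`,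
`ρ' < 0` on `(-∞,0)` and `ρ' > 0` on `(0,∞)` (almost everywhere, where the derivative of an
absolutely continuous function exists). -/
structure IsStrictlyBowlShaped (ρ : ℝ → ℝ) : Prop where
  absCont : ∀ a b : ℝ, AbsolutelyContinuousOnInterval ρ a b
  zero : ρ 0 = 0
  nonneg : ∀ t, 0 ≤ ρ t
  deriv_neg : ∀ᵐ t : ℝ, t < 0 → deriv ρ t < 0
  deriv_pos : ∀ᵐ t : ℝ, 0 < t → 0 < deriv ρ t

/-- Density (up to a constant that does not depend on `θ = (μ, σ)`) of `(X, U)`,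
`U = (U₁, …, Uₙ)`, with respect to Lebesgue measure. -/
def fullDensity (n : ℕ) (f : ℝ → ℝ) (θ : ℝ × ℝ) (ω : ℝ × EuclideanSpace ℝ (Fin n)) : ℝ≥0∞ :=
  ENNReal.ofReal (1 / θ.2 ^ (n + 1) * f (((ω.1 - θ.1) ^ 2 + ‖ω.2‖ ^ 2) / θ.2 ^ 2))

/-- Density (up to a constant that does not depend on `θ = (μ, σ)`) of `(X, S)`, `S = ‖U‖ > 0`,
with respect to Lebesgue measure. -/
def reducedDensity (n : ℕ) (f : ℝ → ℝ) (θ : ℝ × ℝ) (ω : ℝ × ℝ) : ℝ≥0∞ :=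
  if 0 < ω.2 then
    ENNReal.ofReal
      (ω.2 ^ (n - 1) / θ.2 ^ (n + 1) * f (((ω.1 - θ.1) ^ 2 + ω.2 ^ 2) / θ.2 ^ 2))
  else 0

/-- The restricted parameter space: `θ = (μ, σ)` with `μ ≥ 0`, `σ > 0`. -/
def Θ : Set (ℝ × ℝ) := Ici 0 ×ˢ Ioi 0

/-- The prior measure with density `σ ^ (-(l+1))` on `μ ≥ 0`, `σ > 0`. -/
def prior (l : ℝ) : Measure (ℝ × ℝ) :=
  (volume.restrict Θ).withDensity fun θ => ENNReal.ofReal (θ.2 ^ (-(l + 1)))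

/-! ### Decision theory for a family of (unnormalized) densities `p θ` on a sample space `Ω` -/

section Decision

variable {Ω : Type*} [MeasureSpace Ω]

/-- The probability law of the observation under `θ`, with density proportional to `p θ`. -/
def law (p : ℝ × ℝ → Ω → ℝ≥0∞) (θ : ℝ × ℝ) : Measure Ω :=
  (∫⁻ ω, p θ ω)⁻¹ • (volume : Measure Ω).withDensity (p θ)

/-- The risk at `θ = (μ, σ)` of the estimator `δ` under the loss `ρ ((d - μ) / σ)`. -/
def risk (p : ℝ × ℝ → Ω → ℝ≥0∞) (ρ : ℝ → ℝ) (δ : Ω → ℝ) (θ : ℝ × ℝ) : ℝ≥0∞ :=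
  ∫⁻ ω, ENNReal.ofReal (ρ ((δ ω - θ.1) / θ.2)) ∂law p θ

/-- `δ` is minimax over `Θ`: no estimator has a smaller maximal risk. -/
def IsMinimax (p : ℝ × ℝ → Ω → ℝ≥0∞) (ρ : ℝ → ℝ) (δ : Ω → ℝ) : Prop :=
  ∀ δ' : Ω → ℝ, Measurable δ' → ⨆ θ ∈ Θ, risk p ρ δ θ ≤ ⨆ θ ∈ Θ, risk p ρ δ' θ

/-- The (unnormalized) expected posterior loss of the estimate `d` given the observation `ω`,
for the prior measure `prior l`. -/
def posteriorLoss (p : ℝ × ℝ → Ω → ℝ≥0∞) (ρ : ℝ → ℝ) (l : ℝ) (ω : Ω) (d : ℝ) : ℝ≥0∞ :=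
  ∫⁻ θ, ENNReal.ofReal (ρ ((d - θ.1) / θ.2)) * p θ ω ∂prior l

/-- `δ` is a generalized Bayes estimator for `prior l`: for almost every observation the estimate
has finite expected posterior loss, and minimizes it. -/
def IsGeneralizedBayes (p : ℝ × ℝ → Ω → ℝ≥0∞) (ρ : ℝ → ℝ) (l : ℝ) (δ : Ω → ℝ) : Prop :=
  ∀ᵐ ω : Ω, posteriorLoss p ρ l ω (δ ω) < ∞ ∧
    ∀ d, posteriorLoss p ρ l ω (δ ω) ≤ posteriorLoss p ρ l ω d

end Decision

/-- `c₀` is the constant of the minimum risk equivariant estimator `X + c₀ S`: it minimizes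
`c ↦ E_{0,1} [ρ (X + c S)]`, and the minimum is finite. -/
def IsMREConstant (n : ℕ) (f ρ : ℝ → ℝ) (c₀ : ℝ) : Prop :=
  risk (reducedDensity n f) ρ (fun ω => ω.1 + c₀ * ω.2) (0, 1) < ∞ ∧
    ∀ c : ℝ, risk (reducedDensity n f) ρ (fun ω => ω.1 + c₀ * ω.2) (0, 1) ≤
      risk (reducedDensity n f) ρ (fun ω => ω.1 + c * ω.2) (0, 1)

end BoundedMean

end

open Filter Topology

/-! ### Losses, generators, and the loss along a ray -/

namespace BoundedMean

/-! Everything is read off along rays. An estimate at the observation (x,s) is written x + g s, and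
t = x/s. With z = (x-μ)/s and v = s/σ, the posterior loss for the prior σ^{-(l+1)} becomes, up to a
power of s, `truncLoss ρ f (n+l) t g`: the integral of `rayLoss ρ f (n+l) z g` over z < t, where the
cut-off is the constraint μ ≥ 0. The risk of X + gS is, up to normalization, the integral of
`rayLoss ρ f n z g` over all z. It does not depend on θ, and a reflection argument shows that g = 0
is a best choice, so X attains the minimum equivariant risk (`setLIntegral_rayLoss_zero_le`). At μ =
0 the variable z is the observed ratio x/s, so the boundary risk of any estimator is the integral
over z of its loss on the ray z.

The bridge between the two is the prior l = 0, whose posterior weight n agrees with that of the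
risk. A leader γ(t) minimizes `truncLoss` with weight n over g ≥ 0; let M(t) be the minimum. By an
envelope argument M'(t) is at most the loss of γ(t) on the ray t. Moreover M tends to 0 at -∞, and
M(B) is at least the loss of X over -B < z < B. Hence the losses of the leaders along all rays add
up to at least the equivariant risk (`lintegral_rayLoss_zero_lt`). If the Bayes estimate for l < 0
is strictly above every leader, then, leaders giving nonnegative estimates, its loss at μ = 0 is
strictly larger on almost every ray. Its boundary risk then exceeds the constant risk of the
equivariant estimator, which also refutes minimaxity.

The strict comparison of minimizers for the weights n+l < n is a sign-change argument. In the normal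
convex case the g-derivative of the loss at fixed scale v changes sign only once in v, from negative
to positive (`sliceDeriv_pos_of_lt`), and passing to weight n multiplies by the increasing factor
v^{-l}; so the derivative at the Bayes estimate becomes strictly positive. Infinite losses are kept
away by an inversion of the half-line z < t, which confines the leaders to t + g < √(t²+1)
(`integral_lossDeriv_pos`). For |x|^p homogeneity removes f from the minimization. If p ≥ 1 this
reduces to the normal case; if p < 1 convexity fails, and the sign change is found in |z| after
folding the line at 0 (`setIntegral_pos_of_fold_crossing`).

When (X,U) is observed, polar coordinates for U show that along almost every direction the estimator
is a generalized Bayes estimator of the reduced problem; the strict inequality is then integrated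
over the sphere. -/

/-- Even continuous losses which increase strictly and without bound on `[0,∞)`. -/
structure IsEvenLoss (ρ : ℝ → ℝ) : Prop where
  even : ∀ x, ρ (-x) = ρ x
  zero : ρ 0 = 0
  cont : Continuous ρ
  strictMono : StrictMonoOn ρ (Ici 0)
  tendsto : Tendsto ρ atTop atTop

/-- Measurable generators which are positive and nonincreasing on `(0,∞)`. -/
structure IsDecreasingGenerator (f : ℝ → ℝ) : Prop where
  pos : ∀ t, 0 < t → 0 < f t
  meas : Measurable f
  anti : AntitoneOn f (Ioi 0)

namespace IsEvenLoss

variable {ρ : ℝ → ℝ}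

theorem abs_eq (hρ : IsEvenLoss ρ) (x : ℝ) : ρ |x| = ρ x := by
  rcases abs_cases x with ⟨h, _⟩ | ⟨h, _⟩ <;> rw [h]
  exact hρ.even x

theorem mono (hρ : IsEvenLoss ρ) {x y : ℝ} (h : |x| ≤ |y|) : ρ x ≤ ρ y := by
  rw [← hρ.abs_eq x, ← hρ.abs_eq y]
  exact hρ.strictMono.monotoneOn (abs_nonneg x) (abs_nonneg y) h

theorem lt (hρ : IsEvenLoss ρ) {x y : ℝ} (h : |x| < |y|) : ρ x < ρ y := by
  rw [← hρ.abs_eq x, ← hρ.abs_eq y]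
  exact hρ.strictMono (abs_nonneg x) (abs_nonneg y) h

theorem nonneg (hρ : IsEvenLoss ρ) (x : ℝ) : 0 ≤ ρ x := by
  rw [← hρ.zero]; exact hρ.mono (by simp)

theorem pos (hρ : IsEvenLoss ρ) {x : ℝ} (h : x ≠ 0) : 0 < ρ x := by
  rw [← hρ.zero]; exact hρ.lt (by simpa using h)

end IsEvenLoss

/-- The expected loss along the ray of observations in direction `(z, 1)` of the estimate
`z + g`, with weight `v ^ a`. -/
noncomputable def rayLoss (ρ f : ℝ → ℝ) (a z g : ℝ) : ℝ≥0∞ :=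
  ∫⁻ v in Ioi (0 : ℝ), ENNReal.ofReal (ρ (v * (z + g))) *
    ENNReal.ofReal (v ^ a * f (v ^ 2 * (z ^ 2 + 1)))

/-- The expected posterior loss of the estimate `t + g` after observing `(t, 1)`. -/
noncomputable def truncLoss (ρ f : ℝ → ℝ) (a t g : ℝ) : ℝ≥0∞ :=
  ∫⁻ z in Iio t, rayLoss ρ f a z g

/-! ### Changes of variable and the scaling of rays -/

section Scaling

theorem lintegral_Ioi_eq_mul_left {c : ℝ} (hc : 0 < c) (F : ℝ → ℝ≥0∞) :
    ∫⁻ v in Ioi (0 : ℝ), F v = ENNReal.ofReal c * ∫⁻ w in Ioi (0 : ℝ), F (c * w) := by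
  have himg : (fun w : ℝ => c * w) '' Ioi 0 = Ioi 0 := by
    rw [Set.image_mul_left_Ioi hc]; simp
  rw [← himg, lintegral_image_eq_lintegral_abs_deriv_mul (f := fun w : ℝ => c * w)
    (f' := fun _ => c) measurableSet_Ioi
    (fun x _ => ((hasDerivAt_id x).const_mul c |>.hasDerivWithinAt).congr_deriv (by simp))
    (fun x _ y _ h => mul_left_cancel₀ hc.ne' h), himg, abs_of_pos hc,
    lintegral_const_mul' _ _ ENNReal.ofReal_ne_top]

theorem lintegral_Ioi_eq_div {s : ℝ} (hs : 0 < s) (F : ℝ → ℝ≥0∞) :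
    ∫⁻ τ in Ioi (0 : ℝ), F τ =
      ∫⁻ v in Ioi (0 : ℝ), ENNReal.ofReal (s / v ^ 2) * F (s / v) := by
  have himg : (fun w : ℝ => s / w) '' Ioi 0 = Ioi 0 := by
    ext x; constructor
    · rintro ⟨w, hw, rfl⟩; exact div_pos hs hw
    · intro hx; exact ⟨s / x, div_pos hs hx, by field_simp⟩
  rw [← himg, lintegral_image_eq_lintegral_abs_deriv_mul (f' := fun x => -(s / x ^ 2))
    measurableSet_Ioi
    (fun x hx => ?_) (fun x hx y hy h => ?_), himg]
  · refine setLIntegral_congr_fun measurableSet_Ioi fun v hv => ?_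
    rw [abs_neg, abs_of_pos (by have : 0 < v := hv; positivity)]
  · have hx' : x ≠ 0 := ne_of_gt hx
    have := ((hasDerivAt_inv hx').const_mul s).hasDerivWithinAt (s := Ioi 0)
    refine (this.congr_deriv (by ring))
  · have hx' : x ≠ 0 := ne_of_gt hx
    have hy' : y ≠ 0 := ne_of_gt hy
    field_simp at h
    exact h.symm

theorem lintegral_affine {c : ℝ} (hc : 0 < c) (b : ℝ) (F : ℝ → ℝ≥0∞) :
    ∫⁻ x, F x = ENNReal.ofReal c * ∫⁻ z, F (b + c * z) := by
  have himg : (fun w : ℝ => b + c * w) '' univ = univ := by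
    rw [image_univ, range_eq_univ]
    intro y; exact ⟨(y - b) / c, by field_simp; ring⟩
  have := lintegral_image_eq_lintegral_abs_deriv_mul (s := univ) (f := fun w : ℝ => b + c * w)
    (f' := fun _ => c) MeasurableSet.univ
    (fun x _ => (((hasDerivAt_id x).const_mul c).const_add b |>.hasDerivWithinAt).congr_deriv
      (by simp))
    (fun x _ y _ h => mul_left_cancel₀ hc.ne' (add_left_cancel h)) F
  rw [himg, setLIntegral_univ, setLIntegral_univ, abs_of_pos hc,
    lintegral_const_mul' _ _ ENNReal.ofReal_ne_top] at this
  exact this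

theorem lintegral_Ioi_sub_mul {s : ℝ} (hs : 0 < s) (x : ℝ) (F : ℝ → ℝ≥0∞) :
    ∫⁻ μ in Ioi (0 : ℝ), F μ = ENNReal.ofReal s * ∫⁻ z in Iio (x / s), F (x - s * z) := by
  have himg : (fun z : ℝ => x - s * z) '' Iio (x / s) = Ioi 0 := by
    ext y; constructor
    · rintro ⟨w, hw, rfl⟩
      have : w < x / s := hw
      rw [lt_div_iff₀ hs] at this
      simp only [mem_Ioi]; linarith
    · intro hy
      have hy : 0 < y := hy
      refine ⟨(x - y) / s, ?_, by field_simp; ring⟩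
      simp only [mem_Iio]; gcongr; linarith
  rw [← himg, lintegral_image_eq_lintegral_abs_deriv_mul (f := fun z : ℝ => x - s * z)
    (f' := fun _ => -s) measurableSet_Iio
    (fun z _ => (((hasDerivAt_id z).const_mul s).const_sub x |>.hasDerivWithinAt).congr_deriv
      (by simp))
    (fun x _ y _ h => mul_left_cancel₀ hs.ne' (by simpa using h)), abs_neg, abs_of_pos hs,
    lintegral_const_mul' _ _ ENNReal.ofReal_ne_top]

theorem rayLoss_scale {ρ f : ℝ → ℝ} (a z g : ℝ) {c : ℝ} (hc : 0 < c) :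
    rayLoss ρ f a z g = ENNReal.ofReal (c ^ (a + 1)) *
      ∫⁻ w in Ioi (0 : ℝ), ENNReal.ofReal (ρ (w * (c * (z + g)))) *
        ENNReal.ofReal (w ^ a * f (w ^ 2 * (c ^ 2 * (z ^ 2 + 1)))) := by
  rw [rayLoss, lintegral_Ioi_eq_mul_left hc, Real.rpow_add hc, Real.rpow_one, mul_comm (c ^ a),
    ENNReal.ofReal_mul hc.le, mul_assoc]
  congr 1
  rw [← lintegral_const_mul' _ _ ENNReal.ofReal_ne_top]
  refine setLIntegral_congr_fun measurableSet_Ioi fun w hw => ?_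
  have hw : 0 < w := hw
  rw [Real.mul_rpow hc.le hw.le, mul_assoc (c ^ a), ENNReal.ofReal_mul (by positivity),
    mul_left_comm (ENNReal.ofReal (c ^ a)),
    show c * w * (z + g) = w * (c * (z + g)) by ring,
    show (c * w) ^ 2 * (z ^ 2 + 1) = w ^ 2 * (c ^ 2 * (z ^ 2 + 1)) by ring]

/-- Rescaling v by √(z²+1) carries the ray z to the ray 0. All rays thus share one function of the
normalized estimate (z+g)/√(z²+1), and finiteness and continuity need only be studied at z = 0. -/
theorem rayLoss_eq_zero_ray {ρ f : ℝ → ℝ} (a z g : ℝ) :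
    rayLoss ρ f a z g = ENNReal.ofReal ((z ^ 2 + 1) ^ (-((a + 1) / 2))) *
      rayLoss ρ f a 0 ((z + g) / √(z ^ 2 + 1)) := by
  have h1 : 0 < z ^ 2 + 1 := by positivity
  have h2 : 0 < √(z ^ 2 + 1) := Real.sqrt_pos.2 h1
  rw [rayLoss_scale a z g (inv_pos.2 h2), rayLoss]
  congr 1
  · rw [Real.sqrt_eq_rpow, ← Real.rpow_neg_one, ← Real.rpow_mul h1.le, ← Real.rpow_mul h1.le]
    congr 2; ring
  · refine setLIntegral_congr_fun measurableSet_Ioi fun w hw => ?_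
    rw [inv_pow, Real.sq_sqrt h1.le, inv_mul_cancel₀ h1.ne']
    congr 3
    · ring
    · norm_num

end Scaling

/-! ### Measurability and monotonicity of the loss integrals -/

section Basic

variable {ρ f : ℝ → ℝ}

theorem measurable_rayLoss_integrand (hρ : Measurable ρ) (hf : Measurable f) (a : ℝ) :
    Measurable fun q : (ℝ × ℝ) × ℝ => ENNReal.ofReal (ρ (q.2 * (q.1.1 + q.1.2))) *
      ENNReal.ofReal (q.2 ^ a * f (q.2 ^ 2 * (q.1.1 ^ 2 + 1))) := by
  have : Measurable fun q : (ℝ × ℝ) × ℝ => f (q.2 ^ 2 * (q.1.1 ^ 2 + 1)) :=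
    hf.comp (by fun_prop)
  have h2 : Measurable fun q : (ℝ × ℝ) × ℝ => ρ (q.2 * (q.1.1 + q.1.2)) :=
    hρ.comp (by fun_prop)
  fun_prop

theorem measurable_rayLoss_uncurry (hρ : Measurable ρ) (hf : Measurable f) (a : ℝ) :
    Measurable fun q : ℝ × ℝ => rayLoss ρ f a q.1 q.2 :=
  (measurable_rayLoss_integrand hρ hf a).lintegral_prod_right'

theorem measurable_rayLoss (hρ : Measurable ρ) (hf : Measurable f) (a g : ℝ) :
    Measurable fun z => rayLoss ρ f a z g :=
  (measurable_rayLoss_uncurry hρ hf a).comp (by fun_prop : Measurable fun z : ℝ => (z, g))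

theorem rayLoss_mono (hρ : IsEvenLoss ρ) {a z g g' : ℝ} (h : |z + g| ≤ |z + g'|) :
    rayLoss ρ f a z g ≤ rayLoss ρ f a z g' := by
  refine lintegral_mono fun v => ?_
  gcongr
  refine hρ.mono ?_
  rw [abs_mul, abs_mul]
  gcongr

theorem rayLoss_strictMono (hρ : IsEvenLoss ρ) (hf : IsDecreasingGenerator f) {a z g g' : ℝ}
    (h : |z + g| < |z + g'|) (hfin : rayLoss ρ f a z g ≠ ∞) :
    rayLoss ρ f a z g < rayLoss ρ f a z g' := by
  refine lintegral_strict_mono (by simp) ?_ hfin ?_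
  · exact ((measurable_rayLoss_integrand hρ.cont.measurable hf.meas a).comp
      (by fun_prop : Measurable fun v : ℝ => ((z, g'), v))).aemeasurable
  · refine (ae_restrict_iff' measurableSet_Ioi).2 (Eventually.of_forall fun v hv => ?_)
    have hv : 0 < v := hv
    have h1 : 0 < v ^ a * f (v ^ 2 * (z ^ 2 + 1)) :=
      mul_pos (Real.rpow_pos_of_pos hv a) (hf.pos _ (by positivity))
    have h2 : ρ (v * (z + g)) < ρ (v * (z + g')) := hρ.lt (by
      rw [abs_mul, abs_mul]
      exact mul_lt_mul_of_pos_left h (abs_pos.2 hv.ne'))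
    refine ENNReal.mul_lt_mul_left (by simpa using h1) ENNReal.ofReal_ne_top ?_
    exact (ENNReal.ofReal_lt_ofReal_iff ((hρ.nonneg _).trans_lt h2)).2 h2

theorem truncLoss_mono_left {a t t' g : ℝ} (h : t ≤ t') :
    truncLoss ρ f a t g ≤ truncLoss ρ f a t' g :=
  lintegral_mono_set (Iio_subset_Iio h)

theorem truncLoss_mono (hρ : IsEvenLoss ρ) {a t g g' : ℝ}
    (h : ∀ z < t, |z + g| ≤ |z + g'|) : truncLoss ρ f a t g ≤ truncLoss ρ f a t g' :=
  setLIntegral_mono' measurableSet_Iio fun z hz => rayLoss_mono hρ (h z hz)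

theorem truncLoss_strictMono (hρ : IsEvenLoss ρ) (hf : IsDecreasingGenerator f) {a t g g' : ℝ}
    (h : ∀ z < t, |z + g| < |z + g'|) (hfin : truncLoss ρ f a t g ≠ ∞) :
    truncLoss ρ f a t g < truncLoss ρ f a t g' := by
  have hm := measurable_rayLoss hρ.cont.measurable hf.meas a
  refine lintegral_strict_mono (by simp) (hm g').aemeasurable hfin ?_
  filter_upwards [ae_lt_top (hm g) hfin, ae_restrict_mem measurableSet_Iio] with z hz hzt
  exact rayLoss_strictMono hρ hf (h z hzt) hz.ne

theorem truncLoss_add {a t t' g : ℝ} (h : t ≤ t') :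
    truncLoss ρ f a t' g = truncLoss ρ f a t g + ∫⁻ z in Ico t t', rayLoss ρ f a z g := by
  rw [truncLoss, truncLoss, ← Iio_union_Ico_eq_Iio h]
  exact lintegral_union measurableSet_Ico
    (Set.disjoint_left.2 fun x hx hx' => absurd hx'.1 (not_le.2 hx))

end Basic

/-! ### Rearrangement: g = 0 is best without truncation -/

section Rearrangement

theorem mul_add_mul_le_of_le {x y p q : ℝ≥0∞} (h : x ≤ y) (h' : p ≤ q) :
    x * q + y * p ≤ x * p + y * q := by
  obtain ⟨c, rfl⟩ := le_iff_exists_add.1 h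
  calc x * q + (x + c) * p = x * p + (x * q + c * p) := by ring
    _ ≤ x * p + (x * q + c * q) := by gcongr
    _ = x * p + (x + c) * q := by ring

/-- Pairwise rearrangement by the reflection `z ↦ e - z`. -/
theorem lintegral_mul_le_lintegral_sub_mul {ρ : ℝ → ℝ≥0∞} {ζ : ℝ → ℝ≥0∞} (hρm : Measurable ρ)
    (hζm : Measurable ζ) (hρ : ∀ x y, |x| ≤ |y| → ρ x ≤ ρ y) (e : ℝ)
    (hζ : ∀ z, |z - e| ≤ |z| → ζ z ≤ ζ (e - z)) :
    ∫⁻ z, ρ z * ζ z ≤ ∫⁻ z, ρ (z - e) * ζ z := by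
  have hev : ∀ x, ρ (-x) = ρ x := fun x =>
    le_antisymm (hρ _ _ (by simp)) (hρ _ _ (by simp))
  have hrefl : ∀ F : ℝ → ℝ≥0∞, ∫⁻ z, F z = ∫⁻ z, F (e - z) := fun F =>
    (lintegral_sub_left_eq_self F e).symm
  -- Both sides are doubled and one copy of each is reflected, so that the points z and e - z are
  -- compared together, pointwise.
  have key : (∫⁻ z, ρ z * ζ z) + ∫⁻ z, ρ z * ζ z ≤
      (∫⁻ z, ρ (z - e) * ζ z) + ∫⁻ z, ρ (z - e) * ζ z := by
    nth_rewrite 1 [hrefl (fun z => ρ z * ζ z)]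
    nth_rewrite 1 [hrefl (fun z => ρ (z - e) * ζ z)]
    rw [← lintegral_add_right _ (by fun_prop), ← lintegral_add_right _ (by fun_prop)]
    refine lintegral_mono fun z => ?_
    have h1 : e - z - e = -z := by ring
    have h2 : ρ (e - z) = ρ (z - e) := by rw [← hev]; congr 1; ring
    simp only [h1, h2, hev]
    rcases le_total |z - e| |z| with h | h
    · rw [add_comm (ρ z * ζ (e - z))]
      exact mul_add_mul_le_of_le (hρ _ _ h) (hζ z h)
    · have h' : |e - z - e| ≤ |e - z| := by
        rw [h1, abs_neg, abs_sub_comm e z]; exact h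
      have h3 := hζ (e - z) h'
      rw [sub_sub_cancel] at h3
      refine le_trans (add_comm _ _).le (mul_add_mul_le_of_le (hρ _ _ h) h3)
  rw [← two_mul, ← two_mul] at key
  exact (ENNReal.mul_le_mul_iff_right (by norm_num) (by norm_num)).1 key

end Rearrangement

end BoundedMean

namespace BoundedMean

variable {ρ f : ℝ → ℝ}

section Symmetrization

/-- At a fixed scale v the weight f(v²(z²+1)) decreases in |z|, and z ↦ -g - z exchanges |z| and
|z+g|; pairing the two points puts the smaller loss with the larger weight exactly when g = 0. Only
reflections that decrease |z| need stay in S, which covers the symmetric intervals, and the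
half-lines z < t when g ≤ 0. -/
theorem setLIntegral_rayLoss_zero_le (hρ : IsEvenLoss ρ) (hf : IsDecreasingGenerator f) (a g : ℝ)
    {S : Set ℝ} (hS : MeasurableSet S) (h : ∀ z ∈ S, |z + g| ≤ |z| → -g - z ∈ S) :
    ∫⁻ z in S, rayLoss ρ f a z 0 ≤ ∫⁻ z in S, rayLoss ρ f a z g := by
  have hm := measurable_rayLoss_integrand hρ.cont.measurable hf.meas a
  have hswap : ∀ g, ∫⁻ z in S, rayLoss ρ f a z g = ∫⁻ v in Ioi (0 : ℝ), ∫⁻ z in S,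
      ENNReal.ofReal (ρ (v * (z + g))) * ENNReal.ofReal (v ^ a * f (v ^ 2 * (z ^ 2 + 1))) := by
    intro g
    simp only [rayLoss]
    refine lintegral_lintegral_swap ?_
    exact (hm.comp (by fun_prop : Measurable fun q : ℝ × ℝ => ((q.1, g), q.2))).aemeasurable
  rw [hswap, hswap]
  refine setLIntegral_mono' measurableSet_Ioi fun v hv => ?_
  have hv : 0 < v := hv
  have hfm := hf.meas
  have hρm := hρ.cont.measurable
  have key := lintegral_mul_le_lintegral_sub_mul (ρ := fun x => ENNReal.ofReal (ρ (v * x)))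
    (ζ := S.indicator fun z => ENNReal.ofReal (v ^ a * f (v ^ 2 * (z ^ 2 + 1))))
    (by fun_prop) (Measurable.indicator (by fun_prop) hS)
    (fun x y hxy => by
      refine ENNReal.ofReal_le_ofReal (hρ.mono ?_)
      rw [abs_mul, abs_mul]; gcongr) (-g)
    (fun z hz => by
      rw [sub_neg_eq_add] at hz
      by_cases hzS : z ∈ S
      · rw [indicator_of_mem hzS, indicator_of_mem (h z hzS hz)]
        refine ENNReal.ofReal_le_ofReal ?_
        have h1 : (-g - z) ^ 2 ≤ z ^ 2 := by
          rw [← sq_abs z, ← sq_abs (-g - z), show -g - z = -(z + g) by ring, abs_neg]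
          gcongr
        have h2 : f (v ^ 2 * (z ^ 2 + 1)) ≤ f (v ^ 2 * ((-g - z) ^ 2 + 1)) :=
          hf.anti (mem_Ioi.2 (by positivity)) (mem_Ioi.2 (by positivity)) (by gcongr)
        gcongr
      · simp [hzS])
  rw [← lintegral_indicator hS, ← lintegral_indicator hS]
  refine le_trans (le_of_eq (lintegral_congr fun z => ?_))
    (key.trans (le_of_eq (lintegral_congr fun z => ?_)))
  · by_cases hz : z ∈ S <;> simp [hz]
  · by_cases hz : z ∈ S <;> simp [hz]

end Symmetrization

/-! ### Semicontinuity and continuity of the losses -/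

section Semicontinuity

theorem le_liminf_rayLoss (hρ : IsEvenLoss ρ) (hf : IsDecreasingGenerator f) (a z g : ℝ)
    {ι : Type*} {u : Filter ι} [u.IsCountablyGenerated] {γ : ι → ℝ} (hγ : Tendsto γ u (𝓝 g)) :
    rayLoss ρ f a z g ≤ liminf (fun i => rayLoss ρ f a z (γ i)) u := by
  refine le_trans ?_ (lintegral_liminf_le fun i =>
    (measurable_rayLoss_integrand hρ.cont.measurable hf.meas a).comp
      (by fun_prop : Measurable fun v : ℝ => ((z, γ i), v)))
  refine lintegral_mono fun v => ?_
  rcases u.eq_or_neBot with rfl | hu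
  · simp [liminf, limsInf]
  refine (Tendsto.liminf_eq ?_).ge
  refine ENNReal.Tendsto.mul_const ?_ (Or.inr ENNReal.ofReal_ne_top)
  refine (ENNReal.continuous_ofReal.tendsto _).comp ((hρ.cont.tendsto _).comp ?_)
  exact tendsto_const_nhds.mul (tendsto_const_nhds.add hγ)

/-- Fatou's lemma, which needs no finiteness. The semicontinuity is joint in t and g because z < t
is an open condition on t. -/
theorem lowerSemicontinuous_truncLoss (hρ : IsEvenLoss ρ) (hf : IsDecreasingGenerator f) (a : ℝ) :
    LowerSemicontinuous fun p : ℝ × ℝ => truncLoss ρ f a p.1 p.2 := by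
  refine fun p => lowerSemicontinuousAt_iff_le_liminf.2 ?_
  have hind : ∀ p : ℝ × ℝ, truncLoss ρ f a p.1 p.2 =
      ∫⁻ z, (Iio p.1).indicator (fun z => rayLoss ρ f a z p.2) z := fun p => by
    rw [lintegral_indicator measurableSet_Iio]; rfl
  simp only [hind]
  refine le_trans ?_ (lintegral_liminf_le fun i =>
    (measurable_rayLoss hρ.cont.measurable hf.meas a i.2).indicator measurableSet_Iio)
  refine lintegral_mono fun z => ?_
  by_cases hz : z < p.1
  · rw [indicator_of_mem (mem_Iio.2 hz)]
    refine (le_liminf_rayLoss hρ hf a z p.2 (u := 𝓝 p) (γ := Prod.snd)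
      (continuous_snd.tendsto p)).trans (le_of_eq (liminf_congr ?_))
    have : ∀ᶠ q : ℝ × ℝ in 𝓝 p, z < q.1 := continuous_fst.tendsto p (Ioi_mem_nhds hz)
    filter_upwards [this] with q hq
    rw [indicator_of_mem (mem_Iio.2 hq)]
  · rw [indicator_of_notMem (by simpa using hz)]
    exact zero_le

/-- Rays through which the normalized loss stays finite have a continuous `rayLoss`. -/
theorem continuousAt_rayLoss_zero (hρ : IsEvenLoss ρ) (hf : IsDecreasingGenerator f) {a q q' : ℝ}
    (h : |q| < q') (hfin : rayLoss ρ f a 0 q' ≠ ∞) :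
    ContinuousAt (fun q => rayLoss ρ f a 0 q) q := by
  have hm := measurable_rayLoss_integrand hρ.cont.measurable hf.meas a
  refine tendsto_lintegral_filter_of_dominated_convergence
    (fun v => ENNReal.ofReal (ρ (v * (0 + q'))) *
      ENNReal.ofReal (v ^ a * f (v ^ 2 * (0 ^ 2 + 1)))) ?_ ?_ hfin ?_
  · exact Eventually.of_forall fun q => hm.comp
      (by fun_prop : Measurable fun v : ℝ => (((0 : ℝ), q), v))
  · have : ∀ᶠ y in 𝓝 q, |y| < q' := continuous_abs.tendsto q (Iio_mem_nhds h)
    filter_upwards [this] with y hy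
    refine Eventually.of_forall fun v => ?_
    gcongr
    refine hρ.mono ?_
    rw [abs_mul, abs_mul, zero_add, zero_add]
    have := hy.le.trans (le_abs_self q')
    gcongr
  · refine Eventually.of_forall fun v => ?_
    refine ENNReal.Tendsto.mul_const ?_ (Or.inr ENNReal.ofReal_ne_top)
    have : Continuous fun y : ℝ => ENNReal.ofReal (ρ (v * (0 + y))) := by
      have := hρ.cont
      exact ENNReal.continuous_ofReal.comp (by fun_prop)
    exact this.tendsto q

theorem continuousAt_rayLoss (hρ : IsEvenLoss ρ) (hf : IsDecreasingGenerator f) {a z g q' : ℝ}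
    (h : |z + g| / √(z ^ 2 + 1) < q') (hfin : rayLoss ρ f a 0 q' ≠ ∞) :
    ContinuousAt (fun p : ℝ × ℝ => rayLoss ρ f a p.1 p.2) (z, g) := by
  have h1 : ∀ x : ℝ, 0 < √(x ^ 2 + 1) := fun x => Real.sqrt_pos.2 (by positivity)
  have hc : ContinuousAt (fun p : ℝ × ℝ => (p.1 + p.2) / √(p.1 ^ 2 + 1)) (z, g) := by
    refine ContinuousAt.div (by fun_prop) (by fun_prop) (h1 z).ne'
  have hK : ContinuousAt (fun p : ℝ × ℝ => rayLoss ρ f a 0 ((p.1 + p.2) / √(p.1 ^ 2 + 1)))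
      (z, g) := by
    refine ContinuousAt.comp (f := fun p : ℝ × ℝ => (p.1 + p.2) / √(p.1 ^ 2 + 1))
      (g := fun q => rayLoss ρ f a 0 q) ?_ hc
    refine continuousAt_rayLoss_zero hρ hf (q' := q') ?_ hfin
    simpa [abs_div, abs_of_pos (h1 z)] using h
  have : (fun p : ℝ × ℝ => rayLoss ρ f a p.1 p.2) = fun p : ℝ × ℝ =>
      ENNReal.ofReal ((p.1 ^ 2 + 1) ^ (-((a + 1) / 2))) *
        rayLoss ρ f a 0 ((p.1 + p.2) / √(p.1 ^ 2 + 1)) := by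
    funext p; exact rayLoss_eq_zero_ray a p.1 p.2
  rw [this]
  refine ENNReal.Tendsto.mul ?_ (Or.inl ?_) hK (Or.inr ENNReal.ofReal_ne_top)
  · refine (ENNReal.continuous_ofReal.tendsto _).comp ?_
    exact ContinuousAt.rpow_const (f := fun p : ℝ × ℝ => p.1 ^ 2 + 1) (by fun_prop)
      (Or.inl (by positivity))
  · have : 0 < (z ^ 2 + 1) ^ (-((a + 1) / 2)) := Real.rpow_pos_of_pos (by positivity) _
    simpa using this

end Semicontinuity

/-! ### Leaders: coercivity and existence -/

section Leader

/-- `g` minimizes `truncLoss ρ f a t` among the nonnegative `g`, and `t + g ≥ 0`. -/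
structure IsLeader (ρ f : ℝ → ℝ) (a t g : ℝ) : Prop where
  nonneg : 0 ≤ g
  add_nonneg : 0 ≤ t + g
  le : ∀ g', 0 ≤ g' → truncLoss ρ f a t g ≤ truncLoss ρ f a t g'

/-- A negative estimate is farther from every admissible mean than the estimate 0, which is g = -t.
-/
theorem truncLoss_max_le (hρ : IsEvenLoss ρ) (a t g : ℝ) :
    truncLoss ρ f a t (max g (-t)) ≤ truncLoss ρ f a t g := by
  refine truncLoss_mono hρ fun z hz => ?_
  rcases le_total (-t) g with h | h
  · rw [max_eq_left h]
  · rw [max_eq_right h, abs_of_nonpos (by linarith), abs_of_nonpos (by linarith)]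
    linarith

theorem setLIntegral_pos {S : Set ℝ} (hS : MeasurableSet S) (hS0 : volume S ≠ 0) {F : ℝ → ℝ≥0∞}
    (hF : Measurable F) (h : ∀ x ∈ S, 0 < F x) : 0 < ∫⁻ x in S, F x := by
  have := setLIntegral_strict_mono (μ := volume) (f := 0) hS hS0 hF (by simp)
    (Eventually.of_forall h)
  simpa using this

/-- Coercivity already comes from the piece A - 1 < z < A, v > 1: its weight is positive, and there
the error v(z+g) is at least R once g ≥ R + 1 - A. -/
theorem exists_forall_lt_truncLoss (hρ : IsEvenLoss ρ) (hf : IsDecreasingGenerator f) (a A : ℝ)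
    {C : ℝ≥0∞} (hC : C ≠ ∞) : ∃ G, ∀ g, G ≤ g → C < truncLoss ρ f a A g := by
  have hm : Measurable fun q : ℝ × ℝ => ENNReal.ofReal (q.2 ^ a * f (q.2 ^ 2 * (q.1 ^ 2 + 1))) := by
    have : Measurable fun q : ℝ × ℝ => f (q.2 ^ 2 * (q.1 ^ 2 + 1)) := hf.meas.comp (by fun_prop)
    exact ((measurable_snd.pow_const a).mul this).ennreal_ofReal
  set c : ℝ≥0∞ := ∫⁻ z in Ioo (A - 1) A, ∫⁻ v in Ioi (1 : ℝ),
    ENNReal.ofReal (v ^ a * f (v ^ 2 * (z ^ 2 + 1))) with hc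
  have hc0 : 0 < c := by
    refine setLIntegral_pos measurableSet_Ioo (by simp) hm.lintegral_prod_right' fun z _ => ?_
    refine setLIntegral_pos measurableSet_Ioi (by simp)
      (hm.comp (by fun_prop : Measurable fun v : ℝ => (z, v))) fun v hv => ?_
    have hv : 0 < v := zero_lt_one.trans hv
    exact ENNReal.ofReal_pos.2 (mul_pos (Real.rpow_pos_of_pos hv a) (hf.pos _ (by positivity)))
  have hlim : Tendsto (fun R => ENNReal.ofReal (ρ R) * c) atTop (𝓝 ∞) := by
    have := ENNReal.Tendsto.mul_const (b := c)
      (ENNReal.tendsto_ofReal_atTop.comp hρ.tendsto) (Or.inl ENNReal.top_ne_zero)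
    simpa [ENNReal.top_mul hc0.ne'] using this
  obtain ⟨R, hR, hR0⟩ := ((hlim.eventually (lt_mem_nhds (lt_top_iff_ne_top.2 hC))).and
    (eventually_ge_atTop 0)).exists
  refine ⟨R + 1 - A, fun g hg => hR.trans_le ?_⟩
  calc ENNReal.ofReal (ρ R) * c = ∫⁻ z in Ioo (A - 1) A, ∫⁻ v in Ioi (1 : ℝ),
        ENNReal.ofReal (ρ R) * ENNReal.ofReal (v ^ a * f (v ^ 2 * (z ^ 2 + 1))) := by
        rw [hc, ← lintegral_const_mul _ hm.lintegral_prod_right']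
        refine lintegral_congr fun z => ?_
        rw [lintegral_const_mul]
        exact hm.comp (by fun_prop : Measurable fun v : ℝ => (z, v))
    _ ≤ ∫⁻ z in Ioo (A - 1) A, rayLoss ρ f a z g := by
        refine setLIntegral_mono' measurableSet_Ioo fun z hz => ?_
        refine le_trans (setLIntegral_mono' measurableSet_Ioi fun v hv => ?_)
          (lintegral_mono_set (Ioi_subset_Ioi zero_le_one))
        gcongr
        refine hρ.mono ?_
        have hv : 1 < v := hv
        have h1 : R ≤ z + g := by linarith [hz.1]
        rw [abs_of_nonneg hR0, abs_of_nonneg (by nlinarith)]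
        nlinarith
    _ ≤ truncLoss ρ f a A g := lintegral_mono_set Ioo_subset_Iio_self

theorem truncLoss_zero_le (a t : ℝ) :
    truncLoss ρ f a t 0 ≤ ∫⁻ z, rayLoss ρ f a z 0 := setLIntegral_le_lintegral _ _

theorem IsLeader.truncLoss_le {a t g : ℝ} (h : IsLeader ρ f a t g) :
    truncLoss ρ f a t g ≤ ∫⁻ z, rayLoss ρ f a z 0 :=
  (h.le 0 le_rfl).trans (truncLoss_zero_le a t)

/-- Lower semicontinuity on a compact interval, with coercivity beyond it. The final projection to t
+ g ≥ 0 does not raise the loss. -/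
theorem exists_isLeader (hρ : IsEvenLoss ρ) (hf : IsDecreasingGenerator f) {a : ℝ}
    (hfin : ∫⁻ z, rayLoss ρ f a z 0 ≠ ∞) (t : ℝ) : ∃ g, IsLeader ρ f a t g := by
  obtain ⟨G, hG⟩ := exists_forall_lt_truncLoss hρ hf a t hfin
  have hlsc : LowerSemicontinuousOn (fun g => truncLoss ρ f a t g) (Icc 0 (max G 0)) :=
    (LowerSemicontinuous.comp (lowerSemicontinuous_truncLoss hρ hf a)
      (by fun_prop : Continuous fun g : ℝ => (t, g))).lowerSemicontinuousOn _
  obtain ⟨g, hg, hmin⟩ := hlsc.exists_isMinOn (nonempty_Icc.2 (le_max_right _ _)) isCompact_Icc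
  have hmin' : ∀ g', 0 ≤ g' → truncLoss ρ f a t g ≤ truncLoss ρ f a t g' := by
    intro g' hg'
    rcases le_total g' (max G 0) with h | h
    · exact hmin ⟨hg', h⟩
    · exact (hmin ⟨le_rfl, le_max_right _ _⟩).trans ((truncLoss_zero_le a t).trans
        (hG g' ((le_max_left _ _).trans h)).le)
  exact ⟨max g (-t), hg.1.trans (le_max_left _ _), by linarith [le_max_right g (-t)],
    fun g' hg' => (truncLoss_max_le hρ a t g).trans (hmin' g' hg')⟩

end Leader

end BoundedMean

namespace BoundedMean

variable {ρ f : ℝ → ℝ}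

/-! ### The envelope argument for the minimal truncated loss -/

section Leader

theorem rayLoss_ne_top (hρ : IsEvenLoss ρ) {a z g q' : ℝ}
    (h : |z + g| / √(z ^ 2 + 1) ≤ q') (hfin : rayLoss ρ f a 0 q' ≠ ∞) :
    rayLoss ρ f a z g ≠ ∞ := by
  rw [rayLoss_eq_zero_ray]
  refine ENNReal.mul_ne_top ENNReal.ofReal_ne_top (ne_top_of_le_ne_top hfin ?_)
  refine rayLoss_mono hρ ?_
  rw [zero_add, zero_add, abs_div, abs_of_nonneg (Real.sqrt_nonneg _)]
  exact h.trans (le_abs_self q')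

/-- Every leader has a normalized estimate strictly inside the region of finite loss. -/
def LeadersInterior (ρ f : ℝ → ℝ) (a : ℝ) : Prop :=
  ∀ t g, IsLeader ρ f a t g → ∃ q, (t + g) / √(t ^ 2 + 1) < q ∧ rayLoss ρ f a 0 q ≠ ∞

/-- The room beyond the normalized estimate supplies a dominating function on all nearby rays. This
is what `LeadersInterior` is for. -/
theorem LeadersInterior.continuousAt (hρ : IsEvenLoss ρ) (hf : IsDecreasingGenerator f) {a : ℝ}
    (hint : LeadersInterior ρ f a) {t g : ℝ} (hg : IsLeader ρ f a t g) :
    ContinuousAt (fun p : ℝ × ℝ => rayLoss ρ f a p.1 p.2) (t, g) ∧ rayLoss ρ f a t g ≠ ∞ := by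
  obtain ⟨q, hq, hfin⟩ := hint t g hg
  rw [← abs_of_nonneg hg.add_nonneg] at hq
  exact ⟨continuousAt_rayLoss hρ hf hq hfin, rayLoss_ne_top hρ hq.le hfin⟩

theorem LeadersInterior.eventually_lt (hρ : IsEvenLoss ρ) (hf : IsDecreasingGenerator f) {a : ℝ}
    (hint : LeadersInterior ρ f a) {t g : ℝ} (hg : IsLeader ρ f a t g) {ε : ℝ} (hε : 0 < ε) :
    ∀ᶠ p in 𝓝 (t, g), rayLoss ρ f a p.1 p.2 <
      ENNReal.ofReal ((rayLoss ρ f a t g).toReal + ε) := by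
  obtain ⟨hc, hfin⟩ := hint.continuousAt hρ hf hg
  refine hc.eventually (gt_mem_nhds ?_)
  change rayLoss ρ f a t g < _
  rw [ENNReal.ofReal_add ENNReal.toReal_nonneg hε.le, ENNReal.ofReal_toReal hfin]
  exact ENNReal.lt_add_right hfin (by simpa using hε)

theorem truncLoss_le_add (a t t' g : ℝ) :
    truncLoss ρ f a t' g ≤ truncLoss ρ f a t g + ∫⁻ z in Ico t t', rayLoss ρ f a z g := by
  rcases le_total t t' with h | h
  · exact (truncLoss_add h).le
  · exact (truncLoss_mono_left h).trans le_self_add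

theorem setLIntegral_Ico_le {F : ℝ → ℝ≥0∞} {t t' C : ℝ} (h : ∀ z ∈ Ico t t', F z ≤ ENNReal.ofReal C) :
    ∫⁻ z in Ico t t', F z ≤ ENNReal.ofReal C * ENNReal.ofReal (t' - t) := by
  refine (setLIntegral_mono' measurableSet_Ico h).trans ?_
  simp

/-- A limit of leaders is compared with a leader g₀ at the limiting t. Lower semicontinuity bounds
the limit from above, and g₀ remains a competitor at nearby t' at the extra cost of the integral
over [t,t'), which vanishes because the loss of g₀ is bounded near the ray t. -/
theorem isClosed_leaders (hρ : IsEvenLoss ρ) (hf : IsDecreasingGenerator f) {a : ℝ}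
    (hfin : ∫⁻ z, rayLoss ρ f a z 0 ≠ ∞) (hint : LeadersInterior ρ f a) :
    IsClosed {p : ℝ × ℝ | IsLeader ρ f a p.1 p.2} := by
  refine IsSeqClosed.isClosed fun x p hx hxp => ?_
  have hx1 : Tendsto (fun n => (x n).1) atTop (𝓝 p.1) := (continuous_fst.tendsto p).comp hxp
  have hx2 : Tendsto (fun n => (x n).2) atTop (𝓝 p.2) := (continuous_snd.tendsto p).comp hxp
  refine ⟨ge_of_tendsto' hx2 fun n => (hx n).nonneg,
    ge_of_tendsto' (hx1.add hx2) fun n => (hx n).add_nonneg, ?_⟩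
  obtain ⟨g₀, hg₀⟩ := exists_isLeader hρ hf hfin p.1
  intro g' hg'
  refine le_trans ?_ (hg₀.le g' hg')
  set C : ℝ := (rayLoss ρ f a p.1 g₀).toReal + 1
  have hev : ∀ᶠ s in 𝓝 p.1, ∀ z ∈ Ico p.1 s, rayLoss ρ f a z g₀ ≤ ENNReal.ofReal C := by
    have h1 : ∀ᶠ z in 𝓝 p.1, rayLoss ρ f a z g₀ < ENNReal.ofReal C :=
      (by fun_prop : Continuous fun z : ℝ => (z, g₀)).continuousAt.eventually
        (hint.eventually_lt hρ hf hg₀ one_pos)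
    obtain ⟨η, hη, hball⟩ := Metric.eventually_nhds_iff.1 h1
    filter_upwards [Metric.ball_mem_nhds p.1 hη] with s hs z hz
    refine (hball ?_).le
    rw [Metric.mem_ball, Real.dist_eq] at hs
    rw [Real.dist_eq, abs_of_nonneg (by linarith [hz.1])]
    linarith [hz.2, le_abs_self (s - p.1)]
  have hlim : Tendsto (fun n => truncLoss ρ f a p.1 g₀ +
      ENNReal.ofReal C * ENNReal.ofReal ((x n).1 - p.1)) atTop (𝓝 (truncLoss ρ f a p.1 g₀)) := by
    have h0 : Tendsto (fun n => ENNReal.ofReal ((x n).1 - p.1)) atTop (𝓝 0) := by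
      have := (ENNReal.continuous_ofReal.tendsto (p.1 - p.1)).comp (hx1.sub_const p.1)
      rwa [sub_self, ENNReal.ofReal_zero] at this
    have := tendsto_const_nhds (x := truncLoss ρ f a p.1 g₀) |>.add
      (ENNReal.Tendsto.const_mul (a := ENNReal.ofReal C) h0 (Or.inr ENNReal.ofReal_ne_top))
    simpa using this
  calc truncLoss ρ f a p.1 p.2
      ≤ liminf (fun q : ℝ × ℝ => truncLoss ρ f a q.1 q.2) (𝓝 p) :=
        (lowerSemicontinuous_truncLoss hρ hf a).le_liminf p
    _ ≤ liminf (fun n => truncLoss ρ f a (x n).1 (x n).2) atTop := hxp.liminf_le_liminf_comp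
    _ ≤ liminf (fun n => truncLoss ρ f a p.1 g₀ +
          ENNReal.ofReal C * ENNReal.ofReal ((x n).1 - p.1)) atTop := by
        refine liminf_le_liminf ?_
        filter_upwards [hx1.eventually hev] with n hn
        refine ((hx n).le g₀ hg₀.nonneg).trans ((truncLoss_le_add a p.1 (x n).1 g₀).trans ?_)
        gcongr
        exact setLIntegral_Ico_le hn
    _ = truncLoss ρ f a p.1 g₀ := hlim.liminf_eq

/-- Compactness: the leaders over [A,B] form a closed bounded set, and the local bounds given by
continuity are patched together. -/
theorem exists_rayLoss_le_of_isLeader (hρ : IsEvenLoss ρ) (hf : IsDecreasingGenerator f) {a : ℝ}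
    (hfin : ∫⁻ z, rayLoss ρ f a z 0 ≠ ∞) (hint : LeadersInterior ρ f a) (A B : ℝ) :
    ∃ C : ℝ, 0 ≤ C ∧ ∃ η > 0, ∀ t ∈ Icc A B, ∀ g, IsLeader ρ f a t g → ∀ z ∈ Icc t (t + η),
      rayLoss ρ f a z g ≤ ENNReal.ofReal C := by
  obtain ⟨G, hG⟩ := exists_forall_lt_truncLoss hρ hf a A hfin
  have hcomp : IsCompact ((Icc A B ×ˢ Icc 0 G) ∩ {p : ℝ × ℝ | IsLeader ρ f a p.1 p.2}) :=
    (isCompact_Icc.prod isCompact_Icc).inter_right (isClosed_leaders hρ hf hfin hint)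
  have key : ∃ C : ℝ, 0 ≤ C ∧ ∃ η > 0,
      ∀ p ∈ (Icc A B ×ˢ Icc 0 G) ∩ {p : ℝ × ℝ | IsLeader ρ f a p.1 p.2},
      ∀ z ∈ Icc p.1 (p.1 + η), rayLoss ρ f a z p.2 ≤ ENNReal.ofReal C := by
    refine hcomp.induction_on (p := fun s : Set (ℝ × ℝ) => ∃ C : ℝ, 0 ≤ C ∧ ∃ η > 0, ∀ p ∈ s,
      ∀ z ∈ Icc p.1 (p.1 + η), rayLoss ρ f a z p.2 ≤ ENNReal.ofReal C) ?_ ?_ ?_ ?_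
    · exact ⟨0, le_rfl, 1, one_pos, by simp⟩
    · rintro s s' hss' ⟨C, hC, η, hη, h⟩
      exact ⟨C, hC, η, hη, fun p hp => h p (hss' hp)⟩
    · rintro s s' ⟨C, hC, η, hη, h⟩ ⟨C', hC', η', hη', h'⟩
      refine ⟨max C C', le_max_of_le_left hC, min η η', lt_min hη hη', ?_⟩
      rintro p (hp | hp) z hz
      · exact (h p hp z ⟨hz.1, hz.2.trans (by gcongr; exact min_le_left _ _)⟩).trans
          (ENNReal.ofReal_le_ofReal (le_max_left _ _))
      · exact (h' p hp z ⟨hz.1, hz.2.trans (by gcongr; exact min_le_right _ _)⟩).trans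
          (ENNReal.ofReal_le_ofReal (le_max_right _ _))
    · rintro p ⟨-, hp⟩
      have h1 := hint.eventually_lt hρ hf hp one_pos
      obtain ⟨η, hη, hball⟩ := Metric.eventually_nhds_iff.1 h1
      refine ⟨Metric.ball p (η / 2), mem_nhdsWithin_of_mem_nhds (Metric.ball_mem_nhds p (by linarith)),
        _, by positivity, η / 2, by linarith, fun q hq z hz => (@hball (z, q.2) ?_).le⟩
      rw [Metric.mem_ball, Prod.dist_eq, max_lt_iff, Real.dist_eq, Real.dist_eq] at hq
      rw [Prod.dist_eq, max_lt_iff, Real.dist_eq, Real.dist_eq]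
      have h3 := abs_lt.1 hq.1
      exact ⟨abs_lt.2 ⟨by linarith [hz.1], by linarith [hz.2]⟩, by linarith [hq.2]⟩
  obtain ⟨C, hC, η, hη, h⟩ := key
  refine ⟨C, hC, η, hη, fun t ht g hg z hz => h (t, g) ⟨⟨ht, hg.nonneg, ?_⟩, hg⟩ z hz⟩
  -- Leaders over t ≥ A stay below G: otherwise their loss on z < A alone would exceed the total
  -- loss of the estimate X.
  by_contra hlt
  exact absurd ((hG g (not_le.1 hlt).le).trans_le (truncLoss_mono_left ht.1)) hg.truncLoss_le.not_gt

theorem IsLeader.truncLoss_le_add {a t t' g g' : ℝ} (h : IsLeader ρ f a t g)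
    (h' : IsLeader ρ f a t' g') :
    truncLoss ρ f a t' g' ≤ truncLoss ρ f a t g + ∫⁻ z in Ico t t', rayLoss ρ f a z g :=
  (h'.le g h.nonneg).trans (BoundedMean.truncLoss_le_add a t t' g)

theorem IsLeader.truncLoss_mono {a t t' g g' : ℝ} (h : IsLeader ρ f a t g)
    (h' : IsLeader ρ f a t' g') (htt' : t ≤ t') :
    truncLoss ρ f a t g ≤ truncLoss ρ f a t' g' :=
  (h.le g' h'.nonneg).trans (truncLoss_mono_left htt')

/-- The minimal loss is nondecreasing in t. Over steps shorter than η it grows at slope at most C,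
because the leader at the left end is still a competitor; over longer steps the global bound T gives
slope T/η. -/
theorem lipschitzOnWith_leaderLoss (hρ : IsEvenLoss ρ) (hf : IsDecreasingGenerator f) {a : ℝ}
    (hfin : ∫⁻ z, rayLoss ρ f a z 0 ≠ ∞) (hint : LeadersInterior ρ f a) {γ : ℝ → ℝ}
    (hγ : ∀ t, IsLeader ρ f a t (γ t)) (A B : ℝ) :
    ∃ C, LipschitzOnWith C (fun t => (truncLoss ρ f a t (γ t)).toReal) (Icc A B) := by
  obtain ⟨C, hC, η, hη, h⟩ := exists_rayLoss_le_of_isLeader hρ hf hfin hint A B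
  have hne : ∀ t, truncLoss ρ f a t (γ t) ≠ ∞ := fun t =>
    ne_top_of_le_ne_top hfin (hγ t).truncLoss_le
  set T := (∫⁻ z, rayLoss ρ f a z 0).toReal
  have hT : 0 ≤ T := ENNReal.toReal_nonneg
  refine ⟨(max C (T / η)).toNNReal, LipschitzOnWith.of_le_add_mul _ fun x hx y hy => ?_⟩
  rw [Real.coe_toNNReal _ (le_max_of_le_left hC), Real.dist_eq]
  rcases le_total x y with hxy | hxy
  · have := ENNReal.toReal_mono (hne y) ((hγ x).truncLoss_mono (hγ y) hxy)
    have h2 : 0 ≤ max C (T / η) * |x - y| := mul_nonneg (le_max_of_le_left hC) (abs_nonneg _)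
    linarith
  rw [abs_of_nonneg (by linarith)]
  rcases le_total x (y + η) with hx' | hx'
  · have h1 : truncLoss ρ f a x (γ x) ≤ truncLoss ρ f a y (γ y) +
        ENNReal.ofReal C * ENNReal.ofReal (x - y) := by
      refine ((hγ y).truncLoss_le_add (hγ x)).trans ?_
      gcongr
      exact setLIntegral_Ico_le fun z hz => h y hy _ (hγ y) z ⟨hz.1, hz.2.le.trans hx'⟩
    rw [← ENNReal.ofReal_mul hC] at h1
    have h2 := ENNReal.toReal_mono (ENNReal.add_ne_top.2 ⟨hne y, ENNReal.ofReal_ne_top⟩) h1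
    rw [ENNReal.toReal_add (hne y) ENNReal.ofReal_ne_top,
      ENNReal.toReal_ofReal (mul_nonneg hC (by linarith))] at h2
    have h3 : C * (x - y) ≤ max C (T / η) * (x - y) :=
      mul_le_mul_of_nonneg_right (le_max_left _ _) (by linarith)
    linarith
  · have h1 := ENNReal.toReal_mono hfin (hγ x).truncLoss_le
    have h3 : T / η * η ≤ max C (T / η) * (x - y) :=
      mul_le_mul (le_max_right _ _) (by linarith) hη.le (le_max_of_le_left hC)
    rw [div_mul_cancel₀ _ hη.ne'] at h3
    have h4 : 0 ≤ (truncLoss ρ f a y (γ y)).toReal := ENNReal.toReal_nonneg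
    change (truncLoss ρ f a x (γ x)).toReal ≤ T at h1
    linarith

/-- One half of the envelope theorem: keeping the leader of t beyond t bounds the right slopes. This
half suffices, so the leaders need not be unique or depend measurably on t. -/
theorem deriv_leaderLoss_le (hρ : IsEvenLoss ρ) (hf : IsDecreasingGenerator f) {a : ℝ}
    (hfin : ∫⁻ z, rayLoss ρ f a z 0 ≠ ∞) (hint : LeadersInterior ρ f a) {γ : ℝ → ℝ}
    (hγ : ∀ t, IsLeader ρ f a t (γ t)) {t : ℝ}
    (hd : DifferentiableAt ℝ (fun t => (truncLoss ρ f a t (γ t)).toReal) t) :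
    ENNReal.ofReal (deriv (fun t => (truncLoss ρ f a t (γ t)).toReal) t) ≤
      rayLoss ρ f a t (γ t) := by
  have hne : ∀ t, truncLoss ρ f a t (γ t) ≠ ∞ := fun t =>
    ne_top_of_le_ne_top hfin (hγ t).truncLoss_le
  have hH := (hint.continuousAt hρ hf (hγ t)).2
  rw [← ENNReal.ofReal_toReal hH]
  refine ENNReal.ofReal_le_ofReal (le_of_forall_pos_le_add fun ε hε => ?_)
  set C := (rayLoss ρ f a t (γ t)).toReal + ε with hCdef
  have hC : 0 ≤ C := add_nonneg ENNReal.toReal_nonneg hε.le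
  have hslope := (hasDerivAt_iff_tendsto_slope.1 hd.hasDerivAt).mono_left
    (nhdsWithin_mono t (fun x (hx : t < x) => ne_of_gt hx) : 𝓝[>] t ≤ 𝓝[≠] t)
  refine le_of_tendsto hslope ?_
  have h1 : ∀ᶠ z in 𝓝 t, rayLoss ρ f a z (γ t) < ENNReal.ofReal C :=
    (by fun_prop : Continuous fun z : ℝ => (z, γ t)).continuousAt.eventually
      (hint.eventually_lt hρ hf (hγ t) hε)
  obtain ⟨η, hη, hball⟩ := Metric.eventually_nhds_iff.1 h1
  filter_upwards [Ioo_mem_nhdsGT (show t < t + η by linarith)] with x hx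
  have hx1 : 0 < x - t := by linarith [hx.1]
  rw [slope_def_field, div_le_iff₀ hx1]
  have h1 : truncLoss ρ f a x (γ x) ≤ truncLoss ρ f a t (γ t) +
      ENNReal.ofReal C * ENNReal.ofReal (x - t) := by
    refine ((hγ t).truncLoss_le_add (hγ x)).trans ?_
    gcongr
    refine setLIntegral_Ico_le fun z hz => (hball ?_).le
    rw [Real.dist_eq, abs_of_nonneg (by linarith [hz.1])]
    linarith [hz.2, hx.2]
  rw [← ENNReal.ofReal_mul hC] at h1
  have h2 := ENNReal.toReal_mono (ENNReal.add_ne_top.2 ⟨hne t, ENNReal.ofReal_ne_top⟩) h1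
  rw [ENNReal.toReal_add (hne t) ENNReal.ofReal_ne_top,
    ENNReal.toReal_ofReal (mul_nonneg hC hx1.le)] at h2
  linarith

/-- Discarding z ≤ -B leaves a symmetric interval, where g = 0 is best. The resulting lower bound
for the minimal loss does not involve the leader. -/
theorem setLIntegral_rayLoss_le_truncLoss (hρ : IsEvenLoss ρ) (hf : IsDecreasingGenerator f)
    (a B g : ℝ) : ∫⁻ z in Ioo (-B) B, rayLoss ρ f a z 0 ≤ truncLoss ρ f a B g := by
  refine (setLIntegral_rayLoss_zero_le hρ hf a g measurableSet_Ioo fun z hz hzg => ?_).trans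
    (lintegral_mono_set Ioo_subset_Iio_self)
  have := abs_lt.1 (hzg.trans_lt (abs_lt.2 hz))
  exact ⟨by linarith, by linarith⟩

/-- If `φ` exceeds the loss of every leader then its integral exceeds the untruncated loss of the
estimate `0`. -/
theorem lintegral_rayLoss_zero_lt (hρ : IsEvenLoss ρ) (hf : IsDecreasingGenerator f) {a : ℝ}
    (hfin : ∫⁻ z, rayLoss ρ f a z 0 ≠ ∞) (hint : LeadersInterior ρ f a) {φ : ℝ → ℝ≥0∞}
    (hφm : Measurable φ) (hφ : ∀ᵐ z, ∀ g, IsLeader ρ f a z g → rayLoss ρ f a z g < φ z) :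
    ∫⁻ z, rayLoss ρ f a z 0 < ∫⁻ z, φ z := by
  choose γ hγ using exists_isLeader hρ hf hfin
  set M : ℝ → ℝ := fun t => (truncLoss ρ f a t (γ t)).toReal with hM
  have hne : ∀ t, truncLoss ρ f a t (γ t) ≠ ∞ := fun t =>
    ne_top_of_le_ne_top hfin (hγ t).truncLoss_le
  have hac : ∀ A B, A ≤ B → AbsolutelyContinuousOnInterval M A B := fun A B hAB => by
    obtain ⟨C, hC⟩ := lipschitzOnWith_leaderLoss hρ hf hfin hint hγ A B
    rw [← uIcc_of_le hAB] at hC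
    exact hC.absolutelyContinuousOnInterval
  have hdiff : ∀ᵐ t, DifferentiableAt ℝ M t := by
    have : ∀ᵐ t, ∀ n : ℕ, t ∈ uIcc (-(n : ℝ)) n → DifferentiableAt ℝ M t :=
      ae_all_iff.2 fun n => (hac (-n) n (by linarith [n.cast_nonneg (α := ℝ)])).ae_differentiableAt
    filter_upwards [this] with t ht
    obtain ⟨n, hn⟩ := exists_nat_ge |t|
    refine ht n ?_
    rw [uIcc_of_le (by linarith [n.cast_nonneg (α := ℝ)])]
    exact abs_le.1 hn
  set D : ℝ → ℝ≥0∞ := fun t => ENNReal.ofReal (deriv M t)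
  have hlt : ∀ᵐ t, D t < φ t := by
    filter_upwards [hdiff, hφ] with t ht ht'
    exact (deriv_leaderLoss_le hρ hf hfin hint hγ ht).trans_lt (ht' _ (hγ t))
  -- The fundamental theorem of calculus for the locally Lipschitz M, with M' replaced by its
  -- positive part D.
  have hstep : ∀ A B, A ≤ B →
      truncLoss ρ f a B (γ B) ≤ truncLoss ρ f a A (γ A) + ∫⁻ t, D t := fun A B hAB => by
    have h1 := (hac A B hAB).integral_deriv_eq_sub
    rw [intervalIntegral.integral_of_le hAB] at h1
    refine le_trans ?_ (add_le_add_right (setLIntegral_le_lintegral (Ioc A B) D) _)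
    by_cases htop : ∫⁻ t in Ioc A B, D t = ∞
    · rw [htop]; simp
    have h3 : ∫ t in Ioc A B, deriv M t ≤ ∫ t in Ioc A B, (D t).toReal := by
      have hi : IntegrableOn (deriv M) (Ioc A B) :=
        (intervalIntegrable_iff_integrableOn_Ioc_of_le hAB).1
          (hac A B hAB).intervalIntegrable_deriv
      refine integral_mono hi (integrable_toReal_of_lintegral_ne_top
        (measurable_deriv M).ennreal_ofReal.aemeasurable htop) fun t => ?_
      simp only [D, ENNReal.toReal_ofReal']
      exact le_max_left _ _
    rw [integral_toReal (measurable_deriv M).ennreal_ofReal.aemeasurable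
      (Eventually.of_forall fun t => ENNReal.ofReal_lt_top), h1] at h3
    have h4 := ENNReal.ofReal_le_ofReal (sub_le_iff_le_add'.1 h3)
    rwa [ENNReal.ofReal_add ENNReal.toReal_nonneg ENNReal.toReal_nonneg,
      ENNReal.ofReal_toReal htop, ENNReal.ofReal_toReal (hne A),
      ENNReal.ofReal_toReal (hne B)] at h4
  -- The leader does at least as well as g = 0, whose loss on z < -n is the tail of a finite
  -- integral.
  have hbot : Tendsto (fun n : ℕ => truncLoss ρ f a (-(n : ℝ)) (γ (-(n : ℝ)))) atTop (𝓝 0) := by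
    have h0 : Tendsto (fun n : ℕ => truncLoss ρ f a (-(n : ℝ)) 0) atTop (𝓝 0) := by
      have hm := measurable_rayLoss hρ.cont.measurable hf.meas a 0
      simp only [truncLoss, ← lintegral_indicator measurableSet_Iio]
      have := tendsto_lintegral_of_dominated_convergence (μ := volume) (f := fun _ : ℝ => 0)
        (F := fun (n : ℕ) => (Iio (-(n : ℝ))).indicator fun z => rayLoss ρ f a z 0)
        (fun z => rayLoss ρ f a z 0) (fun n => hm.indicator measurableSet_Iio)
        (fun n => Eventually.of_forall fun z => indicator_le_self _ _ z) hfin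
        (Eventually.of_forall fun z => ?_)
      · simpa using this
      · refine tendsto_const_nhds.congr' ?_
        filter_upwards [eventually_ge_atTop ⌈-z⌉₊] with n hn
        rw [indicator_of_notMem]
        simp only [mem_Iio, not_lt]
        linarith [Nat.ceil_le.1 hn]
    exact tendsto_of_tendsto_of_tendsto_of_le_of_le tendsto_const_nhds h0 (fun _ => zero_le)
      fun n => (hγ _).le 0 le_rfl
  have htop : Tendsto (fun n : ℕ => ∫⁻ z in Ioo (-(n : ℝ)) n, rayLoss ρ f a z 0) atTop
      (𝓝 (∫⁻ z, rayLoss ρ f a z 0)) :=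
    (aecover_Ioo (tendsto_neg_atTop_atBot.comp tendsto_natCast_atTop_atTop)
      tendsto_natCast_atTop_atTop).lintegral_tendsto_of_countably_generated
      (measurable_rayLoss hρ.cont.measurable hf.meas a 0).aemeasurable
  -- The loss of X over (-n,n) is at most M(n), hence at most M(-n) + ∫ D; then n tends to infinity.
  have hle : ∫⁻ z, rayLoss ρ f a z 0 ≤ ∫⁻ t, D t := by
    have h1 := hbot.add_const (∫⁻ t, D t)
    rw [zero_add] at h1
    refine le_of_tendsto_of_tendsto' htop h1 fun n => ?_
    exact (setLIntegral_rayLoss_le_truncLoss hρ hf a n (γ n)).trans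
      (hstep _ _ (by linarith [n.cast_nonneg (α := ℝ)]))
  by_cases hD : ∫⁻ t, D t = ∞
  · have : ∫⁻ z, φ z = ∞ := top_le_iff.1 (hD ▸ lintegral_mono_ae (hlt.mono fun _ h => h.le))
    rw [this]
    exact lt_top_iff_ne_top.2 hfin
  · refine hle.trans_lt (lintegral_strict_mono (NeZero.ne volume) hφm.aemeasurable hD hlt)

end Leader

end BoundedMean

namespace BoundedMean

/-! ### One-sided differentiation and sign-change lemmas -/

section General

theorem integral_pos_of_pos_on {α : Type*} [MeasurableSpace α] {μ : Measure α} {F : α → ℝ}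
    (hF : Integrable F μ) (h0 : 0 ≤ᵐ[μ] F) {s : Set α} (hs : μ s ≠ 0)
    (hpos : ∀ᵐ x ∂μ, x ∈ s → 0 < F x) : 0 < ∫ x, F x ∂μ := by
  rw [integral_pos_iff_support_of_nonneg_ae h0 hF]
  refine lt_of_lt_of_le (pos_iff_ne_zero.2 hs) (measure_mono_ae ?_)
  filter_upwards [hpos] with x hx hxs
  exact (hx hxs).ne'

/-- One-sided differentiation under the integral sign at a minimum, by Fatou's lemma. -/
theorem integrable_and_integral_nonneg_of_tendsto {α : Type*} [MeasurableSpace α] {μ : Measure α}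
    {s : ℕ → α → ℝ} {b ψ : α → ℝ} (hs : ∀ k, Integrable (s k) μ) (hb : Integrable b μ)
    (hle : ∀ k, s k ≤ᵐ[μ] b) (hnn : ∀ k, 0 ≤ ∫ x, s k x ∂μ)
    (hlim : ∀ᵐ x ∂μ, Tendsto (fun k => s k x) atTop (𝓝 (ψ x))) :
    Integrable ψ μ ∧ 0 ≤ ∫ x, ψ x ∂μ := by
  have hψm : AEStronglyMeasurable ψ μ :=
    aestronglyMeasurable_of_tendsto_ae atTop (fun k => (hs k).aestronglyMeasurable) hlim
  have hleψ : ψ ≤ᵐ[μ] b := by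
    filter_upwards [hlim, ae_all_iff.2 hle] with x hx hx'
    exact le_of_tendsto' hx hx'
  -- Fatou's lemma for b - s k ≥ 0. Since the integrals of s k are nonnegative, the bound ∫ b
  -- results; it yields both the integrability of ψ and the sign of its integral.
  have hfatou : ∫⁻ x, ENNReal.ofReal (b x - ψ x) ∂μ ≤ ENNReal.ofReal (∫ x, b x ∂μ) := by
    calc ∫⁻ x, ENNReal.ofReal (b x - ψ x) ∂μ
        ≤ ∫⁻ x, liminf (fun k => ENNReal.ofReal (b x - s k x)) atTop ∂μ := by
          refine lintegral_mono_ae ?_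
          filter_upwards [hlim] with x hx
          exact ((ENNReal.continuous_ofReal.tendsto _).comp (hx.const_sub (b x))).liminf_eq.ge
      _ ≤ liminf (fun k => ∫⁻ x, ENNReal.ofReal (b x - s k x) ∂μ) atTop :=
          lintegral_liminf_le' fun k => (hb.sub (hs k)).aestronglyMeasurable.aemeasurable.ennreal_ofReal
      _ ≤ liminf (fun _ : ℕ => ENNReal.ofReal (∫ x, b x ∂μ)) atTop := by
          refine liminf_le_liminf (Eventually.of_forall fun k => ?_)
          rw [← ofReal_integral_eq_lintegral_ofReal (f := fun x => b x - s k x) (hb.sub (hs k))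
            ((hle k).mono fun x hx => by simpa using hx)]
          refine ENNReal.ofReal_le_ofReal ?_
          rw [integral_sub hb (hs k)]
          linarith [hnn k]
      _ = _ := liminf_const _
  have hnn' : 0 ≤ᵐ[μ] fun x => b x - ψ x := hleψ.mono fun x hx => by simpa using hx
  have hint : Integrable (fun x => b x - ψ x) μ := by
    refine ⟨hb.aestronglyMeasurable.sub hψm, ?_⟩
    rw [hasFiniteIntegral_iff_ofReal hnn']
    exact hfatou.trans_lt ENNReal.ofReal_lt_top
  have hψ : Integrable ψ μ := (hb.sub hint).congr (Eventually.of_forall fun x => by simp)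
  refine ⟨hψ, ?_⟩
  rw [← ofReal_integral_eq_lintegral_ofReal hint hnn', integral_sub hb hψ] at hfatou
  have hb0 : 0 ≤ ∫ x, b x ∂μ := (hnn 0).trans (integral_mono_ae (hs 0) hb (hle 0))
  have := (ENNReal.ofReal_le_ofReal_iff hb0).1 hfatou
  linarith

/-- A function with a single sign change, from negative to positive, has a positive integral
against weights that put more mass on large arguments. -/
theorem integral_mul_pos_of_single_crossing {A W M : ℝ → ℝ} {s : ℝ}
    (hM : StrictMonoOn M (Ici s)) (hMs : 0 ≤ M s) (hW : ∀ v, s < v → 0 < W v)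
    (hA : ∀ v v', s < v → v < v' → 0 ≤ A v → 0 < A v')
    (h1 : IntegrableOn (fun v => W v * A v) (Ioi s))
    (h2 : IntegrableOn (fun v => M v * (W v * A v)) (Ioi s))
    (h0 : 0 ≤ ∫ v in Ioi s, W v * A v) :
    0 < ∫ v in Ioi s, M v * (W v * A v) := by
  set S := {v : ℝ | s < v ∧ 0 < A v}
  have hS : S.Nonempty := by
    by_contra hne
    have hneg : ∀ v, s < v → A v < 0 := fun v hv => by
      by_contra hc
      exact hne ⟨v + 1, by linarith, hA v (v + 1) hv (by linarith) (not_lt.1 hc)⟩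
    have := integral_pos_of_pos_on (μ := volume.restrict (Ioi s)) (s := univ) h1.neg
      ((ae_restrict_iff' measurableSet_Ioi).2 (Eventually.of_forall fun v hv => by
        have := mul_neg_of_pos_of_neg (hW v hv) (hneg v hv)
        simp only [Pi.zero_apply, Pi.neg_apply]; linarith)) (by simp)
      ((ae_restrict_iff' measurableSet_Ioi).2 (Eventually.of_forall fun v hv _ => by
        have := mul_neg_of_pos_of_neg (hW v hv) (hneg v hv)
        simp only [Pi.neg_apply]; linarith))
    simp only [Pi.neg_apply] at this
    rw [integral_neg] at this
    linarith
  have hbdd : BddBelow S := ⟨s, fun v hv => hv.1.le⟩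
  set c := sInf S
  have hc : s ≤ c := le_csInf hS fun v hv => hv.1.le
  -- At the crossing point c both M - M c and A change sign, so their product is positive elsewhere;
  -- hence ∫ M W A > M c ∫ W A ≥ 0.
  have hpos : ∀ v, s < v → v ≠ c → 0 < (M v - M c) * (W v * A v) := by
    intro v hv hvc
    rcases lt_or_gt_of_ne hvc with h | h
    · have hAv : A v < 0 := by
        by_contra hcon
        obtain ⟨u, hu1, hu2⟩ := exists_between h
        exact absurd (csInf_le hbdd (show u ∈ S from
          ⟨hv.trans hu1, hA v u hv hu1 (not_lt.1 hcon)⟩)) (not_le.2 hu2)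
      exact mul_pos_of_neg_of_neg (sub_neg.2 (hM (mem_Ici.2 hv.le) (mem_Ici.2 hc) h))
        (mul_neg_of_pos_of_neg (hW v hv) hAv)
    · obtain ⟨u, hu, huv⟩ := exists_lt_of_csInf_lt hS h
      exact mul_pos (sub_pos.2 (hM (mem_Ici.2 hc) (mem_Ici.2 hv.le) h))
        (mul_pos (hW v hv) (hA u v hu.1 huv hu.2.le))
  have hne : ∀ᵐ v ∂(volume.restrict (Ioi s)), s < v ∧ v ≠ c := by
    filter_upwards [ae_restrict_mem measurableSet_Ioi,
      ae_restrict_of_ae (Measure.ae_ne volume c)] with v hv hv' using ⟨hv, hv'⟩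
  have hint : IntegrableOn (fun v => (M v - M c) * (W v * A v)) (Ioi s) := by
    simp only [sub_mul]
    exact h2.sub (h1.const_mul _)
  have key := integral_pos_of_pos_on (μ := volume.restrict (Ioi s)) (s := univ) hint
    (hne.mono fun v hv => (hpos v hv.1 hv.2).le) (by simp)
    (hne.mono fun v hv _ => hpos v hv.1 hv.2)
  simp only [sub_mul] at key
  rw [integral_sub h2 (h1.const_mul _), integral_const_mul] at key
  have := mul_nonneg (hMs.trans (hM.monotoneOn self_mem_Ici (mem_Ici.2 hc) hc)) h0
  linarith

theorem integral_rpow_mul_pos_of_single_crossing {A W : ℝ → ℝ} {m : ℝ} (hm : 0 < m)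
    (hW : ∀ v, 0 < v → 0 < W v)
    (hA : ∀ v v', 0 < v → v < v' → 0 ≤ A v → 0 < A v')
    (h1 : IntegrableOn (fun v => W v * A v) (Ioi 0))
    (h2 : IntegrableOn (fun v => v ^ m * (W v * A v)) (Ioi 0))
    (h0 : 0 ≤ ∫ v in Ioi (0 : ℝ), W v * A v) :
    0 < ∫ v in Ioi (0 : ℝ), v ^ m * (W v * A v) :=
  integral_mul_pos_of_single_crossing
    (fun _ hx _ _ h => Real.rpow_lt_rpow (mem_Ici.1 hx) h hm) (Real.rpow_nonneg le_rfl m)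
    hW hA h1 h2 h0

theorem image_mul_Iio {c : ℝ} (hc : 0 < c) (t : ℝ) :
    (fun y : ℝ => c * y) '' Iio (t / c) = Iio t := by
  ext z; constructor
  · rintro ⟨y, hy, rfl⟩
    have := (lt_div_iff₀ hc).1 hy
    simp only [mem_Iio]; linarith
  · intro hz
    exact ⟨z / c, div_lt_div_of_pos_right hz hc, by field_simp⟩

theorem image_sub_mul_Ioi {c : ℝ} (hc : 0 < c) (t : ℝ) :
    (fun w : ℝ => t - c * w) '' Ioi 0 = Iio t := by
  ext z; constructor
  · rintro ⟨y, hy, rfl⟩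
    have := mul_pos hc hy
    simp only [mem_Iio]; linarith
  · intro hz
    exact ⟨(t - z) / c, div_pos (sub_pos.2 hz) hc, by field_simp; ring⟩

theorem hasDerivAt_const_mul_self (c y : ℝ) : HasDerivAt (fun y : ℝ => c * y) c y := by
  simpa using (hasDerivAt_id y).const_mul c

theorem hasDerivAt_sub_const_mul_self (t c y : ℝ) :
    HasDerivAt (fun y : ℝ => t - c * y) (-c) y := (hasDerivAt_const_mul_self c y).const_sub t

theorem setIntegral_Iio_eq_mul {c : ℝ} (hc : 0 < c) (t : ℝ) (F : ℝ → ℝ) :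
    ∫ z in Iio t, F z = c * ∫ y in Iio (t / c), F (c * y) := by
  rw [← image_mul_Iio hc t, integral_image_eq_integral_abs_deriv_smul (f' := fun _ => c)
    measurableSet_Iio (fun y _ => (hasDerivAt_const_mul_self c y).hasDerivWithinAt)
    (fun x _ y _ h => mul_left_cancel₀ hc.ne' h), abs_of_pos hc]
  simp only [smul_eq_mul]
  rw [integral_const_mul]

theorem integrableOn_Iio_iff_mul {c : ℝ} (hc : 0 < c) (t : ℝ) (F : ℝ → ℝ) :
    IntegrableOn F (Iio t) ↔ IntegrableOn (fun y => F (c * y)) (Iio (t / c)) := by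
  conv_lhs => rw [← image_mul_Iio hc t]
  rw [integrableOn_image_iff_integrableOn_abs_deriv_smul (f' := fun _ => c)
    measurableSet_Iio (fun y _ => (hasDerivAt_const_mul_self c y).hasDerivWithinAt)
    (fun x _ y _ h => mul_left_cancel₀ hc.ne' h), abs_of_pos hc]
  exact integrable_fun_smul_iff hc.ne' _

theorem setIntegral_Iio_eq_sub_mul {c : ℝ} (hc : 0 < c) (t : ℝ) (F : ℝ → ℝ) :
    ∫ z in Iio t, F z = c * ∫ w in Ioi 0, F (t - c * w) := by
  rw [← image_sub_mul_Ioi hc t, integral_image_eq_integral_abs_deriv_smul (f' := fun _ => -c)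
    measurableSet_Ioi (fun y _ => (hasDerivAt_sub_const_mul_self t c y).hasDerivWithinAt)
    (fun x _ y _ h => mul_left_cancel₀ hc.ne' (by simpa using h)), abs_neg, abs_of_pos hc]
  simp only [smul_eq_mul]
  rw [integral_const_mul]

theorem integrableOn_Iio_iff_sub_mul {c : ℝ} (hc : 0 < c) (t : ℝ) (F : ℝ → ℝ) :
    IntegrableOn F (Iio t) ↔ IntegrableOn (fun w => F (t - c * w)) (Ioi 0) := by
  conv_lhs => rw [← image_sub_mul_Ioi hc t]
  rw [integrableOn_image_iff_integrableOn_abs_deriv_smul (f' := fun _ => -c)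
    measurableSet_Ioi (fun y _ => (hasDerivAt_sub_const_mul_self t c y).hasDerivWithinAt)
    (fun x _ y _ h => mul_left_cancel₀ hc.ne' (by simpa using h)), abs_neg, abs_of_pos hc]
  exact integrable_fun_smul_iff hc.ne' _

end General

/-! ### An odd monotone derivative of an even convex loss -/

section Derivative

/-- `r` is an odd monotone version of the derivative of the convex loss `ρ`. -/
structure IsOddDeriv (ρ r : ℝ → ℝ) : Prop where
  odd : ∀ x, r (-x) = -r x
  mono : Monotone r
  pos : ∀ x, 0 < x → 0 < r x
  le_div : ∀ x h, 0 ≤ x → 0 < h → r x ≤ ρ (x + h) / h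
  hasDerivAt : ∀ᵐ x, HasDerivAt ρ (r x) x

theorem IsOddDeriv.neg {ρ r : ℝ → ℝ} (h : IsOddDeriv ρ r) {x : ℝ} (hx : x < 0) : r x < 0 := by
  have := h.pos (-x) (by linarith)
  rw [h.odd] at this
  linarith

/-- The odd part of the right derivative is monotone and odd at every point, not only almost
everywhere, and it equals ρ' wherever ρ is differentiable. Monotonicity of ρ on the half-line and
evenness make that almost everywhere. -/
theorem IsEvenLoss.exists_isOddDeriv {ρ : ℝ → ℝ} (hρ : IsEvenLoss ρ) (hc : ConvexOn ℝ univ ρ) :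
    ∃ r, IsOddDeriv ρ r := by
  set R : ℝ → ℝ := fun x => derivWithin ρ (Ioi x) x with hR
  have hRmono : Monotone R := by
    have := hc.monotoneOn_rightDeriv
    rwa [interior_univ, monotoneOn_univ] at this
  have hle : ∀ x y, x < y → R x ≤ (ρ y - ρ x) / (y - x) := fun x y hxy => by
    have := hc.rightDeriv_le_slope_of_mem_interior (x := x) (by simp) (mem_univ y) hxy
    rwa [slope_def_field] at this
  have hge : ∀ x y, x < y → (ρ y - ρ x) / (y - x) ≤ R y := fun x y hxy => by
    have h1 := hc.slope_le_leftDeriv_of_mem_interior (y := y) (mem_univ x) (by simp) hxy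
    rw [slope_def_field] at h1
    exact h1.trans (hc.leftDeriv_le_rightDeriv_of_mem_interior (by simp))
  have hRpos : ∀ x, 0 < x → 0 < R x := fun x hx =>
    (div_pos (by rw [hρ.zero]; linarith [hρ.pos hx.ne']) (by linarith)).trans_le (hge 0 x hx)
  have hRneg : ∀ x, x < 0 → R x < 0 := fun x hx =>
    (hle x 0 hx).trans_lt (div_neg_of_neg_of_pos
      (by rw [hρ.zero]; linarith [hρ.pos hx.ne]) (by linarith))
  have hRdiff : ∀ x, DifferentiableAt ℝ ρ x → R x = deriv ρ x := fun x hx =>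
    hx.hasDerivAt.hasDerivWithinAt.derivWithin (uniqueDiffWithinAt_Ioi x)
  have hdpos : ∀ᵐ x, 0 < x → DifferentiableAt ℝ ρ x := by
    filter_upwards [hρ.strictMono.monotoneOn.ae_differentiableWithinAt_of_mem] with x hx h
    exact (hx (mem_Ici.2 h.le)).differentiableAt (Ici_mem_nhds h)
  have hdneg : ∀ x, DifferentiableAt ℝ ρ (-x) → DifferentiableAt ℝ ρ x := fun x hx => by
    have : ρ = fun y => ρ (-y) := funext fun y => (hρ.even y).symm
    rw [this]
    exact hx.comp x differentiableAt_id.neg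
  have hdiff : ∀ᵐ x, DifferentiableAt ℝ ρ x := by
    have h2 := (Measure.measurePreserving_neg (volume : Measure ℝ)).quasiMeasurePreserving.ae hdpos
    filter_upwards [hdpos, h2, Measure.ae_ne volume 0] with x hx hx' h0
    rcases lt_or_gt_of_ne h0 with h | h
    · exact hdneg x (hx' (by linarith))
    · exact hx h
  refine ⟨fun x => (R x - R (-x)) / 2, fun x => by rw [neg_neg]; ring, ?_, ?_, ?_, ?_⟩
  · intro x y hxy
    have h1 := hRmono hxy
    have h2 := hRmono (neg_le_neg hxy)
    linarith
  · intro x hx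
    have h1 := hRpos x hx
    have h2 := hRneg (-x) (by linarith)
    linarith
  · intro x h hx hh
    have h1 := hle x (x + h) (by linarith)
    have h2 := hge (-(x + h)) (-x) (by linarith)
    rw [hρ.even, hρ.even] at h2
    have h3 : -x - -(x + h) = h := by ring
    have h4 : x + h - x = h := by ring
    rw [h3, sub_div] at h2
    rw [h4, sub_div] at h1
    have h5 : 0 ≤ ρ x / h := div_nonneg (hρ.nonneg x) hh.le
    linarith
  · filter_upwards [hdiff] with x hx
    have hx' : DifferentiableAt ℝ ρ (-x) := hdneg (-x) (by rwa [neg_neg])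
    have h1 : deriv ρ (-x) = -deriv ρ x := by
      have : deriv (fun y => ρ (-y)) x = -deriv ρ (-x) := deriv_comp_neg ρ x
      rw [show (fun y => ρ (-y)) = ρ from funext hρ.even] at this
      linarith
    have : (R x - R (-x)) / 2 = deriv ρ x := by
      rw [hRdiff x hx, hRdiff _ hx', h1]; ring
    rw [this]
    exact hx.hasDerivAt

end Derivative

end BoundedMean

namespace BoundedMean

theorem ae_affine {p : ℝ → Prop} (h : ∀ᵐ x, p x) {c : ℝ} (hc : c ≠ 0) (b : ℝ) :
    ∀ᵐ z, p (b + c * z) := by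
  have h1 : volume ((fun x => b + x) ⁻¹' {x | ¬p x}) = 0 := by
    rw [measure_preimage_add]; exact h
  have h2 : volume ((fun z => c * z) ⁻¹' ((fun x => b + x) ⁻¹' {x | ¬p x})) = 0 := by
    rw [Real.volume_preimage_mul_left hc, h1, mul_zero]
  exact h2

/-- The generator `exp (-t / 2)` of the normal model. -/
noncomputable def normalGenerator (t : ℝ) : ℝ := Real.exp (-t / 2)

theorem isDecreasingGenerator_normal : IsDecreasingGenerator normalGenerator where
  pos _ _ := Real.exp_pos _
  meas := by unfold normalGenerator; fun_prop
  anti x _ y _ h := by unfold normalGenerator; gcongr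

/-! ### Normal model: differentiating the truncated loss in g -/

section Normal

variable {ρ r : ℝ → ℝ}

/-- The weight of the point `q = (v, z)` in `truncLoss` for the normal generator. -/
noncomputable def normalWeight (a : ℝ) (q : ℝ × ℝ) : ℝ :=
  q.1 ^ a * Real.exp (-(q.1 ^ 2 * (q.2 ^ 2 + 1)) / 2)

/-- Lebesgue measure on `v > 0`, `z < t`. -/
noncomputable def wedge (t : ℝ) : Measure (ℝ × ℝ) :=
  (volume.restrict (Ioi 0)).prod (volume.restrict (Iio t))

theorem ae_wedge_pos (t : ℝ) : ∀ᵐ q ∂wedge t, 0 < q.1 ∧ q.2 < t := by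
  rw [wedge, Measure.prod_restrict]
  filter_upwards [ae_restrict_mem (measurableSet_Ioi.prod measurableSet_Iio)] with q hq
  exact ⟨hq.1, hq.2⟩

theorem normalWeight_pos (a : ℝ) {q : ℝ × ℝ} (hq : 0 < q.1) : 0 < normalWeight a q :=
  mul_pos (Real.rpow_pos_of_pos hq a) (Real.exp_pos _)

theorem measurable_normalWeight (a : ℝ) : Measurable (normalWeight a) := by
  have : Measurable fun q : ℝ × ℝ => q.1 ^ a := measurable_fst.pow_const a
  unfold normalWeight
  fun_prop

theorem truncLoss_normal_eq (hρ : IsEvenLoss ρ) (a t g : ℝ) :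
    truncLoss ρ normalGenerator a t g =
      ∫⁻ q, ENNReal.ofReal (ρ (q.1 * (q.2 + g)) * normalWeight a q) ∂wedge t := by
  have hm : Measurable fun q : ℝ × ℝ =>
      ENNReal.ofReal (ρ (q.1 * (q.2 + g)) * normalWeight a q) := by
    have := hρ.cont
    have h2 := measurable_normalWeight a
    exact (Measurable.mul (by fun_prop) h2).ennreal_ofReal
  rw [wedge, lintegral_prod_symm _ hm.aemeasurable, truncLoss]
  refine lintegral_congr fun z => ?_
  refine lintegral_congr fun v => ?_
  rw [← ENNReal.ofReal_mul (hρ.nonneg _)]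
  rfl

theorem measurable_loss_mul_weight (hρ : IsEvenLoss ρ) (a g : ℝ) :
    Measurable fun q : ℝ × ℝ => ρ (q.1 * (q.2 + g)) * normalWeight a q := by
  have := hρ.cont
  exact Measurable.mul (by fun_prop) (measurable_normalWeight a)

theorem integrable_loss_mul_weight (hρ : IsEvenLoss ρ) {a t g : ℝ}
    (h : truncLoss ρ normalGenerator a t g ≠ ∞) :
    Integrable (fun q : ℝ × ℝ => ρ (q.1 * (q.2 + g)) * normalWeight a q) (wedge t) := by
  refine ⟨(measurable_loss_mul_weight hρ a g).aestronglyMeasurable, ?_⟩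
  rw [hasFiniteIntegral_iff_ofReal]
  · rw [← truncLoss_normal_eq hρ]; exact lt_top_iff_ne_top.2 h
  · filter_upwards [ae_wedge_pos t] with q hq
    exact mul_nonneg (hρ.nonneg _) (normalWeight_pos a hq.1).le

theorem truncLoss_normal_eq_ofReal (hρ : IsEvenLoss ρ) {a t g : ℝ}
    (h : truncLoss ρ normalGenerator a t g ≠ ∞) :
    truncLoss ρ normalGenerator a t g =
      ENNReal.ofReal (∫ q, ρ (q.1 * (q.2 + g)) * normalWeight a q ∂wedge t) := by
  rw [truncLoss_normal_eq hρ,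
    ofReal_integral_eq_lintegral_ofReal (integrable_loss_mul_weight hρ h)]
  filter_upwards [ae_wedge_pos t] with q hq
  exact mul_nonneg (hρ.nonneg _) (normalWeight_pos a hq.1).le

/-- The derivative in `g` of the integrand of `truncLoss`. -/
noncomputable def lossDeriv (r : ℝ → ℝ) (a g : ℝ) (q : ℝ × ℝ) : ℝ :=
  r (q.1 * (q.2 + g)) * (q.1 * normalWeight a q)

/-- For each v > 0 the map z ↦ v(z+g) is a nondegenerate affine map, so it pulls null sets back to
null sets. The exceptional set is enlarged to a measurable null set so that Fubini applies. -/
theorem ae_wedge_hasDerivAt (hr : IsOddDeriv ρ r) (t g : ℝ) :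
    ∀ᵐ q ∂wedge t, HasDerivAt ρ (r (q.1 * (q.2 + g))) (q.1 * (q.2 + g)) := by
  set T := toMeasurable volume {x | ¬HasDerivAt ρ (r x) x}
  have hT : ∀ᵐ x, x ∉ T := by
    rw [ae_iff]
    simp only [not_not, ofPred_mem_eq]
    rw [measure_toMeasurable]
    exact hr.hasDerivAt
  have hmeas : Measurable fun q : ℝ × ℝ => q.1 * (q.2 + g) := by fun_prop
  have : ∀ᵐ q ∂wedge t, q.1 * (q.2 + g) ∉ T := by
    refine (Measure.ae_prod_iff_ae_ae
      (hmeas (measurableSet_toMeasurable volume _).compl)).2 ?_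
    filter_upwards [ae_restrict_mem measurableSet_Ioi] with v hv
    have hv : 0 < v := hv
    refine ae_restrict_of_ae ?_
    filter_upwards [ae_affine hT hv.ne' (v * g)] with z hz
    rwa [show v * (z + g) = v * g + v * z by ring]
  filter_upwards [this] with q hq
  by_contra hcon
  exact hq (subset_toMeasurable volume _ hcon)

theorem tendsto_one_div_nhdsNE_zero :
    Tendsto (fun k : ℕ => 1 / ((k : ℝ) + 1)) atTop (𝓝[≠] 0) :=
  tendsto_nhdsWithin_iff.2 ⟨tendsto_one_div_add_atTop_nhds_zero_nat,
    Eventually.of_forall fun k => by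
      have : (0 : ℝ) < 1 / ((k : ℝ) + 1) := by positivity
      exact this.ne'⟩

/-- By convexity each difference quotient towards g₁ is at most the full increment from g to g₁,
which is integrable because both losses are finite. Fatou's lemma for the quotients then makes
integrability of the derivative a conclusion rather than an assumption. -/
theorem lossDeriv_of_isMin (hρ : IsEvenLoss ρ) (hc : ConvexOn ℝ univ ρ) (hr : IsOddDeriv ρ r)
    {a t g g₁ : ℝ} (hne : g₁ ≠ g) (hg : truncLoss ρ normalGenerator a t g ≠ ∞)
    (hg₁ : truncLoss ρ normalGenerator a t g₁ ≠ ∞)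
    (hmin : ∀ τ ∈ Ioc (0 : ℝ) 1, truncLoss ρ normalGenerator a t g ≤
      truncLoss ρ normalGenerator a t (g + τ * (g₁ - g))) :
    Integrable (lossDeriv r a g) (wedge t) ∧ 0 ≤ (g₁ - g) * ∫ q, lossDeriv r a g q ∂wedge t := by
  set φ : ℝ → ℝ × ℝ → ℝ := fun g q => ρ (q.1 * (q.2 + g)) * normalWeight a q with hφ
  set τ : ℕ → ℝ := fun k => 1 / ((k : ℝ) + 1) with hτ
  have hτ0 : ∀ k, 0 < τ k := fun k => by positivity
  have hτ1 : ∀ k, τ k ≤ 1 := fun k => by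
    rw [hτ]
    exact (div_le_one (by positivity)).2 (by linarith [k.cast_nonneg (α := ℝ)])
  have hi := integrable_loss_mul_weight hρ hg
  have hi₁ := integrable_loss_mul_weight hρ hg₁
  have hconv : ∀ s, 0 ≤ s → s ≤ 1 → ∀ q : ℝ × ℝ, 0 < q.1 →
      φ (g + s * (g₁ - g)) q ≤ (1 - s) * φ g q + s * φ g₁ q := fun s hs0 hs1 q hq => by
    have h1 := hc.2 (mem_univ (q.1 * (q.2 + g))) (mem_univ (q.1 * (q.2 + g₁)))
      (sub_nonneg.2 hs1) hs0 (by ring)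
    simp only [smul_eq_mul] at h1
    rw [show (1 - s) * (q.1 * (q.2 + g)) + s * (q.1 * (q.2 + g₁)) =
      q.1 * (q.2 + (g + s * (g₁ - g))) by ring] at h1
    have h2 := mul_le_mul_of_nonneg_right h1 (normalWeight_pos a hq).le
    simp only [hφ]
    linarith
  have hτi : ∀ k, Integrable (φ (g + τ k * (g₁ - g))) (wedge t) := fun k => by
    refine Integrable.mono' ((hi.const_mul (1 - τ k)).add (hi₁.const_mul (τ k)))
      (measurable_loss_mul_weight hρ a _).aestronglyMeasurable ?_
    filter_upwards [ae_wedge_pos t] with q hq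
    rw [Real.norm_of_nonneg (mul_nonneg (hρ.nonneg _) (normalWeight_pos a hq.1).le)]
    exact hconv _ (hτ0 k).le (hτ1 k) q hq.1
  have hτfin : ∀ k, truncLoss ρ normalGenerator a t (g + τ k * (g₁ - g)) ≠ ∞ := fun k => by
    rw [truncLoss_normal_eq hρ]
    exact ((hasFiniteIntegral_iff_ofReal (by
      filter_upwards [ae_wedge_pos t] with q hq
      exact mul_nonneg (hρ.nonneg _) (normalWeight_pos a hq.1).le)).1 (hτi k).2).ne
  have key := integrable_and_integral_nonneg_of_tendsto (μ := wedge t)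
    (s := fun k q => (φ (g + τ k * (g₁ - g)) q - φ g q) / τ k) (b := fun q => φ g₁ q - φ g q)
    (ψ := fun q => (g₁ - g) * lossDeriv r a g q)
    (fun k => ((hτi k).sub hi).div_const _) (hi₁.sub hi)
    (fun k => by
      filter_upwards [ae_wedge_pos t] with q hq
      rw [div_le_iff₀ (hτ0 k)]
      have := hconv _ (hτ0 k).le (hτ1 k) q hq.1
      linarith)
    (fun k => by
      rw [integral_div, integral_sub (hτi k) hi]
      refine div_nonneg (sub_nonneg.2 ?_) (hτ0 k).le
      have h1 := hmin (τ k) ⟨hτ0 k, hτ1 k⟩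
      rw [truncLoss_normal_eq_ofReal hρ hg, truncLoss_normal_eq_ofReal hρ (hτfin k)] at h1
      refine (ENNReal.ofReal_le_ofReal_iff (integral_nonneg_of_ae ?_)).1 h1
      filter_upwards [ae_wedge_pos t] with q hq
      exact mul_nonneg (hρ.nonneg _) (normalWeight_pos a hq.1).le)
    (by
      filter_upwards [ae_wedge_hasDerivAt hr t g] with q hq
      have h1 : HasDerivAt (fun s : ℝ => q.1 * (q.2 + g) + (q.1 * (g₁ - g)) * s)
          (q.1 * (g₁ - g)) 0 := (hasDerivAt_const_mul_self _ _).const_add _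
      have h2 : HasDerivAt ρ (r (q.1 * (q.2 + g))) (q.1 * (q.2 + g) + (q.1 * (g₁ - g)) * 0) := by
        simpa using hq
      have h3 := ((h2.comp 0 h1).mul_const (normalWeight a q)).tendsto_slope_zero.comp
        tendsto_one_div_nhdsNE_zero
      refine (h3.congr fun k => ?_).trans (le_of_eq ?_)
      · simp only [Function.comp_apply, zero_add, smul_eq_mul, mul_zero, add_zero, hφ, hτ]
        rw [show q.1 * (q.2 + g) + q.1 * (g₁ - g) * (1 / ((k : ℝ) + 1)) =
          q.1 * (q.2 + (g + 1 / ((k : ℝ) + 1) * (g₁ - g))) by ring]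
        exact (div_eq_inv_mul _ _).symm
      · congr 1
        rw [lossDeriv]
        ring)
  rw [integral_const_mul] at key
  exact ⟨(integrable_const_mul_iff (isUnit_iff_ne_zero.2 (sub_ne_zero.2 hne)) _).1 key.1, key.2⟩

end Normal

end BoundedMean

namespace BoundedMean

variable {ρ r : ℝ → ℝ}

/-! ### Where the losses are finite -/

section Finiteness

/-- Convexity of ρ passes to the loss in g. The weaker quasiconvex form is all that is needed to
locate minimizers, and it allows infinite values. -/
theorem truncLoss_convex_le_max (hρ : IsEvenLoss ρ) (hc : ConvexOn ℝ univ ρ) (a t : ℝ)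
    {g g₁ x : ℝ} (h : g ≤ x) (h' : x ≤ g₁) :
    truncLoss ρ normalGenerator a t x ≤
      max (truncLoss ρ normalGenerator a t g) (truncLoss ρ normalGenerator a t g₁) := by
  by_cases hg : truncLoss ρ normalGenerator a t g = ∞
  · simp [hg]
  by_cases hg₁ : truncLoss ρ normalGenerator a t g₁ = ∞
  · simp [hg₁]
  obtain ⟨p, s, hp, hs, hps, hx⟩ : ∃ p s : ℝ, 0 ≤ p ∧ 0 ≤ s ∧ p + s = 1 ∧ p * g + s * g₁ = x := by
    have : x ∈ segment ℝ g g₁ := by rw [segment_eq_Icc (h.trans h')]; exact ⟨h, h'⟩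
    obtain ⟨p, s, hp, hs, hps, hx⟩ := this
    exact ⟨p, s, hp, hs, hps, by simpa using hx⟩
  have hi := integrable_loss_mul_weight hρ hg
  have hi₁ := integrable_loss_mul_weight hρ hg₁
  have hnn : ∀ g, 0 ≤ᵐ[wedge t] fun q : ℝ × ℝ => ρ (q.1 * (q.2 + g)) * normalWeight a q := fun g => by
    filter_upwards [ae_wedge_pos t] with q hq
    exact mul_nonneg (hρ.nonneg _) (normalWeight_pos a hq.1).le
  have hle : truncLoss ρ normalGenerator a t x ≤ ENNReal.ofReal
      (p * ∫ q, ρ (q.1 * (q.2 + g)) * normalWeight a q ∂wedge t +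
        s * ∫ q, ρ (q.1 * (q.2 + g₁)) * normalWeight a q ∂wedge t) := by
    rw [truncLoss_normal_eq hρ, ← integral_const_mul, ← integral_const_mul,
      ← integral_add (hi.const_mul p) (hi₁.const_mul s),
      ofReal_integral_eq_lintegral_ofReal (f := fun q : ℝ × ℝ =>
        p * (ρ (q.1 * (q.2 + g)) * normalWeight a q) +
          s * (ρ (q.1 * (q.2 + g₁)) * normalWeight a q))
        ((hi.const_mul p).add (hi₁.const_mul s))]
    · refine lintegral_mono_ae ?_
      filter_upwards [ae_wedge_pos t] with q hq
      refine ENNReal.ofReal_le_ofReal ?_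
      have h1 := hc.2 (mem_univ (q.1 * (q.2 + g))) (mem_univ (q.1 * (q.2 + g₁))) hp hs hps
      simp only [smul_eq_mul] at h1
      rw [show p * (q.1 * (q.2 + g)) + s * (q.1 * (q.2 + g₁)) =
        q.1 * ((p + s) * q.2 + (p * g + s * g₁)) by ring, hps, one_mul, hx] at h1
      have h2 := mul_le_mul_of_nonneg_right h1 (normalWeight_pos a hq.1).le
      linarith
    · filter_upwards [hnn g, hnn g₁] with q h1 h2
      exact add_nonneg (mul_nonneg hp h1) (mul_nonneg hs h2)
  refine hle.trans ?_
  rw [truncLoss_normal_eq_ofReal hρ hg, truncLoss_normal_eq_ofReal hρ hg₁, ← ENNReal.ofReal_max]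
  refine ENNReal.ofReal_le_ofReal ?_
  set u := ∫ q, ρ (q.1 * (q.2 + g)) * normalWeight a q ∂wedge t
  set w := ∫ q, ρ (q.1 * (q.2 + g₁)) * normalWeight a q ∂wedge t
  have h1 := mul_le_mul_of_nonneg_left (le_max_left u w) hp
  have h2 := mul_le_mul_of_nonneg_left (le_max_right u w) hs
  have h3 : p * max u w + s * max u w = max u w := by rw [← add_mul, hps, one_mul]
  linarith

/-- With x = v z the Gaussian weight splits into a function of v and a function of x. Finiteness is
therefore the condition that ρ be Gaussian integrable, the same for every weight a > 0; this
transfers it from a = n to n + l. -/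
theorem lintegral_rayLoss_normal {ρ : ℝ → ℝ} (hρ : Measurable ρ) (h0 : ∀ x, 0 ≤ ρ x) (a : ℝ) :
    ∫⁻ z, rayLoss ρ normalGenerator a z 0 =
      (∫⁻ v in Ioi (0 : ℝ), ENNReal.ofReal (v ^ (a - 1) * Real.exp (-(1 / 2) * v ^ 2))) *
        ∫⁻ x, ENNReal.ofReal (ρ x * Real.exp (-x ^ 2 / 2)) := by
  have hm := measurable_rayLoss_integrand hρ isDecreasingGenerator_normal.meas a
  have hswap : ∫⁻ z, rayLoss ρ normalGenerator a z 0 = ∫⁻ v in Ioi (0 : ℝ), ∫⁻ z,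
      ENNReal.ofReal (ρ (v * (z + 0))) *
        ENNReal.ofReal (v ^ a * normalGenerator (v ^ 2 * (z ^ 2 + 1))) := by
    simp only [rayLoss]
    refine lintegral_lintegral_swap ?_
    exact (hm.comp (by fun_prop : Measurable fun q : ℝ × ℝ => ((q.1, (0 : ℝ)), q.2))).aemeasurable
  set c := ∫⁻ x, ENNReal.ofReal (ρ x * Real.exp (-x ^ 2 / 2)) with hcdef
  have hinner : ∀ v ∈ Ioi (0 : ℝ), ∫⁻ z, ENNReal.ofReal (ρ (v * (z + 0))) *
        ENNReal.ofReal (v ^ a * normalGenerator (v ^ 2 * (z ^ 2 + 1))) =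
      ENNReal.ofReal (v ^ (a - 1) * Real.exp (-(1 / 2) * v ^ 2)) * c := by
    intro v hv
    have hv : 0 < v := hv
    rw [hcdef, lintegral_affine hv 0 (fun x => ENNReal.ofReal (ρ x * Real.exp (-x ^ 2 / 2))),
      ← mul_assoc, ← ENNReal.ofReal_mul
      (mul_nonneg (Real.rpow_nonneg hv.le _) (Real.exp_pos _).le), ← lintegral_const_mul']
    · refine lintegral_congr fun z => ?_
      rw [← ENNReal.ofReal_mul (h0 _), ← ENNReal.ofReal_mul (by positivity)]
      congr 1
      have h1 : v ^ a = v ^ (a - 1) * v := by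
        rw [← Real.rpow_add_one hv.ne']; congr 1; ring
      have h2 : normalGenerator (v ^ 2 * (z ^ 2 + 1)) =
          Real.exp (-(1 / 2) * v ^ 2) * Real.exp (-(0 + v * z) ^ 2 / 2) := by
        rw [normalGenerator, ← Real.exp_add]; congr 1; ring
      rw [h1, h2, add_zero, zero_add]
      ring
    · exact ENNReal.ofReal_ne_top
  have hmeas : Measurable fun v : ℝ =>
      ENNReal.ofReal (v ^ (a - 1) * Real.exp (-(1 / 2) * v ^ 2)) := by
    have : Measurable fun v : ℝ => v ^ (a - 1) := measurable_id.pow_const _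
    fun_prop
  rw [hswap, setLIntegral_congr_fun measurableSet_Ioi hinner, lintegral_mul_const _ hmeas]

theorem lintegral_rpow_mul_gaussian_ne_top {a : ℝ} (ha : 0 < a) :
    ∫⁻ v in Ioi (0 : ℝ), ENNReal.ofReal (v ^ (a - 1) * Real.exp (-(1 / 2) * v ^ 2)) ≠ ∞ := by
  have hi := integrableOn_rpow_mul_exp_neg_mul_sq (b := 1 / 2) (by norm_num)
    (s := a - 1) (by linarith)
  have := (hasFiniteIntegral_iff_ofReal ((ae_restrict_iff' measurableSet_Ioi).2
    (Eventually.of_forall fun v hv => mul_nonneg (Real.rpow_nonneg (le_of_lt hv) _)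
      (Real.exp_pos _).le))).1 hi.2
  exact this.ne

theorem lintegral_rpow_mul_gaussian_ne_zero (a : ℝ) :
    ∫⁻ v in Ioi (0 : ℝ), ENNReal.ofReal (v ^ (a - 1) * Real.exp (-(1 / 2) * v ^ 2)) ≠ 0 := by
  refine (setLIntegral_pos measurableSet_Ioi (by simp) ?_ fun v hv => ?_).ne'
  · have : Measurable fun v : ℝ => v ^ (a - 1) := measurable_id.pow_const _
    fun_prop
  · exact ENNReal.ofReal_pos.2 (mul_pos (Real.rpow_pos_of_pos hv _) (Real.exp_pos _))

theorem lintegral_rayLoss_normal_ne_top (hρ : IsEvenLoss ρ)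
    (hfin : Integrable fun x => ρ x * Real.exp (-x ^ 2 / 2)) {a : ℝ} (ha : 0 < a) :
    ∫⁻ z, rayLoss ρ normalGenerator a z 0 ≠ ∞ := by
  rw [lintegral_rayLoss_normal hρ.cont.measurable hρ.nonneg]
  exact ENNReal.mul_ne_top (lintegral_rpow_mul_gaussian_ne_top ha)
    ((hasFiniteIntegral_iff_ofReal (Eventually.of_forall fun x =>
      mul_nonneg (hρ.nonneg x) (Real.exp_pos _).le)).1 hfin.2).ne

theorem integrable_of_lintegral_rayLoss_normal_ne_top (hρ : IsEvenLoss ρ) {a : ℝ}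
    (h : ∫⁻ z, rayLoss ρ normalGenerator a z 0 ≠ ∞) :
    Integrable fun x => ρ x * Real.exp (-x ^ 2 / 2) := by
  have hc := hρ.cont
  refine ⟨Continuous.aestronglyMeasurable (by fun_prop), ?_⟩
  rw [hasFiniteIntegral_iff_ofReal (Eventually.of_forall fun x =>
    mul_nonneg (hρ.nonneg x) (Real.exp_pos _).le)]
  rw [lintegral_rayLoss_normal hρ.cont.measurable hρ.nonneg] at h
  refine lt_top_iff_ne_top.2 fun htop => h ?_
  rw [htop, ENNReal.mul_top (lintegral_rpow_mul_gaussian_ne_zero a)]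

/-- Finiteness of the risk of the estimate `0` bounds the loss along all rays that are strictly
less inclined than the horizontal one. -/
theorem rayLoss_zero_ne_top_of_lt_one {f : ℝ → ℝ} (hρ : IsEvenLoss ρ)
    (hf : IsDecreasingGenerator f) {a : ℝ} (hfin : ∫⁻ z, rayLoss ρ f a z 0 ≠ ∞) {q : ℝ}
    (hq0 : 0 ≤ q) (hq : q < 1) : rayLoss ρ f a 0 q ≠ ∞ := by
  have hae := ae_lt_top (measurable_rayLoss hρ.cont.measurable hf.meas a 0) hfin
  have hq2 : 0 < 1 - q ^ 2 := by nlinarith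
  -- Almost every ray has finite loss, and z > q/√(1-q²) says precisely that z/√(z²+1) > q, so such
  -- a ray dominates the normalized estimate q.
  obtain ⟨z, hz, hzM⟩ : ∃ z, rayLoss ρ f a z 0 < ∞ ∧ z ∈ Ioi (q / √(1 - q ^ 2)) := by
    have hne : ∃ᵐ z : ℝ, z ∈ Ioi (q / √(1 - q ^ 2)) := frequently_ae_mem_iff.2 (by simp)
    obtain ⟨z, h1, h2⟩ := (hne.and_eventually hae).exists
    exact ⟨z, h2, h1⟩
  have h1 : 0 < √(z ^ 2 + 1) := Real.sqrt_pos.2 (by positivity)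
  have hz0 : 0 ≤ z := (div_nonneg hq0 (Real.sqrt_nonneg _)).trans hzM.le
  rw [rayLoss_eq_zero_ray, add_zero] at hz
  have hpos : 0 < (z ^ 2 + 1) ^ (-((a + 1) / 2)) := Real.rpow_pos_of_pos (by positivity) _
  have hfin' : rayLoss ρ f a 0 (z / √(z ^ 2 + 1)) ≠ ∞ := fun h => by
    rw [h, ENNReal.mul_top (by simpa using hpos)] at hz
    exact hz.ne rfl
  refine ne_top_of_le_ne_top hfin' (rayLoss_mono hρ ?_)
  rw [zero_add, zero_add, abs_of_nonneg hq0, abs_of_nonneg (by positivity), le_div_iff₀ h1]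
  refine abs_le_of_sq_le_sq' ?_ hz0 |>.2
  rw [mul_pow, Real.sq_sqrt (by positivity)]
  have h2 : q < z * √(1 - q ^ 2) := (div_lt_iff₀ (Real.sqrt_pos.2 hq2)).1 hzM
  have h3 : q ^ 2 ≤ (z * √(1 - q ^ 2)) ^ 2 := by gcongr
  rw [mul_pow, Real.sq_sqrt hq2.le] at h3
  linarith

/-- For z ≤ -g the error is no larger than that of g = 0. For -g < z < t one has (z+g)² ≤ z² + 1 - κ
with κ = t² + 1 - (t+g)² > 0, so on this bounded range the normalized estimates stay below some q <
1, where rays have finite loss. -/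
theorem truncLoss_ne_top_of_sq_lt {f : ℝ → ℝ} (hρ : IsEvenLoss ρ) (hf : IsDecreasingGenerator f)
    {a : ℝ} (ha : 0 < a) (hfin : ∫⁻ z, rayLoss ρ f a z 0 ≠ ∞) {t g : ℝ} (hg : 0 ≤ g)
    (h : (t + g) ^ 2 < t ^ 2 + 1) : truncLoss ρ f a t g ≠ ∞ := by
  set κ := 1 - 2 * t * g - g ^ 2 with hκ
  have hκ0 : 0 < κ := by rw [hκ]; nlinarith
  set M := max |t| g with hM
  have hM0 : 0 ≤ M := (abs_nonneg t).trans (le_max_left _ _)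
  set q := √(max 0 (1 - κ / (M ^ 2 + 1))) with hqdef
  have hq1 : q < 1 := by
    rw [hqdef, Real.sqrt_lt' one_pos, one_pow, max_lt_iff]
    exact ⟨one_pos, by have : 0 < κ / (M ^ 2 + 1) := by positivity
                       linarith⟩
  have hK := rayLoss_zero_ne_top_of_lt_one hρ hf hfin (Real.sqrt_nonneg _) hq1
  have hbound : ∀ z ∈ Iio t, rayLoss ρ f a z g ≤
      rayLoss ρ f a z 0 + (Ioo (-g) t).indicator (fun _ => rayLoss ρ f a 0 q) z := by
    intro z hz
    have hz : z < t := hz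
    rcases le_or_gt z (-g) with hzg | hzg
    · refine (rayLoss_mono hρ ?_).trans le_self_add
      rw [add_zero, abs_of_nonpos (by linarith), abs_of_nonpos (by linarith)]
      linarith
    · rw [indicator_of_mem (show z ∈ Ioo (-g) t from ⟨hzg, hz⟩)]
      refine le_trans ?_ le_add_self
      rw [rayLoss_eq_zero_ray]
      have hpre : (z ^ 2 + 1) ^ (-((a + 1) / 2)) ≤ 1 :=
        Real.rpow_le_one_of_one_le_of_nonpos (by nlinarith [sq_nonneg z]) (by linarith)
      refine (mul_le_of_le_one_left zero_le (by simpa using hpre)).trans (rayLoss_mono hρ ?_)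
      have hs : 0 < √(z ^ 2 + 1) := Real.sqrt_pos.2 (by positivity)
      rw [zero_add, zero_add, abs_of_nonneg (Real.sqrt_nonneg _), abs_div, abs_of_pos hs,
        div_le_iff₀ hs]
      refine abs_le_of_sq_le_sq ?_ (by positivity)
      rw [mul_pow, Real.sq_sqrt (le_max_left _ _), Real.sq_sqrt (by positivity)]
      have hzM : z ^ 2 ≤ M ^ 2 := by
        refine sq_le_sq' ?_ ?_
        · linarith [le_max_right |t| g]
        · linarith [le_max_left |t| g, le_abs_self t]
      have h4 : κ / (M ^ 2 + 1) * (z ^ 2 + 1) ≤ κ := by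
        rw [div_mul_eq_mul_div, div_le_iff₀ (by positivity)]
        gcongr
      have h5 : (1 - κ / (M ^ 2 + 1)) * (z ^ 2 + 1) ≤
          max 0 (1 - κ / (M ^ 2 + 1)) * (z ^ 2 + 1) := by
        gcongr
        exact le_max_right _ _
      nlinarith
  refine ne_top_of_le_ne_top ?_ (setLIntegral_mono' measurableSet_Iio hbound)
  rw [lintegral_add_right _ (measurable_const.indicator measurableSet_Ioo),
    lintegral_indicator measurableSet_Ioo, setLIntegral_const]
  refine ENNReal.add_ne_top.2 ⟨ne_top_of_le_ne_top hfin (setLIntegral_le_lintegral _ _),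
    ENNReal.mul_ne_top hK ?_⟩
  refine ne_top_of_le_ne_top ?_ (Measure.restrict_apply_le _ _)
  simp

end Finiteness

end BoundedMean

namespace BoundedMean

variable {ρ r : ℝ → ℝ}

/-! ### Inversion of the half-line and the sign of the derivative at √(t²+1) -/

section Inversion

theorem setIntegral_Ioi_eq_mul {c : ℝ} (hc : 0 < c) (F : ℝ → ℝ) :
    ∫ v in Ioi (0 : ℝ), F v = c * ∫ w in Ioi (0 : ℝ), F (c * w) := by
  rw [integral_comp_mul_left_Ioi F 0 hc, mul_zero, smul_eq_mul, mul_inv_cancel_left₀ hc.ne']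

/-- The inversion `τ ↦ d² / τ`, with `d² = t² + 1`, reverses the sign of the derivative of the
posterior loss at the estimate `d`. -/
theorem integral_lossDeriv_inversion (hr : IsOddDeriv ρ r) (a t : ℝ) {d τ : ℝ} (hd : 0 < d)
    (hdt : d ^ 2 = t ^ 2 + 1) (hτ : 0 < τ) :
    ∫ v in Ioi (0 : ℝ), lossDeriv r a (d - t) (v, t - d ^ 2 / τ) =
      -((τ / d) ^ (a + 2) * ∫ v in Ioi (0 : ℝ), lossDeriv r a (d - t) (v, t - τ)) := by
  have hc : 0 < τ / d := div_pos hτ hd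
  suffices ∫ w in Ioi (0 : ℝ), lossDeriv r a (d - t) (τ / d * w, t - d ^ 2 / τ) =
      ∫ v in Ioi (0 : ℝ), -(τ / d) ^ (a + 1) * lossDeriv r a (d - t) (v, t - τ) by
    rw [setIntegral_Ioi_eq_mul hc, this, integral_const_mul, show a + 2 = a + 1 + 1 by ring,
      Real.rpow_add_one hc.ne' (a + 1)]
    ring
  refine setIntegral_congr_fun measurableSet_Ioi fun w hw => ?_
  have hw : 0 < w := hw
  simp only [lossDeriv, normalWeight]
  have h1 : τ / d * w * (t - d ^ 2 / τ + (d - t)) = -(w * (t - τ + (d - t))) := by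
    field_simp; ring
  have h2 : (τ / d * w) ^ 2 * ((t - d ^ 2 / τ) ^ 2 + 1) = w ^ 2 * ((t - τ) ^ 2 + 1) := by
    have : (τ / d) ^ 2 * ((t - d ^ 2 / τ) ^ 2 + 1) = (t - τ) ^ 2 + 1 := by
      have h3 : (t - d ^ 2 / τ) ^ 2 + 1 = d ^ 2 - 2 * t * d ^ 2 / τ + d ^ 4 / τ ^ 2 := by
        rw [hdt]; ring_nf
        have : d ^ 4 = (d ^ 2) ^ 2 := by ring
        rw [this, hdt]; ring
      rw [h3]
      field_simp
      rw [hdt]; ring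
    calc (τ / d * w) ^ 2 * ((t - d ^ 2 / τ) ^ 2 + 1)
        = w ^ 2 * ((τ / d) ^ 2 * ((t - d ^ 2 / τ) ^ 2 + 1)) := by ring
      _ = _ := by rw [this]
  rw [h1, h2, hr.odd, Real.mul_rpow hc.le hw.le, Real.rpow_add_one hc.ne']
  ring

/-- Put τ = t - z, d = √(t²+1), and let F(τ) be the derivative on the ray t - τ. The inversion
carries the part τ > d onto 0 < τ < d with integrand -(τ/d)^a F(τ). The total is the integral of (1
- (τ/d)^a) F(τ) over (0,d), where both factors are positive: F because the error d - τ is, the other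
because a > 0. -/
theorem integral_lossDeriv_pos (hr : IsOddDeriv ρ r) {a : ℝ} (ha : 0 < a) (t : ℝ)
    (hint : Integrable (lossDeriv r a (√(t ^ 2 + 1) - t)) (wedge t)) :
    0 < ∫ q, lossDeriv r a (√(t ^ 2 + 1) - t) q ∂wedge t := by
  set d := √(t ^ 2 + 1) with hddef
  have hd : 0 < d := Real.sqrt_pos.2 (by positivity)
  have hdt : d ^ 2 = t ^ 2 + 1 := Real.sq_sqrt (by positivity)
  set F : ℝ → ℝ := fun w => ∫ v in Ioi (0 : ℝ), lossDeriv r a (d - t) (v, t - w) with hF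
  have hsub := integrableOn_Iio_iff_sub_mul one_pos t
    (fun z => ∫ v in Ioi (0 : ℝ), lossDeriv r a (d - t) (v, z))
  have hFint : IntegrableOn F (Ioi 0) := by
    have h1 : IntegrableOn (fun z => ∫ v in Ioi (0 : ℝ), lossDeriv r a (d - t) (v, z)) (Iio t) :=
      Integrable.integral_prod_right hint
    simpa only [one_mul] using hsub.1 h1
  have htotal : ∫ q, lossDeriv r a (d - t) q ∂wedge t = ∫ w in Ioi 0, F w := by
    rw [wedge, integral_prod_symm _ hint, setIntegral_Iio_eq_sub_mul one_pos t]
    simp only [one_mul, hF]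
  have himg : (fun τ : ℝ => d ^ 2 / τ) '' Ioo 0 d = Ioi d := by
    ext x; constructor
    · rintro ⟨τ, hτ, rfl⟩
      rw [mem_Ioi, lt_div_iff₀ hτ.1]
      nlinarith [hτ.2]
    · intro hx
      have hx : d < x := hx
      have hx0 : 0 < x := hd.trans hx
      refine ⟨d ^ 2 / x, ⟨by positivity, ?_⟩, by field_simp⟩
      rw [div_lt_iff₀ hx0]; nlinarith
  have hderiv : ∀ τ ∈ Ioo 0 d,
      HasDerivWithinAt (fun τ : ℝ => d ^ 2 / τ) (-(d ^ 2 / τ ^ 2)) (Ioo 0 d) τ := fun τ hτ => by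
    have := ((hasDerivAt_inv hτ.1.ne').const_mul (d ^ 2)).hasDerivWithinAt (s := Ioo 0 d)
    exact this.congr_deriv (by ring)
  have hinj : InjOn (fun τ : ℝ => d ^ 2 / τ) (Ioo 0 d) := fun x hx y hy h => by
    have hx' := hx.1.ne'
    have hy' := hy.1.ne'
    field_simp at h
    exact h.symm
  have hscale : ∀ τ ∈ Ioo 0 d, |-(d ^ 2 / τ ^ 2)| • F (d ^ 2 / τ) = -((τ / d) ^ a * F τ) := by
    intro τ hτ
    have hc : 0 < τ / d := div_pos hτ.1 hd
    have hτ0 := hτ.1.ne'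
    rw [abs_neg, abs_of_nonneg (by positivity), smul_eq_mul, hF]
    dsimp only
    rw [integral_lossDeriv_inversion hr a t hd hdt hτ.1, Real.rpow_add hc, Real.rpow_two]
    field_simp
  have hupper : ∫ w in Ioi d, F w = ∫ τ in Ioo 0 d, -((τ / d) ^ a * F τ) := by
    rw [← himg, integral_image_eq_integral_abs_deriv_smul measurableSet_Ioo hderiv hinj]
    exact setIntegral_congr_fun measurableSet_Ioo hscale
  have hupper_int : IntegrableOn (fun τ => -((τ / d) ^ a * F τ)) (Ioo 0 d) := by
    have h1 : IntegrableOn F (Ioi d) := hFint.mono_set (Ioi_subset_Ioi hd.le)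
    rw [← himg, integrableOn_image_iff_integrableOn_abs_deriv_smul measurableSet_Ioo hderiv
      hinj] at h1
    exact h1.congr_fun hscale measurableSet_Ioo
  have hlower_int : IntegrableOn F (Ioo 0 d) := hFint.mono_set Ioo_subset_Ioi_self
  have hsplit : ∫ w in Ioi 0, F w = ∫ τ in Ioo 0 d, (1 - (τ / d) ^ a) * F τ := by
    rw [← Ioc_union_Ioi_eq_Ioi hd.le, setIntegral_union
      (Ioc_disjoint_Ioi_same) measurableSet_Ioi
      (hFint.mono_set Ioc_subset_Ioi_self) (hFint.mono_set (Ioi_subset_Ioi hd.le)), hupper,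
      integral_Ioc_eq_integral_Ioo, ← integral_add hlower_int hupper_int]
    congr 1
    funext τ
    ring
  have hinner : ∀ᵐ τ, 0 < τ →
      IntegrableOn (fun v => lossDeriv r a (d - t) (v, t - τ)) (Ioi 0) := by
    have h1 : ∀ᵐ z, z ∈ Iio t → IntegrableOn (fun v => lossDeriv r a (d - t) (v, z)) (Ioi 0) :=
      (ae_restrict_iff' measurableSet_Iio).1 hint.prod_left_ae
    filter_upwards [ae_affine h1 (show (-1 : ℝ) ≠ 0 by norm_num) t] with τ hτ hτ0
    have := hτ (show t + -1 * τ < t by linarith)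
    rwa [show t + -1 * τ = t - τ by ring] at this
  have hFpos : ∀ᵐ τ, τ ∈ Ioo 0 d → 0 < F τ := by
    filter_upwards [hinner] with τ hτ hτd
    have hpos : ∀ v ∈ Ioi (0 : ℝ), 0 < lossDeriv r a (d - t) (v, t - τ) := fun v hv => by
      have hv : 0 < v := hv
      refine mul_pos (hr.pos _ (mul_pos hv ?_)) (mul_pos hv (normalWeight_pos a hv))
      dsimp only
      linarith [hτd.2]
    exact integral_pos_of_pos_on (s := Ioi 0) (hτ hτd.1)
      ((ae_restrict_iff' measurableSet_Ioi).2 (Eventually.of_forall fun v hv => (hpos v hv).le))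
      (by simp) (Eventually.of_forall fun v hv => hpos v hv)
  rw [htotal, hsplit]
  have hpos : ∀ᵐ τ ∂volume.restrict (Ioo 0 d), 0 < (1 - (τ / d) ^ a) * F τ := by
    refine (ae_restrict_iff' measurableSet_Ioo).2 ?_
    filter_upwards [hFpos] with τ hτ hτd
    refine mul_pos (sub_pos.2 (Real.rpow_lt_one (div_pos hτd.1 hd).le ?_ ha)) (hτ hτd)
    exact (div_lt_one hd).2 hτd.2
  refine integral_pos_of_pos_on (s := univ) ?_ (hpos.mono fun _ h => h.le) (by simpa using hd)
    (hpos.mono fun _ h _ => h)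
  refine (hlower_int.add hupper_int).congr (Eventually.of_forall fun τ => ?_)
  simp only [Pi.add_apply]
  ring

end Inversion

/-! ### Single sign change of the derivative in the scale v -/

section Crossing

/-- The derivative of the posterior loss at the fixed scale `v`. -/
noncomputable def sliceDeriv (r : ℝ → ℝ) (t g v : ℝ) : ℝ :=
  ∫ z in Iio t, r (v * (z + g)) * Real.exp (-(v * z) ^ 2 / 2)

theorem integrable_comp_mul_gaussian (hfin : Integrable fun x => ρ x * Real.exp (-x ^ 2 / 2))
    {v : ℝ} (hv : 0 < v) : Integrable fun z => ρ (v * z) * Real.exp (-(v * z) ^ 2 / 2) :=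
  hfin.comp_mul_left' hv.ne'

theorem integrable_gaussian_mul {v : ℝ} (hv : 0 < v) :
    Integrable fun z : ℝ => Real.exp (-(v * z) ^ 2 / 2) := by
  have := integrable_exp_neg_mul_sq (b := v ^ 2 / 2) (by positivity)
  refine this.congr (Eventually.of_forall fun z => ?_)
  simp only
  congr 1; ring

/-- Where z + g ≤ 0, the convexity bound `le_div` with step v g replaces |r(v(z+g))| by ρ(vz)/(vg),
which is Gaussian integrable; where z + g > 0, monotonicity bounds it by the value at z = t. -/
theorem integrableOn_sliceDeriv (hρ : IsEvenLoss ρ) (hr : IsOddDeriv ρ r)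
    (hfin : Integrable fun x => ρ x * Real.exp (-x ^ 2 / 2)) (t : ℝ) {g v : ℝ} (hg : 0 < g)
    (hv : 0 < v) :
    IntegrableOn (fun z => r (v * (z + g)) * Real.exp (-(v * z) ^ 2 / 2)) (Iio t) := by
  have h1 := ((integrable_comp_mul_gaussian hfin hv).div_const (v * g)).add
    ((integrable_gaussian_mul hv).const_mul |r (v * (t + g))|)
  refine Integrable.mono' h1.integrableOn ?_ ?_
  · have := hr.mono.measurable
    exact Measurable.aestronglyMeasurable (by fun_prop)
  · refine (ae_restrict_iff' measurableSet_Iio).2 (Eventually.of_forall fun z hz => ?_)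
    have hz : z < t := hz
    have hvg : 0 < v * g := mul_pos hv hg
    have hle : |r (v * (z + g))| ≤ ρ (v * z) / (v * g) + |r (v * (t + g))| := by
      rcases le_or_gt (z + g) 0 with h | h
      · have h2 : v * (z + g) ≤ 0 := mul_nonpos_of_nonneg_of_nonpos hv.le h
        have h3 := hr.le_div (-(v * (z + g))) (v * g) (by linarith) hvg
        rw [show -(v * (z + g)) + v * g = -(v * z) by ring, hρ.even] at h3
        have h4 : |r (v * (z + g))| = r (-(v * (z + g))) := by
          rw [hr.odd]
          refine abs_of_nonpos ?_
          have h5 := hr.mono h2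
          have h6 : r 0 = 0 := by have := hr.odd 0; rw [neg_zero] at this; linarith
          linarith
        rw [h4]
        exact h3.trans (le_add_of_nonneg_right (abs_nonneg _))
      · have h2 : 0 < r (v * (z + g)) := hr.pos _ (mul_pos hv h)
        rw [abs_of_pos h2]
        refine (hr.mono (by gcongr : v * (z + g) ≤ v * (t + g))).trans ((le_abs_self _).trans
          (le_add_of_nonneg_left (div_nonneg (hρ.nonneg _) hvg.le)))
    rw [norm_mul, Real.norm_eq_abs, Real.norm_of_nonneg (Real.exp_pos _).le]
    simp only [Pi.add_apply]
    calc |r (v * (z + g))| * Real.exp (-(v * z) ^ 2 / 2)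
        ≤ (ρ (v * z) / (v * g) + |r (v * (t + g))|) * Real.exp (-(v * z) ^ 2 / 2) := by gcongr
      _ = _ := by ring

/-- The derivative at the scale `v` changes sign at most once, from negative to positive. -/
theorem sliceDeriv_pos_of_lt (hρ : IsEvenLoss ρ) (hr : IsOddDeriv ρ r)
    (hfin : Integrable fun x => ρ x * Real.exp (-x ^ 2 / 2)) {t g : ℝ} (hg : 0 < g)
    (hd : 0 < t + g) {v v' : ℝ} (hv : 0 < v) (hvv' : v < v') (h : 0 ≤ sliceDeriv r t g v) :
    0 < sliceDeriv r t g v' := by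
  have hv' : 0 < v' := hv.trans hvv'
  have hi := integrableOn_sliceDeriv hρ hr hfin t hg hv
  have hi' := integrableOn_sliceDeriv hρ hr hfin t hg hv'
  have hr0 : r 0 = 0 := by have := hr.odd 0; rw [neg_zero] at this; linarith
  rcases le_or_gt 0 t with ht | ht
  -- Case t ≥ 0. After y = u z the Gaussian factor no longer depends on u; raising u increases the
  -- argument of r and extends the range only to y ≥ 0, where r(y + u g) is positive.
  · have key : ∀ u, 0 < u → sliceDeriv r t g u =
        u⁻¹ * ∫ y, (Iio (u * t)).indicator (fun y => r (y + u * g) * Real.exp (-y ^ 2 / 2)) y := by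
      intro u hu
      rw [sliceDeriv, setIntegral_Iio_eq_mul (inv_pos.2 hu), integral_indicator measurableSet_Iio,
        div_inv_eq_mul, mul_comm t u]
      congr 1
      refine setIntegral_congr_fun measurableSet_Iio fun y _ => ?_
      rw [mul_add, mul_inv_cancel_left₀ hu.ne']
    have keyi : ∀ u, 0 < u →
        IntegrableOn (fun z => r (u * (z + g)) * Real.exp (-(u * z) ^ 2 / 2)) (Iio t) →
        Integrable ((Iio (u * t)).indicator fun y => r (y + u * g) * Real.exp (-y ^ 2 / 2)) := by
      intro u hu hi
      rw [integrable_indicator_iff measurableSet_Iio]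
      rw [integrableOn_Iio_iff_mul (inv_pos.2 hu), div_inv_eq_mul, mul_comm t u] at hi
      refine hi.congr_fun (fun y _ => ?_) measurableSet_Iio
      dsimp only
      rw [mul_add, mul_inv_cancel_left₀ hu.ne']
    rw [key v hv] at h
    rw [key v' hv']
    have h0 := nonneg_of_mul_nonneg_right h (inv_pos.2 hv)
    refine mul_pos (inv_pos.2 hv') (h0.trans_lt (sub_pos.1 ?_))
    rw [← integral_sub (keyi v' hv' hi') (keyi v hv hi)]
    have hmono : ∀ y, r (y + v * g) ≤ r (y + v' * g) := fun y => hr.mono (by gcongr)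
    refine integral_pos_of_pos_on (s := Ioo (-(v' * g)) (-(v * g)))
      ((keyi v' hv' hi').sub (keyi v hv hi)) (Eventually.of_forall fun y => ?_)
      (by simpa using mul_lt_mul_of_pos_right hvv' hg) (Eventually.of_forall fun y hy => ?_)
    · simp only [Pi.zero_apply, sub_nonneg]
      by_cases h1 : y < v * t
      · have h2 : y < v' * t := h1.trans_le (by gcongr)
        rw [indicator_of_mem (mem_Iio.2 h1), indicator_of_mem (mem_Iio.2 h2)]
        have := hmono y
        gcongr
      · rw [indicator_of_notMem (by simpa using h1)]
        have h3 : 0 ≤ y := (mul_nonneg hv.le ht).trans (not_lt.1 h1)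
        rw [indicator_apply]
        split_ifs
        · exact mul_nonneg (hr.pos _ (by positivity)).le (Real.exp_pos _).le
        · exact le_rfl
    · have h1 : y < v * t := hy.2.trans_le (by
        have := mul_pos hv hg; have := mul_nonneg hv.le ht; linarith)
      have h2 : y < v' * t := h1.trans_le (by gcongr)
      rw [indicator_of_mem (mem_Iio.2 h1), indicator_of_mem (mem_Iio.2 h2), ← sub_mul]
      refine mul_pos (sub_pos.2 ?_) (Real.exp_pos _)
      exact (hr.neg (by linarith [hy.2])).trans (hr.pos _ (by linarith [hy.1]))
  -- Case t < 0. After w = u(t - z) the range no longer depends on u. The ratio E of the two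
  -- Gaussian factors decreases in w because t < 0, while r(v(t+g) - w) turns from positive to
  -- negative at w = v(t+g); replacing E by its value c there can only lower the integrand.
  · have key : ∀ u, 0 < u → sliceDeriv r t g u =
        u⁻¹ * ∫ w in Ioi 0, r (u * (t + g) - w) * Real.exp (-(u * t - w) ^ 2 / 2) := by
      intro u hu
      rw [sliceDeriv, setIntegral_Iio_eq_sub_mul (inv_pos.2 hu)]
      congr 1
      refine setIntegral_congr_fun measurableSet_Ioi fun w _ => ?_
      congr 2
      · field_simp; ring
      · field_simp
    have keyi : ∀ u, 0 < u →
        IntegrableOn (fun z => r (u * (z + g)) * Real.exp (-(u * z) ^ 2 / 2)) (Iio t) →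
        IntegrableOn (fun w => r (u * (t + g) - w) * Real.exp (-(u * t - w) ^ 2 / 2)) (Ioi 0) := by
      intro u hu hi
      rw [integrableOn_Iio_iff_sub_mul (inv_pos.2 hu)] at hi
      refine hi.congr_fun (fun w _ => ?_) measurableSet_Ioi
      dsimp only
      congr 2
      · field_simp; ring
      · field_simp
    rw [key v hv] at h
    rw [key v' hv']
    have h0 := nonneg_of_mul_nonneg_right h (inv_pos.2 hv)
    set E : ℝ → ℝ := fun w => Real.exp (-(v' ^ 2 - v ^ 2) * t ^ 2 / 2 + (v' - v) * t * w) with hE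
    have hEe : ∀ w, Real.exp (-(v' * t - w) ^ 2 / 2) = E w * Real.exp (-(v * t - w) ^ 2 / 2) :=
      fun w => by rw [hE, ← Real.exp_add]; congr 1; ring
    set c := E (v * (t + g)) with hc
    have hc0 : 0 < c := Real.exp_pos _
    refine mul_pos (inv_pos.2 hv') ((mul_nonneg hc0.le h0).trans_lt (sub_pos.1 ?_))
    rw [← integral_const_mul, ← integral_sub (keyi v' hv' hi') ((keyi v hv hi).const_mul c)]
    have hdiff : ∀ w, w ≠ v * (t + g) → 0 < r (v' * (t + g) - w) * Real.exp (-(v' * t - w) ^ 2 / 2) -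
        c * (r (v * (t + g) - w) * Real.exp (-(v * t - w) ^ 2 / 2)) := by
      intro w hw
      have h1 : r (v * (t + g) - w) ≤ r (v' * (t + g) - w) := hr.mono (by gcongr)
      have h2 : 0 < r (v * (t + g) - w) * (E w - c) := by
        have hvt : (v' - v) * t < 0 := mul_neg_of_pos_of_neg (by linarith) ht
        rcases lt_or_gt_of_ne hw with h3 | h3
        · refine mul_pos (hr.pos _ (by linarith)) (sub_pos.2 (Real.exp_lt_exp.2 ?_))
          have := mul_lt_mul_of_neg_left h3 hvt
          linarith
        · refine mul_pos_of_neg_of_neg (hr.neg (by linarith)) (sub_neg.2 (Real.exp_lt_exp.2 ?_))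
          have := mul_lt_mul_of_neg_left h3 hvt
          linarith
      have h3 : 0 < E w := Real.exp_pos _
      have h4 : 0 < Real.exp (-(v * t - w) ^ 2 / 2) := Real.exp_pos _
      rw [hEe]
      have h5 := mul_le_mul_of_nonneg_right h1 h3.le
      have h6 : 0 < r (v' * (t + g) - w) * E w - c * r (v * (t + g) - w) := by linarith
      have h7 := mul_pos h6 h4
      linarith
    have hae : ∀ᵐ w ∂volume.restrict (Ioi (0 : ℝ)), w ≠ v * (t + g) :=
      ae_restrict_of_ae (Measure.ae_ne volume _)
    exact integral_pos_of_pos_on (s := univ) ((keyi v' hv' hi').sub ((keyi v hv hi).const_mul c))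
      (hae.mono fun w hw => (hdiff w hw).le) (by simp) (hae.mono fun w hw _ => hdiff w hw)

end Crossing

end BoundedMean

/-! ### Normal model: Bayes estimates lie above the leaders -/

namespace BoundedMean

theorem abs_lt_sqrt_sq_add_one (t : ℝ) : |t| < √(t ^ 2 + 1) :=
  Real.lt_sqrt_of_sq_lt (by rw [sq_abs]; linarith)

theorem sq_add_lt_of_lt_sqrt_sub {t g : ℝ} (h0 : 0 ≤ t + g) (h : g < √(t ^ 2 + 1) - t) :
    (t + g) ^ 2 < t ^ 2 + 1 :=
  (Real.lt_sqrt h0).1 (by linarith)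

variable {ρ r : ℝ → ℝ} {a b t : ℝ}

/-- A leader lies strictly below `√(t² + 1) - t`. -/
theorem IsLeader.lt_sqrt_sub (hρ : IsEvenLoss ρ) (hc : ConvexOn ℝ univ ρ)
    (hfin : Integrable fun x => ρ x * Real.exp (-x ^ 2 / 2)) (ha : 0 < a) {g : ℝ}
    (h : IsLeader ρ normalGenerator a t g) : g < √(t ^ 2 + 1) - t := by
  obtain ⟨r, hr⟩ := hρ.exists_isOddDeriv hc
  by_contra! hge
  set e := √(t ^ 2 + 1) - t with he
  have he0 : 0 < e := sub_pos.2 ((le_abs_self t).trans_lt (abs_lt_sqrt_sq_add_one t))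
  have hL := lintegral_rayLoss_normal_ne_top hρ hfin ha
  have h0 := ne_top_of_le_ne_top hL (truncLoss_zero_le a t)
  have hg := ne_top_of_le_ne_top hL h.truncLoss_le
  have hefin : truncLoss ρ normalGenerator a t e ≠ ∞ :=
    ne_top_of_le_ne_top (max_ne_top h0 hg) (truncLoss_convex_le_max hρ hc a t he0.le hge)
  -- If a leader had g ≥ e, quasiconvexity would make e optimal on [0,e], and the derivative at e
  -- would be at most 0.
  have key := lossDeriv_of_isMin hρ hc hr he0.ne hefin h0 fun τ hτ => by
    have hx0 : 0 ≤ e + τ * (0 - e) := by nlinarith [hτ.2]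
    have hxe : e + τ * (0 - e) ≤ e := by nlinarith [hτ.1]
    refine (truncLoss_convex_le_max hρ hc a t hxe hge).trans (max_le le_rfl (h.le _ hx0))
  have := integral_lossDeriv_pos hr ha t key.1
  have h2 := key.2
  nlinarith

theorem leadersInterior_normal (hρ : IsEvenLoss ρ) (hc : ConvexOn ℝ univ ρ)
    (hfin : Integrable fun x => ρ x * Real.exp (-x ^ 2 / 2)) (ha : 0 < a) :
    LeadersInterior ρ normalGenerator a := by
  intro t g h
  have hs : 0 < √(t ^ 2 + 1) := (abs_nonneg t).trans_lt (abs_lt_sqrt_sq_add_one t)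
  have h1 : (t + g) / √(t ^ 2 + 1) < 1 := by
    rw [div_lt_one hs]
    linarith [h.lt_sqrt_sub hρ hc hfin ha]
  have h0 : 0 ≤ (t + g) / √(t ^ 2 + 1) := div_nonneg h.add_nonneg hs.le
  obtain ⟨q, hq, hq1⟩ := exists_between h1
  exact ⟨q, hq, rayLoss_zero_ne_top_of_lt_one hρ isDecreasingGenerator_normal
    (lintegral_rayLoss_normal_ne_top hρ hfin ha) (h0.trans hq.le) hq1⟩

/-- The gap below √(t²+1) - t provides a point to the right of g with finite loss, which is what the
one-sided differentiation needs. -/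
theorem lossDeriv_nonneg_of_forall_le (hρ : IsEvenLoss ρ) (hc : ConvexOn ℝ univ ρ)
    (hr : IsOddDeriv ρ r) (hfin : Integrable fun x => ρ x * Real.exp (-x ^ 2 / 2)) (hb : 0 < b)
    {g : ℝ} (h0 : 0 ≤ g) (h1 : 0 ≤ t + g) (hlt : g < √(t ^ 2 + 1) - t)
    (hmin : ∀ g', truncLoss ρ normalGenerator b t g ≤ truncLoss ρ normalGenerator b t g') :
    Integrable (lossDeriv r b g) (wedge t) ∧ 0 ≤ ∫ q, lossDeriv r b g q ∂wedge t := by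
  have hL := lintegral_rayLoss_normal_ne_top hρ hfin hb
  have hfin' : ∀ x, g ≤ x → x < √(t ^ 2 + 1) - t → truncLoss ρ normalGenerator b t x ≠ ∞ :=
    fun x hx hx' => truncLoss_ne_top_of_sq_lt hρ isDecreasingGenerator_normal hb hL (h0.trans hx)
      (sq_add_lt_of_lt_sqrt_sub (by linarith) hx')
  obtain ⟨g₁, hg₁, hg₁'⟩ := exists_between hlt
  have key := lossDeriv_of_isMin hρ hc hr hg₁.ne' (hfin' g le_rfl hlt) (hfin' g₁ hg₁.le hg₁')
    fun τ _ => hmin _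
  exact ⟨key.1, nonneg_of_mul_nonneg_right key.2 (sub_pos.2 hg₁)⟩

/-- The part over [-t,t) cancels by oddness, and what remains lies in z < -t. -/
theorem setIntegral_odd_neg {Φ : ℝ → ℝ} (hodd : ∀ z, Φ (-z) = -Φ z) {t : ℝ} (ht : 0 ≤ t)
    (hi : IntegrableOn Φ (Iio t)) (hneg : ∀ᵐ z, z < 0 → Φ z < 0) : ∫ z in Iio t, Φ z < 0 := by
  have hsplit : Iio (-t) ∪ Ico (-t) t = Iio t := Iio_union_Ico_eq_Iio (by linarith)
  have hsub1 : Iio (-t) ⊆ Iio t := Iio_subset_Iio (by linarith)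
  have hmid : ∫ z in Ico (-t) t, Φ z = 0 := by
    have h1 : ∫ z in (-t)..t, Φ z = -∫ z in (-t)..t, Φ z := by
      conv_lhs => rw [← neg_neg t, ← intervalIntegral.integral_comp_neg, neg_neg]
      simp only [hodd, intervalIntegral.integral_neg]
    rw [integral_Ico_eq_integral_Ioo, ← integral_Ioc_eq_integral_Ioo,
      ← intervalIntegral.integral_of_le (by linarith)]
    linarith
  rw [← hsplit, setIntegral_union (Iio_disjoint_Ici le_rfl |>.mono_right Ico_subset_Ici_self)
    measurableSet_Ico (hi.mono_set hsub1) (hi.mono_set Ico_subset_Iio_self), hmid, add_zero]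
  have h2 : ∀ᵐ z ∂volume.restrict (Iio (-t)), 0 < -Φ z := by
    refine (ae_restrict_iff' measurableSet_Iio).2 (hneg.mono fun z hz hzt => ?_)
    have hzt : z < -t := hzt
    exact neg_pos.2 (hz (by linarith))
  have := integral_pos_of_pos_on (s := univ) (hi.mono_set hsub1).neg (h2.mono fun _ h => h.le)
    (by simp) (h2.mono fun _ h _ => h)
  simp only [Pi.neg_apply, integral_neg] at this
  linarith

theorem integral_lossDeriv_zero_neg (hr : IsOddDeriv ρ r) (ht : 0 ≤ t)
    (hi : Integrable (lossDeriv r b 0) (wedge t)) : ∫ q, lossDeriv r b 0 q ∂wedge t < 0 := by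
  rw [wedge, integral_prod_symm _ hi]
  refine setIntegral_odd_neg (fun z => ?_) ht (Integrable.integral_prod_right hi) ?_
  · rw [← integral_neg]
    congr 1
    funext v
    simp only [lossDeriv, normalWeight, add_zero, mul_neg, hr.odd, even_two.neg_pow, neg_mul]
  · have h1 : ∀ᵐ z, z ∈ Iio t → IntegrableOn (fun v => lossDeriv r b 0 (v, z)) (Ioi 0) :=
      (ae_restrict_iff' measurableSet_Iio).1 hi.prod_left_ae
    filter_upwards [h1] with z hz hz0
    have hneg : ∀ᵐ v ∂volume.restrict (Ioi (0 : ℝ)), 0 < -lossDeriv r b 0 (v, z) :=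
      (ae_restrict_iff' measurableSet_Ioi).2 (Eventually.of_forall fun v hv => by
        have hv : 0 < v := hv
        refine neg_pos.2 (mul_neg_of_neg_of_pos (hr.neg (mul_neg_of_pos_of_neg hv ?_))
          (mul_pos hv (normalWeight_pos b hv)))
        simpa using hz0)
    have := integral_pos_of_pos_on (s := univ) (hz (hz0.trans_le ht)).neg
      (hneg.mono fun _ h => h.le) (by simp) (hneg.mono fun _ h _ => h)
    simp only [Pi.neg_apply, integral_neg] at this
    linarith

theorem integral_lossDeriv_neg (hr : IsOddDeriv ρ r) {g : ℝ} (h : t + g ≤ 0)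
    (hi : Integrable (lossDeriv r b g) (wedge t)) : ∫ q, lossDeriv r b g q ∂wedge t < 0 := by
  have h2 : ∀ᵐ q ∂wedge t, 0 < -lossDeriv r b g q := by
    filter_upwards [ae_wedge_pos t] with q hq
    refine neg_pos.2 (mul_neg_of_neg_of_pos (hr.neg (mul_neg_of_pos_of_neg hq.1 ?_))
      (mul_pos hq.1 (normalWeight_pos b hq.1)))
    linarith [hq.2]
  have := integral_pos_of_pos_on (s := univ) hi.neg (h2.mono fun _ h => h.le)
    (by rw [wedge, ← univ_prod_univ, Measure.prod_prod]; simp) (h2.mono fun _ h _ => h)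
  simp only [Pi.neg_apply, integral_neg] at this
  linarith

theorem setIntegral_lossDeriv_slice (a g v : ℝ) :
    ∫ z in Iio t, lossDeriv r a g (v, z) =
      v * (v ^ a * Real.exp (-v ^ 2 / 2)) * sliceDeriv r t g v := by
  rw [sliceDeriv, ← integral_const_mul]
  congr 1
  funext z
  simp only [lossDeriv, normalWeight]
  rw [show -(v ^ 2 * (z ^ 2 + 1)) / 2 = -v ^ 2 / 2 + -(v * z) ^ 2 / 2 by ring, Real.exp_add]
  ring

/-- Slicing by v, the weights b and a differ by the increasing factor v^{a-b}, and the slice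
derivative has a single crossing from negative to positive. -/
theorem integral_lossDeriv_pos_of_nonneg (hρ : IsEvenLoss ρ) (hr : IsOddDeriv ρ r)
    (hfin : Integrable fun x => ρ x * Real.exp (-x ^ 2 / 2)) (hba : b < a) {g : ℝ} (hg : 0 < g)
    (hd : 0 < t + g) (hb : Integrable (lossDeriv r b g) (wedge t))
    (ha : Integrable (lossDeriv r a g) (wedge t)) (h : 0 ≤ ∫ q, lossDeriv r b g q ∂wedge t) :
    0 < ∫ q, lossDeriv r a g q ∂wedge t := by
  have hv : ∀ v ∈ Ioi (0 : ℝ), v * (v ^ a * Real.exp (-v ^ 2 / 2)) * sliceDeriv r t g v =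
      v ^ (a - b) * (v * (v ^ b * Real.exp (-v ^ 2 / 2)) * sliceDeriv r t g v) := fun v hv => by
    rw [show a = a - b + b by ring, Real.rpow_add hv, add_sub_cancel_right]; ring
  have hbi := Integrable.integral_prod_left hb
  have hai := Integrable.integral_prod_left ha
  rw [wedge, integral_prod _ hb] at h
  rw [wedge, integral_prod _ ha]
  simp only [setIntegral_lossDeriv_slice] at h hbi hai ⊢
  rw [setIntegral_congr_fun measurableSet_Ioi hv]
  exact integral_rpow_mul_pos_of_single_crossing (sub_pos.2 hba)
    (fun v hv => mul_pos hv (mul_pos (Real.rpow_pos_of_pos hv b) (Real.exp_pos _)))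
    (fun v v' hv hvv' h => sliceDeriv_pos_of_lt hρ hr hfin hg hd hv hvv' h) hbi
    (IntegrableOn.congr_fun hai hv measurableSet_Ioi) h

theorem add_nonneg_of_forall_le {f : ℝ → ℝ} (hρ : IsEvenLoss ρ) (hf : IsDecreasingGenerator f)
    {g : ℝ} (hg : truncLoss ρ f b t g ≠ ∞)
    (hmin : ∀ g', truncLoss ρ f b t g ≤ truncLoss ρ f b t g') : 0 ≤ t + g := by
  by_contra! h
  have hlt : ∀ z < t, |z + -t| < |z + g| := fun z hz => by
    rw [abs_of_neg (by linarith), abs_of_neg (by linarith)]; linarith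
  exact (hmin (-t)).not_gt (truncLoss_strictMono hρ hf hlt
    (ne_top_of_le_ne_top hg (truncLoss_mono hρ fun z hz => (hlt z hz).le)))

/-- For g < 0 a point with |z+g| ≤ |z| satisfies -g - z ≤ z, so its reflection stays below t and the
rearrangement applies on the half-line. -/
theorem truncLoss_zero_le_of_nonpos {f : ℝ → ℝ} (hρ : IsEvenLoss ρ) (hf : IsDecreasingGenerator f)
    {g : ℝ} (hg : g ≤ 0) : truncLoss ρ f b t 0 ≤ truncLoss ρ f b t g := by
  rcases hg.eq_or_lt with rfl | hg
  · exact le_rfl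
  refine setLIntegral_rayLoss_zero_le hρ hf b g measurableSet_Iio fun z hz h => ?_
  have hz : z < t := hz
  have := sq_le_sq.2 h
  have h2 : 0 ≤ 2 * z + g := by nlinarith
  exact mem_Iio.2 (by linarith)

/-- A generalized Bayes estimate lies strictly above every leader of larger weight. -/
theorem IsLeader.lt_of_forall_le_normal (hρ : IsEvenLoss ρ) (hc : ConvexOn ℝ univ ρ)
    (hfin : Integrable fun x => ρ x * Real.exp (-x ^ 2 / 2)) (hb : 0 < b) (hba : b < a)
    {g₀ g : ℝ} (h₀ : IsLeader ρ normalGenerator a t g₀) (hg : truncLoss ρ normalGenerator b t g ≠ ∞)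
    (hmin : ∀ g', truncLoss ρ normalGenerator b t g ≤ truncLoss ρ normalGenerator b t g') :
    g₀ < g := by
  have hN := isDecreasingGenerator_normal
  obtain ⟨r, hr⟩ := hρ.exists_isOddDeriv hc
  have ha := hb.trans hba
  have h₀e := h₀.lt_sqrt_sub hρ hc hfin ha
  rcases le_or_gt (√(t ^ 2 + 1) - t) g with hge | hlt
  · exact h₀e.trans_le hge
  have hd := add_nonneg_of_forall_le hρ hN hg hmin
  -- If g ≤ 0 then g = 0 is a minimizer as well, and t ≥ 0 because t + g ≥ 0. But the derivative at
  -- 0 integrates an odd function of z over z < t, with a negative result.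
  have hgpos : 0 < g := by
    by_contra! hle
    have h1 := lossDeriv_nonneg_of_forall_le hρ hc hr hfin hb le_rfl (by linarith)
      (sub_pos.2 ((le_abs_self t).trans_lt (abs_lt_sqrt_sq_add_one t)))
      fun g' => (truncLoss_zero_le_of_nonpos hρ hN hle).trans (hmin g')
    exact absurd h1.2 (not_le.2 (integral_lossDeriv_zero_neg hr (by linarith) h1.1))
  have hbi := lossDeriv_nonneg_of_forall_le hρ hc hr hfin hb hgpos.le hd hlt hmin
  have hdpos : 0 < t + g := by
    refine hd.lt_of_ne fun h => ?_
    exact absurd hbi.2 (not_le.2 (integral_lossDeriv_neg hr h.ge hbi.1))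
  by_contra! hle
  have hL := lintegral_rayLoss_normal_ne_top hρ hfin ha
  -- If g ≤ g₀, quasiconvexity for the weight a makes g optimal on [0,g], so the weight-a derivative
  -- at g is at most 0; the crossing argument says that it is positive.
  have hai := lossDeriv_of_isMin hρ hc hr hgpos.ne
    (truncLoss_ne_top_of_sq_lt hρ hN ha hL hgpos.le (sq_add_lt_of_lt_sqrt_sub hd hlt))
    (ne_top_of_le_ne_top hL (truncLoss_zero_le a t)) fun τ hτ => by
      have hx0 : 0 ≤ g + τ * (0 - g) := by nlinarith [hτ.2]
      have hxe : g + τ * (0 - g) ≤ g := by nlinarith [hτ.1]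
      exact (truncLoss_convex_le_max hρ hc a t hxe hle).trans (max_le le_rfl (h₀.le _ hx0))
  have h1 := integral_lossDeriv_pos_of_nonneg hρ hr hfin hba hgpos hdpos hbi.1 hai.1 hbi.2
  have h2 := hai.2
  nlinarith

end BoundedMean

namespace BoundedMean

variable {p a b t : ℝ}

/-! ### Increments and the derivative of |x|^p -/

section Increments

/-- The points x + h and y are mirror-image convex combinations of x and y + h, so the two strict
concavity inequalities add up to the claim. -/
theorem rpow_add_sub_rpow_lt (hp : 0 < p) (hp1 : p < 1) {x y h : ℝ} (hx : 0 ≤ x) (hxy : x < y)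
    (hh : 0 < h) : (y + h) ^ p - y ^ p < (x + h) ^ p - x ^ p := by
  have hc := Real.strictConcaveOn_rpow hp hp1
  have hD : 0 < y + h - x := by linarith
  have hx' : x ∈ Ici (0 : ℝ) := hx
  have hy' : y + h ∈ Ici (0 : ℝ) := by rw [mem_Ici]; linarith
  have hne : x ≠ y + h := by linarith
  have h1 := hc.2 hx' hy' hne (div_pos (sub_pos.2 hxy) hD) (div_pos hh hD) (by field_simp; ring)
  have h2 := hc.2 hx' hy' hne (div_pos hh hD) (div_pos (sub_pos.2 hxy) hD) (by field_simp; ring)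
  simp only [smul_eq_mul] at h1 h2
  rw [show (y - x) / (y + h - x) * x + h / (y + h - x) * (y + h) = x + h by
    field_simp; ring] at h1
  rw [show h / (y + h - x) * x + (y - x) / (y + h - x) * (y + h) = y by field_simp; ring] at h2
  have h3 : (y - x) / (y + h - x) + h / (y + h - x) = 1 := by field_simp; ring
  have h4 : ∀ A B : ℝ, (y - x) / (y + h - x) * A + h / (y + h - x) * B +
      (h / (y + h - x) * A + (y - x) / (y + h - x) * B) = A + B := fun A B => by
    linear_combination (A + B) * h3
  have := h4 (x ^ p) ((y + h) ^ p)
  linarith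

theorem abs_rpow_sub_one_le (hp : 0 < p) (hp1 : p < 1) {x : ℝ} (hx : 0 ≤ x) :
    |x ^ p - 1| ≤ |x - 1| := by
  rcases le_total x 1 with h | h
  · have h1 : x ≤ x ^ p := by
      rcases hx.eq_or_lt with rfl | h0
      · exact Real.rpow_nonneg le_rfl p
      · simpa using Real.rpow_le_rpow_of_exponent_ge h0 h hp1.le
    have h2 : x ^ p ≤ 1 := Real.rpow_le_one hx h hp.le
    rw [abs_of_nonpos (by linarith), abs_of_nonpos (by linarith)]
    linarith
  · have h1 : x ^ p ≤ x := by simpa using Real.rpow_le_rpow_of_exponent_le h hp1.le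
    have h2 : 1 ≤ x ^ p := Real.one_le_rpow h hp.le
    rw [abs_of_nonneg (by linarith), abs_of_nonneg (by linarith)]
    linarith

/-- Factoring out |y| reduces this to a comparison with 1. The bound is linear in e, so divided by
the step it dominates difference quotients even though |y|^p is not convex. -/
theorem abs_abs_rpow_add_sub_le (hp : 0 < p) (hp1 : p < 1) {y : ℝ} (hy : y ≠ 0) (e : ℝ) :
    |(|y + e| ^ p - |y| ^ p)| ≤ |e| * |y| ^ (p - 1) := by
  have hy0 : 0 < |y| := abs_pos.2 hy
  have h1 : |y + e| = |y| * |1 + e / y| := by rw [← abs_mul]; congr 1; field_simp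
  have h2 : |(|1 + e / y| ^ p - 1)| ≤ |e / y| :=
    (abs_rpow_sub_one_le hp hp1 (abs_nonneg _)).trans (by
      have := abs_abs_sub_abs_le_abs_sub (1 + e / y) 1
      simpa using this)
  rw [h1, Real.mul_rpow hy0.le (abs_nonneg _), Real.rpow_sub_one hy0.ne',
    show |y| ^ p * |1 + e / y| ^ p - |y| ^ p = |y| ^ p * (|1 + e / y| ^ p - 1) by ring, abs_mul,
    abs_of_pos (Real.rpow_pos_of_pos hy0 p)]
  calc |y| ^ p * |(|1 + e / y| ^ p - 1)| ≤ |y| ^ p * |e / y| := by gcongr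
    _ = |e| * (|y| ^ p / |y|) := by rw [abs_div]; ring

/-- The derivative of `|y| ^ p`. -/
noncomputable def powDeriv (p y : ℝ) : ℝ :=
  if 0 < y then p * y ^ (p - 1) else -(p * (-y) ^ (p - 1))

theorem powDeriv_of_pos {y : ℝ} (hy : 0 < y) : powDeriv p y = p * y ^ (p - 1) := if_pos hy

theorem powDeriv_of_nonpos {y : ℝ} (hy : y ≤ 0) : powDeriv p y = -(p * (-y) ^ (p - 1)) :=
  if_neg hy.not_gt

theorem powDeriv_neg {y : ℝ} (hp1 : p < 1) : powDeriv p (-y) = -powDeriv p y := by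
  rcases lt_trichotomy y 0 with h | rfl | h
  · rw [powDeriv_of_pos (by linarith), powDeriv_of_nonpos h.le, neg_neg]
  · rw [neg_zero, powDeriv_of_nonpos le_rfl, neg_zero, Real.zero_rpow (by linarith)]; simp
  · rw [powDeriv_of_pos h, powDeriv_of_nonpos (by linarith), neg_neg]

theorem powDeriv_lt_zero (hp : 0 < p) {y : ℝ} (hy : y < 0) : powDeriv p y < 0 := by
  rw [powDeriv_of_nonpos hy.le]
  exact neg_neg_of_pos (mul_pos hp (Real.rpow_pos_of_pos (by linarith) _))

theorem hasDerivAt_abs_rpow_of_ne {y : ℝ} (hy : y ≠ 0) :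
    HasDerivAt (fun y : ℝ => |y| ^ p) (powDeriv p y) y := by
  rcases lt_or_gt_of_ne hy with h | h
  · rw [powDeriv_of_nonpos h.le]
    have h1 : HasDerivAt (fun y : ℝ => (-y) ^ p) (-(p * (-y) ^ (p - 1))) y := by
      have := (hasDerivAt_id y).neg.rpow_const (p := p) (Or.inl (by simpa using hy))
      simpa [mul_assoc] using this
    refine h1.congr_of_eventuallyEq ?_
    filter_upwards [Iio_mem_nhds h] with x hx
    rw [abs_of_neg hx]
  · rw [powDeriv_of_pos h]
    refine (Real.hasDerivAt_rpow_const (Or.inl hy)).congr_of_eventuallyEq ?_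
    filter_upwards [Ioi_mem_nhds h] with x hx
    rw [abs_of_pos hx]

end Increments

/-! ### Folding the half-line z < t at the origin -/

section Fold

/-- The two branches `z = r` and `z = -r` of a function on `z < t` as a function of `r > 0`. -/
noncomputable def fold (t : ℝ) (F : ℝ → ℝ) (r : ℝ) : ℝ := F (-r) + (Iio t).indicator F r

theorem integrableOn_comp_neg_Ioi {F : ℝ → ℝ} {c : ℝ} (h : IntegrableOn F (Iio (-c))) :
    IntegrableOn (fun r => F (-r)) (Ioi c) := by
  have h1 := (integrableOn_Iio_iff_sub_mul one_pos (-c) F).1 h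
  have h2 := h1
  rw [← integrable_indicator_iff measurableSet_Ioi] at h2 ⊢
  refine (h2.comp_sub_right c).congr (Eventually.of_forall fun r => ?_)
  simp only [indicator_apply, mem_Ioi, sub_pos, one_mul]
  split_ifs
  · congr 1; ring
  · rfl

theorem integrableOn_fold {F : ℝ → ℝ} (h : IntegrableOn F (Iio t)) :
    IntegrableOn (fold t F) (Ioi (max 0 (-t))) := by
  refine Integrable.add (integrableOn_comp_neg_Ioi (h.mono_set (Iio_subset_Iio ?_)))
    ((integrable_indicator_iff measurableSet_Iio).2 h).integrableOn
  linarith [le_max_right 0 (-t)]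

theorem setIntegral_Iio_eq_fold {F : ℝ → ℝ} (h : IntegrableOn F (Iio t)) :
    ∫ z in Iio t, F z = ∫ r in Ioi (max 0 (-t)), fold t F r := by
  have hsub : Iio (-max 0 (-t)) ⊆ Iio t :=
    Iio_subset_Iio (by linarith [le_max_right 0 (-t)])
  simp only [fold]
  rw [integral_add (integrableOn_comp_neg_Ioi (h.mono_set hsub))
    ((integrable_indicator_iff measurableSet_Iio).2 h).integrableOn, integral_comp_neg_Ioi,
    setIntegral_indicator measurableSet_Iio, Ioi_inter_Iio, integral_Iic_eq_integral_Iio]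
  rcases le_or_gt t 0 with ht | ht
  · rw [max_eq_right (by linarith), neg_neg, Ioo_eq_empty (by linarith)]
    simp
  · rw [max_eq_left (by linarith), neg_zero, ← integral_Ico_eq_integral_Ioo,
      ← setIntegral_union (Iio_disjoint_Ici le_rfl |>.mono_right Ico_subset_Ici_self)
        measurableSet_Ico (h.mono_set (Iio_subset_Iio ht.le)) (h.mono_set Ico_subset_Iio_self),
      Iio_union_Ico_eq_Iio ht.le]

/-- If the folded function changes sign once, from positive to negative, its integral becomes
more positive under even weights that put less mass on large arguments. -/
theorem setIntegral_pos_of_fold_crossing {D W M : ℝ → ℝ} (hM : StrictMonoOn M (Ici 0))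
    (hM0 : 0 < M 0) (hMe : ∀ z, M (-z) = M z) (hW : ∀ z, 0 < W z) (hWe : ∀ z, W (-z) = W z)
    (hD : ∀ r r', max 0 (-t) < r → r < r' → 0 ≤ fold t D r' → 0 < fold t D r)
    (h1 : IntegrableOn (fun z => W z * D z) (Iio t))
    (h2 : IntegrableOn (fun z => M z * (W z * D z)) (Iio t))
    (h : 0 ≤ ∫ z in Iio t, M z * (W z * D z)) : 0 < ∫ z in Iio t, W z * D z := by
  have f1 : fold t (fun z => W z * D z) = fun r => -(W r * -fold t D r) := by
    funext r
    simp only [fold, hWe, indicator_apply]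
    split_ifs <;> ring
  have f2 : fold t (fun z => M z * (W z * D z)) = fun r => -(M r * (W r * -fold t D r)) := by
    funext r
    simp only [fold, hWe, hMe, indicator_apply]
    split_ifs <;> ring
  have i1 := integrableOn_fold h1
  have i2 := integrableOn_fold h2
  rw [setIntegral_Iio_eq_fold h2] at h
  rw [setIntegral_Iio_eq_fold h1]
  rw [f1] at i1 ⊢
  rw [f2] at i2 h
  rw [integral_neg] at h ⊢
  -- Otherwise minus the folded function crosses from negative to positive and has nonnegative
  -- W-integral; the increasing weight M would make its integral positive, contrary to `h`.
  by_contra! hcon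
  have hs : (0 : ℝ) ≤ max 0 (-t) := le_max_left _ _
  have := integral_mul_pos_of_single_crossing (A := fun r => -fold t D r)
    (hM.mono (Ici_subset_Ici.2 hs))
    (hM0.le.trans (hM.monotoneOn self_mem_Ici hs hs)) (fun v _ => hW v)
    (fun v v' hv hvv' hA => by
      by_contra! hA'
      exact absurd (hD v v' hv hvv' (by linarith)) (by linarith))
    (by simpa using i1.neg) (by simpa using i2.neg) (by linarith)
  linarith

end Fold

end BoundedMean

/-! ### Power losses: factorization and the role of the generator -/

namespace BoundedMean

variable {p a b t : ℝ} {f : ℝ → ℝ}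

/-- The loss `|x| ^ p`. -/
noncomputable def powLoss (p x : ℝ) : ℝ := |x| ^ p

theorem isEvenLoss_powLoss (hp : 0 < p) : IsEvenLoss (powLoss p) where
  even x := by simp [powLoss]
  zero := by simp [powLoss, Real.zero_rpow hp.ne']
  cont := continuous_abs.rpow_const fun _ => Or.inr hp.le
  strictMono x hx y hy h := by
    simp only [powLoss, abs_of_nonneg (mem_Ici.1 hx), abs_of_nonneg (mem_Ici.1 hy)]
    exact Real.rpow_lt_rpow hx h hp
  tendsto := (tendsto_rpow_atTop hp).comp tendsto_abs_atTop_atTop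

/-- The weight of `z` in `truncLoss` for the loss `|x| ^ p`. -/
noncomputable def powWeight (p a z : ℝ) : ℝ := (z ^ 2 + 1) ^ (-((a + p + 1) / 2))

theorem powWeight_pos (p a z : ℝ) : 0 < powWeight p a z := Real.rpow_pos_of_pos (by positivity) _

theorem powWeight_neg (p a z : ℝ) : powWeight p a (-z) = powWeight p a z := by simp [powWeight]

theorem measurable_powWeight (p a : ℝ) : Measurable (powWeight p a) := by
  have : Measurable fun z : ℝ => z ^ 2 + 1 := by fun_prop
  exact this.pow_const _

theorem rayLoss_powLoss_zero (a q : ℝ) :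
    rayLoss (powLoss p) f a 0 q = ENNReal.ofReal (|q| ^ p) * rayLoss (powLoss p) f a 0 1 := by
  rw [rayLoss, rayLoss, ← lintegral_const_mul' _ _ ENNReal.ofReal_ne_top]
  refine lintegral_congr fun v => ?_
  simp only [powLoss, zero_add, mul_one]
  rw [← mul_assoc, abs_mul, Real.mul_rpow (abs_nonneg _) (abs_nonneg _),
    ENNReal.ofReal_mul' (by positivity), mul_comm (ENNReal.ofReal (|v| ^ p))]

/-- By homogeneity the generator enters only through the constant at z = 0, g = 1. Minimizers in g
therefore do not depend on f, as long as that constant is finite. -/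
theorem rayLoss_powLoss (a z g : ℝ) :
    rayLoss (powLoss p) f a z g =
      ENNReal.ofReal (|z + g| ^ p * powWeight p a z) * rayLoss (powLoss p) f a 0 1 := by
  have h0 : 0 < z ^ 2 + 1 := by positivity
  rw [rayLoss_eq_zero_ray, rayLoss_powLoss_zero, ← mul_assoc, ← ENNReal.ofReal_mul (by positivity)]
  congr 2
  rw [abs_div, abs_of_pos (Real.sqrt_pos.2 h0), Real.div_rpow (abs_nonneg _) (Real.sqrt_nonneg _),
    Real.sqrt_eq_rpow, ← Real.rpow_mul h0.le, powWeight,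
    show -((a + p + 1) / 2) = -((a + 1) / 2) - 1 / 2 * p by ring, Real.rpow_sub h0]
  ring

theorem rayLoss_powLoss_one_ne_zero (hp : 0 < p) (hf : IsDecreasingGenerator f) (a : ℝ) :
    rayLoss (powLoss p) f a 0 1 ≠ 0 := by
  have h0 : rayLoss (powLoss p) f a 0 0 = 0 := by
    rw [rayLoss_powLoss_zero]; simp [Real.zero_rpow hp.ne']
  have := rayLoss_strictMono (isEvenLoss_powLoss hp) hf (a := a) (z := 0) (g := 0) (g' := 1)
    (by simp) (by rw [h0]; exact ENNReal.zero_ne_top)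
  exact (h0 ▸ this).ne'

theorem rayLoss_powLoss_one_ne_top (hp : 0 < p) (hf : IsDecreasingGenerator f)
    (hfin : ∫⁻ z, rayLoss (powLoss p) f a z 0 ≠ ∞) : rayLoss (powLoss p) f a 0 1 ≠ ∞ := by
  have h := rayLoss_zero_ne_top_of_lt_one (isEvenLoss_powLoss hp) hf hfin
    (by norm_num : (0 : ℝ) ≤ 1 / 2) (by norm_num)
  rw [rayLoss_powLoss_zero] at h
  intro htop
  rw [htop, ENNReal.mul_top] at h
  · exact h rfl
  · rw [ne_eq, ENNReal.ofReal_eq_zero, not_le]; positivity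

theorem leadersInterior_powLoss (hκ : rayLoss (powLoss p) f a 0 1 ≠ ∞) :
    LeadersInterior (powLoss p) f a := fun t g _ =>
  ⟨(t + g) / √(t ^ 2 + 1) + 1, by linarith, by
    rw [rayLoss_powLoss_zero]; exact ENNReal.mul_ne_top ENNReal.ofReal_ne_top hκ⟩

theorem integrable_one_add_sq_rpow {s : ℝ} (hs : 1 < s) :
    Integrable fun z : ℝ => (z ^ 2 + 1) ^ (-(s / 2)) := by
  have := integrable_rpow_neg_one_add_norm_sq (E := ℝ) (μ := volume) (r := s) (by simpa using hs)
  refine this.congr (Eventually.of_forall fun z => ?_)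
  simp only [Real.norm_eq_abs, sq_abs]
  rw [add_comm, neg_div]

theorem integrable_powWeight (hp : 0 < p) (ha : 0 < a) : Integrable (powWeight p a) :=
  integrable_one_add_sq_rpow (by linarith)

theorem measurable_abs_rpow (p g : ℝ) : Measurable fun z : ℝ => |z + g| ^ p := by
  have : Measurable fun z : ℝ => |z + g| := by fun_prop
  exact this.pow_const _

theorem integrable_abs_rpow_mul_powWeight (hp : 0 < p) (ha : 0 < a) (g : ℝ) :
    Integrable fun z => |z + g| ^ p * powWeight p a z := by
  refine Integrable.mono' ((integrable_one_add_sq_rpow (s := a + 1) (by linarith)).const_mul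
    ((1 + |g|) ^ p)) ((measurable_abs_rpow p g).mul (measurable_powWeight p a)).aestronglyMeasurable
    (Eventually.of_forall fun z => ?_)
  have h0 : 0 < z ^ 2 + 1 := by positivity
  have h1 : |z| ≤ √(z ^ 2 + 1) := (abs_lt_sqrt_sq_add_one z).le
  have h2 : 1 ≤ √(z ^ 2 + 1) := Real.one_le_sqrt.2 (by nlinarith [sq_nonneg z])
  have h3 : |z + g| ≤ (1 + |g|) * √(z ^ 2 + 1) := by
    have := abs_add_le z g
    nlinarith [abs_nonneg g]
  rw [Real.norm_of_nonneg (mul_nonneg (by positivity) (powWeight_pos p a z).le)]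
  calc |z + g| ^ p * powWeight p a z
      ≤ ((1 + |g|) * √(z ^ 2 + 1)) ^ p * powWeight p a z := by
        have := (powWeight_pos p a z).le
        gcongr
    _ = (1 + |g|) ^ p * (z ^ 2 + 1) ^ (-((a + 1) / 2)) := by
        rw [Real.mul_rpow (by positivity) (by positivity), Real.sqrt_eq_rpow, ← Real.rpow_mul h0.le,
          mul_assoc, powWeight, ← Real.rpow_add h0]
        congr 2; ring

/-- `truncLoss` for the loss `|x| ^ p`, up to a constant that depends on the generator. -/
noncomputable def powTruncLoss (p a t g : ℝ) : ℝ := ∫ z in Iio t, |z + g| ^ p * powWeight p a z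

theorem truncLoss_powLoss (hp : 0 < p) (ha : 0 < a) (g : ℝ) :
    truncLoss (powLoss p) f a t g =
      ENNReal.ofReal (powTruncLoss p a t g) * rayLoss (powLoss p) f a 0 1 := by
  have hm : Measurable fun z => ENNReal.ofReal (|z + g| ^ p * powWeight p a z) :=
    ((measurable_abs_rpow p g).mul (measurable_powWeight p a)).ennreal_ofReal
  rw [powTruncLoss, ofReal_integral_eq_lintegral_ofReal
    (integrable_abs_rpow_mul_powWeight hp ha g).integrableOn
    (Eventually.of_forall fun z => mul_nonneg (by positivity) (powWeight_pos p a z).le),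
    ← lintegral_mul_const _ hm]
  exact lintegral_congr fun z => rayLoss_powLoss a z g

theorem powTruncLoss_pos (hp : 0 < p) (ha : 0 < a) (g : ℝ) : 0 < powTruncLoss p a t g := by
  refine integral_pos_of_pos_on (s := univ) (integrable_abs_rpow_mul_powWeight hp ha g).integrableOn
    (Eventually.of_forall fun z => mul_nonneg (by positivity) (powWeight_pos p a z).le) (by simp) ?_
  filter_upwards [ae_restrict_of_ae (Measure.ae_ne volume (-g))] with z hz _
  have : z + g ≠ 0 := fun h => hz (by linarith)
  exact mul_pos (Real.rpow_pos_of_pos (abs_pos.2 this) p) (powWeight_pos p a z)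

theorem truncLoss_powLoss_le_iff (hp : 0 < p) (ha : 0 < a) (hf : IsDecreasingGenerator f)
    (hκ : rayLoss (powLoss p) f a 0 1 ≠ ∞) {g g' : ℝ} :
    truncLoss (powLoss p) f a t g ≤ truncLoss (powLoss p) f a t g' ↔
      powTruncLoss p a t g ≤ powTruncLoss p a t g' := by
  rw [truncLoss_powLoss hp ha, truncLoss_powLoss hp ha,
    ENNReal.mul_le_mul_iff_left (rayLoss_powLoss_one_ne_zero hp hf a) hκ,
    ENNReal.ofReal_le_ofReal_iff (powTruncLoss_pos hp ha g').le]

theorem rayLoss_powLoss_one_ne_top_of_truncLoss (hp : 0 < p) (ha : 0 < a) {g : ℝ}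
    (h : truncLoss (powLoss p) f a t g ≠ ∞) : rayLoss (powLoss p) f a 0 1 ≠ ∞ := by
  rw [truncLoss_powLoss hp ha] at h
  intro htop
  rw [htop, ENNReal.mul_top] at h
  · exact h rfl
  · rw [ne_eq, ENNReal.ofReal_eq_zero, not_le]; exact powTruncLoss_pos hp ha g

/-! ### Power losses with p < 1 -/

section Concave

/-- The singularity at z = -g is integrable because p - 1 > -1; away from it the factor is at most 1
and the weight decays. -/
theorem integrable_abs_rpow_sub_one_mul_powWeight (hp : 0 < p) (hp1 : p < 1) (ha : 0 < a) (g : ℝ) :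
    Integrable fun z => |z + g| ^ (p - 1) * powWeight p a z := by
  set F : ℝ → ℝ := (Ioc 0 1).indicator fun y => y ^ (p - 1) with hF
  have hFi : Integrable F := by
    rw [hF, integrable_indicator_iff measurableSet_Ioc]
    exact (intervalIntegrable_iff_integrableOn_Ioc_of_le zero_le_one).1
      (intervalIntegral.intervalIntegrable_rpow' (by linarith))
  have hF0 : ∀ y, 0 ≤ F y := fun y => indicator_nonneg (fun y hy => Real.rpow_nonneg hy.1.le _) y
  have hle : ∀ y : ℝ, y ≠ 0 → |y| ^ (p - 1) ≤ F y + F (-y) + 1 := fun y hy => by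
    have h0 : 0 < |y| := abs_pos.2 hy
    rcases le_or_gt |y| 1 with h | h
    · have h2 : |y| ^ (p - 1) = F |y| := by rw [hF, indicator_of_mem (mem_Ioc.2 ⟨h0, h⟩)]
      have h3 := hF0 y
      have h4 := hF0 (-y)
      rcases abs_choice y with h' | h' <;> rw [h2, h'] <;> linarith
    · have := Real.rpow_le_one_of_one_le_of_nonpos h.le (show p - 1 ≤ 0 by linarith)
      linarith [hF0 y, hF0 (-y)]
  have hW1 : ∀ z, powWeight p a z ≤ 1 := fun z =>
    Real.rpow_le_one_of_one_le_of_nonpos (by nlinarith [sq_nonneg z]) (by linarith)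
  refine Integrable.mono' (((hFi.comp_add_right g).add (hFi.comp_neg.comp_add_right g)).add
    (integrable_powWeight hp ha))
    ((measurable_abs_rpow (p - 1) g).mul (measurable_powWeight p a)).aestronglyMeasurable ?_
  filter_upwards [Measure.ae_ne volume (-g)] with z hz
  have hW := powWeight_pos p a z
  rw [Real.norm_of_nonneg (mul_nonneg (by positivity) hW.le)]
  have h1 := hle (z + g) fun h => hz (by linarith)
  have h2 := hF0 (z + g)
  have h3 := hF0 (-(z + g))
  have h4 := hW1 z
  simp only [Pi.add_apply]
  nlinarith [mul_le_mul_of_nonneg_right h1 hW.le]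

theorem powDeriv_of_isMin (hp : 0 < p) (hp1 : p < 1) (ha : 0 < a) {g e : ℝ} (he : e ≠ 0)
    (hmin : ∀ τ ∈ Ioc (0 : ℝ) 1, powTruncLoss p a t g ≤ powTruncLoss p a t (g + τ * e)) :
    IntegrableOn (fun z => powWeight p a z * powDeriv p (z + g)) (Iio t) ∧
      0 ≤ e * ∫ z in Iio t, powWeight p a z * powDeriv p (z + g) := by
  set τ : ℕ → ℝ := fun k => 1 / ((k : ℝ) + 1) with hτ
  have hτ0 : ∀ k, 0 < τ k := fun k => by positivity
  have hτ1 : ∀ k, τ k ≤ 1 := fun k => by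
    rw [hτ]
    exact (div_le_one (by positivity)).2 (by linarith [k.cast_nonneg (α := ℝ)])
  have hi : ∀ g, IntegrableOn (fun z => |z + g| ^ p * powWeight p a z) (Iio t) := fun g =>
    (integrable_abs_rpow_mul_powWeight hp ha g).integrableOn
  have hne : ∀ᵐ z ∂volume.restrict (Iio t), z + g ≠ 0 :=
    ae_restrict_of_ae ((Measure.ae_ne volume (-g)).mono fun z hz h => hz (by linarith))
  have key := integrable_and_integral_nonneg_of_tendsto (μ := volume.restrict (Iio t))
    (s := fun k z => (|z + (g + τ k * e)| ^ p * powWeight p a z - |z + g| ^ p * powWeight p a z) /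
      τ k)
    (b := fun z => |e| * (|z + g| ^ (p - 1) * powWeight p a z))
    (ψ := fun z => e * (powWeight p a z * powDeriv p (z + g)))
    (fun k => ((hi _).sub (hi g)).div_const _)
    ((integrable_abs_rpow_sub_one_mul_powWeight hp hp1 ha g).integrableOn.const_mul _)
    (fun k => by
      filter_upwards [hne] with z hz
      have h1 := (le_abs_self _).trans (abs_abs_rpow_add_sub_le hp hp1 hz (τ k * e))
      have h2 := mul_le_mul_of_nonneg_right h1 (powWeight_pos p a z).le
      rw [div_le_iff₀ (hτ0 k)]
      rw [abs_mul, abs_of_pos (hτ0 k), add_assoc] at h2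
      linarith)
    (fun k => by
      rw [integral_div, integral_sub (hi _) (hi g)]
      exact div_nonneg (sub_nonneg.2 (hmin (τ k) ⟨hτ0 k, hτ1 k⟩)) (hτ0 k).le)
    (by
      filter_upwards [hne] with z hz
      have h1 : HasDerivAt (fun s : ℝ => z + g + e * s) e 0 :=
        (hasDerivAt_const_mul_self _ _).const_add _
      have h2 : HasDerivAt (fun y : ℝ => |y| ^ p) (powDeriv p (z + g)) (z + g + e * 0) := by
        simpa using hasDerivAt_abs_rpow_of_ne hz
      have h3 := ((h2.comp 0 h1).mul_const (powWeight p a z)).tendsto_slope_zero.comp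
        tendsto_one_div_nhdsNE_zero
      refine (h3.congr fun k => ?_).trans (le_of_eq ?_)
      · simp only [Function.comp_apply, zero_add, smul_eq_mul, mul_zero, add_zero, hτ]
        rw [show z + g + e * (1 / ((k : ℝ) + 1)) = z + (g + 1 / ((k : ℝ) + 1) * e) by ring]
        exact (div_eq_inv_mul _ _).symm
      · congr 1
        ring)
  rw [integral_const_mul] at key
  exact ⟨(integrable_const_mul_iff (isUnit_iff_ne_zero.2 he) _).1 key.1, key.2⟩

/-- Below m both branches are nonnegative and the left one is positive. Beyond m the left branch is
negative and, being nearer to the kink, outweighs the right one because p - 1 < 0. -/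
theorem fold_powDeriv_pos_of_lt (hp : 0 < p) (hp1 : p < 1) {m : ℝ} {r r' : ℝ}
    (hr0 : 0 < r) (hm : 0 < m) (hrr' : r < r') (h : 0 ≤ fold t (fun z => powDeriv p (z + m)) r') :
    0 < fold t (fun z => powDeriv p (z + m)) r := by
  simp only [fold] at h ⊢
  have hpos : ∀ y : ℝ, 0 < y → 0 < powDeriv p y := fun y hy => by
    have := powDeriv_lt_zero hp (neg_lt_zero.2 hy)
    rw [powDeriv_neg hp1] at this
    linarith
  rcases lt_or_ge r m with hrm | hrm
  · refine add_pos_of_pos_of_nonneg (hpos _ (by linarith)) ?_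
    rw [indicator_apply]
    split_ifs
    · exact (hpos _ (by linarith)).le
    · exact le_rfl
  · exfalso
    have h1 : powDeriv p (r' + m) < powDeriv p (r' - m) := by
      rw [powDeriv_of_pos (by linarith), powDeriv_of_pos (by linarith)]
      exact mul_lt_mul_of_pos_left
        (Real.rpow_lt_rpow_of_neg (by linarith) (by linarith) (by linarith)) hp
    have h2 : powDeriv p (-r' + m) = -powDeriv p (r' - m) := by
      rw [← powDeriv_neg hp1]; congr 1; ring
    have h3 := hpos (r' - m) (by linarith)
    rw [h2, indicator_apply] at h
    split_ifs at h <;> linarith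

/-- Below the midpoint (m+g)/2 the left branch is positive and the right one nonnegative. Beyond it
a nonnegative sum forces r' < t, so that the right branch is present, and r' < g, since past g the
concave increment of the left branch dominates. On the remaining range both branches decrease
strictly or weakly in r: the right by concavity, the left because |g - r| falls and |r - m| grows.
-/
theorem fold_abs_rpow_sub_pos_of_lt (hp : 0 < p) (hp1 : p < 1) {m g : ℝ} {r r' : ℝ}
    (hr0 : 0 < r) (hm : 0 < m) (hmg : m < g) (hrr' : r < r')
    (h : 0 ≤ fold t (fun z => |z + g| ^ p - |z + m| ^ p) r') :
    0 < fold t (fun z => |z + g| ^ p - |z + m| ^ p) r := by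
  have hQ : ∀ s, 0 < s → 0 < |s + g| ^ p - |s + m| ^ p := fun s hs => by
    rw [abs_of_pos (by linarith), abs_of_pos (by linarith)]
    exact sub_pos.2 (Real.rpow_lt_rpow (by linarith) (by linarith) hp)
  simp only [fold] at h ⊢
  rcases lt_or_ge (2 * r) (m + g) with hc | hc
  · refine add_pos_of_pos_of_nonneg (sub_pos.2 (Real.rpow_lt_rpow (abs_nonneg _) ?_ hp)) ?_
    · rw [← sq_lt_sq]; nlinarith
    · rw [indicator_apply]
      split_ifs
      · exact (hQ r hr0).le
      · exact le_rfl
  · have hP : |-r' + g| ^ p - |-r' + m| ^ p < 0 := by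
      refine sub_neg.2 (Real.rpow_lt_rpow (abs_nonneg _) ?_ hp)
      rw [← sq_lt_sq]; nlinarith
    have hr't : r' < t := by
      by_contra hcon
      rw [indicator_of_notMem (by simpa using hcon)] at h
      linarith
    rw [indicator_of_mem (mem_Iio.2 hr't)] at h
    rw [indicator_of_mem (mem_Iio.2 (hrr'.trans hr't))]
    have hinc : ∀ x y : ℝ, 0 ≤ x → x < y →
        (y + (g - m)) ^ p - y ^ p < (x + (g - m)) ^ p - x ^ p := fun x y hx hxy =>
      rpow_add_sub_rpow_lt hp hp1 hx hxy (sub_pos.2 hmg)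
    have e1 : ∀ s, 0 < s → |s + g| ^ p - |s + m| ^ p = (s + m + (g - m)) ^ p - (s + m) ^ p :=
      fun s hs => by
        rw [abs_of_pos (by linarith), abs_of_pos (by linarith)]; congr 2; ring
    have hr'0 := hr0.trans hrr'
    rw [e1 r' hr'0] at h
    rw [e1 r hr0]
    have hr'g : r' < g := by
      by_contra! hcon
      have := hinc (r' - g) (r' + m) (by linarith) (by linarith)
      rw [show -r' + g = -(r' - g) by ring, show -r' + m = -(r' - g + (g - m)) by ring, abs_neg,
        abs_neg, abs_of_nonneg (by linarith : 0 ≤ r' - g),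
        abs_of_nonneg (by linarith : 0 ≤ r' - g + (g - m))] at h
      linarith
    have h1 := hinc (r + m) (r' + m) (by linarith) (by linarith)
    have h2 : |-r' + g| ^ p ≤ |-r + g| ^ p := by
      rw [abs_of_pos (by linarith), abs_of_pos (by linarith)]
      exact Real.rpow_le_rpow (by linarith) (by linarith) hp.le
    have h3 : |-r + m| ^ p ≤ |-r' + m| ^ p := by
      refine Real.rpow_le_rpow (abs_nonneg _) ?_ hp.le
      rw [abs_of_nonpos (by linarith), abs_of_nonpos (by linarith)]
      linarith
    linarith

theorem powWeight_eq_mul (p a b z : ℝ) :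
    powWeight p b z = (z ^ 2 + 1) ^ ((a - b) / 2) * powWeight p a z := by
  rw [powWeight, powWeight, ← Real.rpow_add (by positivity)]
  congr 1; ring

theorem powTruncLoss_crossing (hba : b < a) {D : ℝ → ℝ}
    (hD : ∀ r r', 0 < r → r < r' → 0 ≤ fold t D r' → 0 < fold t D r)
    (hb : IntegrableOn (fun z => powWeight p b z * D z) (Iio t))
    (ha : IntegrableOn (fun z => powWeight p a z * D z) (Iio t))
    (h : 0 ≤ ∫ z in Iio t, powWeight p b z * D z) : 0 < ∫ z in Iio t, powWeight p a z * D z := by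
  have hM : StrictMonoOn (fun z : ℝ => (z ^ 2 + 1) ^ ((a - b) / 2)) (Ici 0) :=
    fun x hx y hy hxy => by
      have hx : 0 ≤ x := hx
      exact Real.rpow_lt_rpow (by positivity) (by nlinarith) (by linarith)
  simp only [powWeight_eq_mul p a b, mul_assoc] at hb h
  exact setIntegral_pos_of_fold_crossing hM (by simp) (by simp) (powWeight_pos p a)
    (powWeight_neg p a) (fun r r' hr => hD r r' ((le_max_left _ _).trans_lt hr)) ha hb h

theorem powTruncLoss_minimizer_lt (hp : 0 < p) (hp1 : p < 1) (hb : 0 < b) (hba : b < a)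
    {g₀ g : ℝ} (hg : 0 < g) (h₀ : ∀ g', 0 ≤ g' → powTruncLoss p a t g₀ ≤ powTruncLoss p a t g')
    (hmin : ∀ g', powTruncLoss p b t g ≤ powTruncLoss p b t g') : g₀ < g := by
  by_contra! hle
  have ha := hb.trans hba
  -- If g₀ = g, the one-sided derivatives at the common point have contradictory signs. If g < g₀, a
  -- derivative says nothing without convexity, so the whole increment of the loss from g to g₀ is
  -- reweighted instead.
  rcases hle.eq_or_lt with rfl | hlt
  · have h1 := powDeriv_of_isMin hp hp1 hb one_ne_zero fun τ _ => hmin (g + τ * 1)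
    have h2 := powDeriv_of_isMin hp hp1 ha (neg_ne_zero.2 hg.ne') fun τ hτ =>
      h₀ (g + τ * -g) (by nlinarith [hτ.2])
    have := powTruncLoss_crossing hba
      (fun r r' hr hrr' => fold_powDeriv_pos_of_lt hp hp1 hr hg hrr') h1.1 h2.1 (by linarith [h1.2])
    nlinarith [h2.2]
  · have hi : ∀ c, 0 < c → IntegrableOn
        (fun z => powWeight p c z * (|z + g₀| ^ p - |z + g| ^ p)) (Iio t) ∧
        ∫ z in Iio t, powWeight p c z * (|z + g₀| ^ p - |z + g| ^ p) =
          powTruncLoss p c t g₀ - powTruncLoss p c t g := fun c hc => by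
      have i1 := (integrable_abs_rpow_mul_powWeight hp hc g₀).integrableOn (s := Iio t)
      have i2 := (integrable_abs_rpow_mul_powWeight hp hc g).integrableOn (s := Iio t)
      have : (fun z => powWeight p c z * (|z + g₀| ^ p - |z + g| ^ p)) = fun z =>
        |z + g₀| ^ p * powWeight p c z - |z + g| ^ p * powWeight p c z := by funext z; ring
      rw [this]
      exact ⟨i1.sub i2, integral_sub i1 i2⟩
    have := powTruncLoss_crossing hba
      (fun r r' hr hrr' => fold_abs_rpow_sub_pos_of_lt hp hp1 hr hg hlt hrr') (hi b hb).1 (hi a ha).1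
      (by rw [(hi b hb).2]; linarith [hmin g₀])
    rw [(hi a ha).2] at this
    linarith [h₀ g hg.le]

theorem powTruncLoss_minimizer_pos (hp : 0 < p) (hp1 : p < 1) (hb : 0 < b) (ht : 0 ≤ t) :
    ∃ g', powTruncLoss p b t g' < powTruncLoss p b t 0 := by
  by_contra! hcon
  have h := powDeriv_of_isMin hp hp1 hb one_ne_zero fun τ _ => hcon (0 + τ * 1)
  simp only [add_zero, one_mul] at h
  refine absurd h.2 (not_le.2 (setIntegral_odd_neg (fun z => ?_) ht h.1
    (Eventually.of_forall fun z hz => mul_neg_of_pos_of_neg (powWeight_pos p b z)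
      (powDeriv_lt_zero hp hz))))
  rw [powWeight_neg, powDeriv_neg hp1]; ring

end Concave

theorem integrable_powLoss_mul_gaussian (hp : 0 < p) :
    Integrable fun x => powLoss p x * Real.exp (-x ^ 2 / 2) := by
  set F : ℝ → ℝ := fun x => x ^ p * Real.exp (-(1 / 2) * x ^ 2) with hF
  have hi : IntegrableOn F (Ioi 0) :=
    integrableOn_rpow_mul_exp_neg_mul_sq (by norm_num) (by linarith)
  have hpos : 0 < ∫ x in Ioi (0 : ℝ), F x :=
    integral_pos_of_pos_on (s := univ) hi
      ((ae_restrict_iff' measurableSet_Ioi).2 (Eventually.of_forall fun x hx =>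
        mul_nonneg (Real.rpow_nonneg (mem_Ioi.1 hx).le _) (Real.exp_pos _).le)) (by simp)
      ((ae_restrict_iff' measurableSet_Ioi).2 (Eventually.of_forall fun x hx _ =>
        mul_pos (Real.rpow_pos_of_pos (mem_Ioi.1 hx) _) (Real.exp_pos _)))
  -- A function that is not integrable has Bochner integral 0, whereas this integral is twice the
  -- positive integral over the half-line.
  have h : Integrable fun x => F |x| := by
    by_contra hcon
    have := integral_comp_abs (f := F)
    rw [integral_undef hcon] at this
    linarith
  refine h.congr (Eventually.of_forall fun x => ?_)
  simp only [hF, powLoss, sq_abs]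
  congr 2; ring

/-- A generalized Bayes estimate lies strictly above every leader of larger weight. -/
theorem IsLeader.lt_of_forall_le_powLoss (hp : 0 < p) (hf : IsDecreasingGenerator f) (hb : 0 < b)
    (hba : b < a) (hκ : rayLoss (powLoss p) f a 0 1 ≠ ∞) {g₀ g : ℝ}
    (h₀ : IsLeader (powLoss p) f a t g₀) (hg : truncLoss (powLoss p) f b t g ≠ ∞)
    (hmin : ∀ g', truncLoss (powLoss p) f b t g ≤ truncLoss (powLoss p) f b t g') : g₀ < g := by
  have hρ := isEvenLoss_powLoss hp
  have ha := hb.trans hba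
  have hκb := rayLoss_powLoss_one_ne_top_of_truncLoss hp hb hg
  have h₀' := fun g' hg' => (truncLoss_powLoss_le_iff hp ha hf hκ).1 (h₀.le g' hg')
  have hmin' := fun g' => (truncLoss_powLoss_le_iff hp hb hf hκb).1 (hmin g')
  rcases lt_or_ge p 1 with hp1 | hp1
  · refine powTruncLoss_minimizer_lt hp hp1 hb hba ?_ h₀' hmin'
    by_contra! hle
    have hd := add_nonneg_of_forall_le hρ hf hg hmin
    obtain ⟨g', hg'⟩ := powTruncLoss_minimizer_pos hp hp1 hb (show 0 ≤ t by linarith)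
    have := (truncLoss_powLoss_le_iff hp hb hf hκb).1
      (truncLoss_zero_le_of_nonpos (b := b) (t := t) hρ hf hle)
    linarith [hmin' g']
  -- For p ≥ 1 the loss is convex and minimizers do not see the generator, so f is exchanged for the
  -- normal one.
  · have hN := isDecreasingGenerator_normal
    have hfin := integrable_powLoss_mul_gaussian hp
    have hκN : ∀ c, 0 < c → rayLoss (powLoss p) normalGenerator c 0 1 ≠ ∞ := fun c hc =>
      rayLoss_powLoss_one_ne_top hp hN (lintegral_rayLoss_normal_ne_top hρ hfin hc)
    have hconv : ConvexOn ℝ univ (powLoss p) := by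
      refine ⟨convex_univ, fun x _ y _ s u hs hu hsu => ?_⟩
      have h1 := (convexOn_rpow hp1).2 (mem_Ici.2 (abs_nonneg x)) (mem_Ici.2 (abs_nonneg y)) hs hu hsu
      refine le_trans (Real.rpow_le_rpow (abs_nonneg _) ?_ hp.le) h1
      simp only [smul_eq_mul]
      refine (abs_add_le _ _).trans_eq ?_
      rw [abs_mul, abs_mul, abs_of_nonneg hs, abs_of_nonneg hu]
    refine IsLeader.lt_of_forall_le_normal (t := t) hρ hconv hfin hb hba
      ⟨h₀.nonneg, h₀.add_nonneg, fun g' hg' =>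
        (truncLoss_powLoss_le_iff hp ha hN (hκN a ha)).2 (h₀' g' hg')⟩ ?_
      fun g' => (truncLoss_powLoss_le_iff hp hb hN (hκN b hb)).2 (hmin' g')
    rw [truncLoss_powLoss hp hb]
    exact ENNReal.mul_ne_top ENNReal.ofReal_ne_top (hκN b hb)

end BoundedMean

namespace BoundedMean

/-! ### Ray coordinates on the half-plane of observations -/

section Rays

/-- The substitution `(x, s) = (μ + σ v z, σ v)` in an integral over the half-plane `s > 0`. -/
theorem lintegral_halfPlane {H : ℝ × ℝ → ℝ≥0∞} (hH : Measurable H) (μ : ℝ) {σ : ℝ} (hσ : 0 < σ) :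
    ∫⁻ ω, {ω : ℝ × ℝ | 0 < ω.2}.indicator H ω =
      ∫⁻ z, ∫⁻ v in Ioi (0 : ℝ), ENNReal.ofReal (σ ^ 2 * v) * H (μ + σ * v * z, σ * v) := by
  have hS : MeasurableSet {ω : ℝ × ℝ | 0 < ω.2} := measurableSet_lt measurable_const measurable_snd
  have hm : Measurable fun q : ℝ × ℝ =>
      ENNReal.ofReal (σ ^ 2 * q.2) * H (μ + σ * q.2 * q.1, σ * q.2) := by
    have : Measurable fun q : ℝ × ℝ => H (μ + σ * q.2 * q.1, σ * q.2) :=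
      hH.comp (by fun_prop)
    fun_prop
  rw [lintegral_lintegral_swap hm.aemeasurable, Measure.volume_eq_prod,
    lintegral_prod_symm _ (hH.indicator hS).aemeasurable]
  have h1 : ∀ s, ∫⁻ x, {ω : ℝ × ℝ | 0 < ω.2}.indicator H (x, s) =
      (Ioi 0).indicator (fun s => ∫⁻ x, H (x, s)) s := by
    intro s
    by_cases hs : 0 < s
    · rw [indicator_of_mem (mem_Ioi.2 hs)]
      exact lintegral_congr fun x => indicator_of_mem (show (x, s) ∈ {ω : ℝ × ℝ | 0 < ω.2} from hs) _
    · rw [indicator_of_notMem (by simpa using hs), ← lintegral_zero]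
      exact lintegral_congr fun x => indicator_of_notMem (s := {ω : ℝ × ℝ | 0 < ω.2}) hs _
  simp only [h1]
  rw [lintegral_indicator measurableSet_Ioi, lintegral_Ioi_eq_mul_left hσ,
    ← lintegral_const_mul' _ _ ENNReal.ofReal_ne_top]
  refine setLIntegral_congr_fun measurableSet_Ioi fun v hv => ?_
  have hσv : 0 < σ * v := mul_pos hσ hv
  rw [lintegral_affine hσv μ, ← mul_assoc, ← ENNReal.ofReal_mul hσ.le,
    ← lintegral_const_mul' _ _ ENNReal.ofReal_ne_top]
  refine lintegral_congr fun z => ?_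
  congr 2
  ring

/-- The substitution formula is applied to the indicator of a measurable null set containing the
exceptional points. -/
theorem ae_halfPlane {P : ℝ × ℝ → Prop} (hP : ∀ᵐ ω, 0 < ω.2 → P ω) (μ : ℝ) {σ : ℝ} (hσ : 0 < σ) :
    ∀ᵐ z : ℝ, ∀ᵐ v, 0 < v → P (μ + σ * v * z, σ * v) := by
  set T := toMeasurable volume {ω : ℝ × ℝ | ¬(0 < ω.2 → P ω)} with hT
  have hTm : MeasurableSet T := measurableSet_toMeasurable _ _
  have hT0 : volume T = 0 := by rw [hT, measure_toMeasurable]; exact hP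
  set H : ℝ × ℝ → ℝ≥0∞ := T.indicator 1 with hH
  have hHm : Measurable H := measurable_one.indicator hTm
  have h0 : ∫⁻ ω, {ω : ℝ × ℝ | 0 < ω.2}.indicator H ω = 0 := by
    refine le_antisymm ?_ bot_le
    calc ∫⁻ ω, {ω : ℝ × ℝ | 0 < ω.2}.indicator H ω ≤ ∫⁻ ω, H ω :=
          lintegral_mono fun ω => indicator_le_self _ _ ω
      _ = 0 := by rw [hH, lintegral_indicator_one hTm, hT0]
  rw [lintegral_halfPlane hHm μ hσ] at h0
  have hm : Measurable fun q : ℝ × ℝ =>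
      ENNReal.ofReal (σ ^ 2 * q.2) * H (μ + σ * q.2 * q.1, σ * q.2) := by
    have : Measurable fun q : ℝ × ℝ => H (μ + σ * q.2 * q.1, σ * q.2) :=
      hHm.comp (by fun_prop)
    fun_prop
  have h1 := (lintegral_eq_zero_iff (Measurable.lintegral_prod_right'
    (ν := volume.restrict (Ioi (0 : ℝ))) hm)).1 h0
  filter_upwards [h1] with z hz
  have h2 := (lintegral_eq_zero_iff (hm.comp (by fun_prop : Measurable fun v : ℝ => (z, v)))).1 hz
  filter_upwards [(ae_restrict_iff' measurableSet_Ioi).1 h2] with v hv hv0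
  have hv' := hv hv0
  simp only [Function.comp_apply, Pi.zero_apply, mul_eq_zero, ENNReal.ofReal_eq_zero] at hv'
  have hv2 : 0 < σ ^ 2 * v := by positivity
  have h3 := hv'.resolve_left hv2.not_ge
  by_contra hcon
  have : (μ + σ * v * z, σ * v) ∈ T := subset_toMeasurable _ _ fun h => hcon (h (mul_pos hσ hv0))
  rw [hH, indicator_of_mem this] at h3
  simp at h3

end Rays

/-! ### Risk and posterior loss of the reduced problem in ray coordinates -/

section Reduced

variable {n : ℕ} {f ρ : ℝ → ℝ}

theorem measurable_reducedDensity_uncurry (n : ℕ) (hf : Measurable f) :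
    Measurable fun q : (ℝ × ℝ) × (ℝ × ℝ) => reducedDensity n f q.1 q.2 := by
  unfold reducedDensity
  refine Measurable.ite (measurableSet_lt measurable_const (by fun_prop)) ?_ measurable_const
  exact (Measurable.mul (by fun_prop) (hf.comp (by fun_prop))).ennreal_ofReal

theorem measurable_reducedDensity (n : ℕ) (hf : Measurable f) (θ : ℝ × ℝ) :
    Measurable (reducedDensity n f θ) :=
  (measurable_reducedDensity_uncurry n hf).comp (by fun_prop : Measurable fun ω => (θ, ω))

/-- The Jacobian contributes one more factor v to v^{n-1}, and all powers of σ cancel, so θ survives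
only in the argument of G. -/
theorem lintegral_reducedDensity_mul (hn : 1 ≤ n) (hf : Measurable f) (μ : ℝ) {σ : ℝ} (hσ : 0 < σ)
    {G : ℝ × ℝ → ℝ≥0∞} (hG : Measurable G) :
    ∫⁻ ω, reducedDensity n f (μ, σ) ω * G ω = ∫⁻ z, ∫⁻ v in Ioi (0 : ℝ),
      G (μ + σ * v * z, σ * v) * ENNReal.ofReal (v ^ (n : ℝ) * f (v ^ 2 * (z ^ 2 + 1))) := by
  have h := lintegral_halfPlane ((measurable_reducedDensity n hf (μ, σ)).mul hG) μ hσ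
  have h1 : ∀ ω, {ω : ℝ × ℝ | 0 < ω.2}.indicator (reducedDensity n f (μ, σ) * G) ω =
      reducedDensity n f (μ, σ) ω * G ω := fun ω => by
    by_cases hω : 0 < ω.2
    · exact indicator_of_mem (show ω ∈ {ω : ℝ × ℝ | 0 < ω.2} from hω) _
    · rw [indicator_of_notMem (s := {ω : ℝ × ℝ | 0 < ω.2}) hω, reducedDensity, if_neg hω, zero_mul]
  simp only [h1] at h
  rw [h]
  refine lintegral_congr fun z => setLIntegral_congr_fun measurableSet_Ioi fun v hv => ?_
  have hv : 0 < v := hv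
  have hσv : 0 < σ * v := mul_pos hσ hv
  obtain ⟨m, rfl⟩ : ∃ m, n = m + 1 := ⟨n - 1, by omega⟩
  simp only [Pi.mul_apply, reducedDensity, if_pos hσv, add_tsub_cancel_right]
  rw [← mul_assoc, ← ENNReal.ofReal_mul (by positivity), mul_comm]
  congr 2
  have e1 : ((μ + σ * v * z - μ) ^ 2 + (σ * v) ^ 2) / σ ^ 2 = v ^ 2 * (z ^ 2 + 1) := by
    field_simp; ring
  rw [e1, Real.rpow_natCast]
  field_simp
  ring

theorem risk_eq {Ω : Type*} [MeasureSpace Ω] {p : ℝ × ℝ → Ω → ℝ≥0∞} {δ : Ω → ℝ} {θ : ℝ × ℝ}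
    (hp : Measurable (p θ)) (hρ : Measurable ρ) (hδ : Measurable δ) :
    risk p ρ δ θ = (∫⁻ ω, p θ ω)⁻¹ *
      ∫⁻ ω, p θ ω * ENNReal.ofReal (ρ ((δ ω - θ.1) / θ.2)) := by
  have hm : Measurable fun ω => ENNReal.ofReal (ρ ((δ ω - θ.1) / θ.2)) :=
    (hρ.comp (by fun_prop)).ennreal_ofReal
  rw [risk, law, lintegral_smul_measure, lintegral_withDensity_eq_lintegral_mul _ hp hm]
  rfl

theorem lintegral_reducedDensity (hn : 1 ≤ n) (hf : Measurable f) (μ : ℝ) {σ : ℝ} (hσ : 0 < σ) :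
    ∫⁻ ω, reducedDensity n f (μ, σ) ω = ∫⁻ z, rayLoss (fun _ => 1) f n z 0 := by
  have := lintegral_reducedDensity_mul hn hf μ hσ (G := fun _ => 1) measurable_const
  simpa [rayLoss] using this

theorem lintegral_reducedDensity_equivariant (hn : 1 ≤ n) (hf : Measurable f) (hρ : Measurable ρ)
    (c μ : ℝ) {σ : ℝ} (hσ : 0 < σ) :
    ∫⁻ ω, reducedDensity n f (μ, σ) ω * ENNReal.ofReal (ρ ((ω.1 + c * ω.2 - μ) / σ)) =
      ∫⁻ z, rayLoss ρ f n z c := by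
  rw [lintegral_reducedDensity_mul hn hf μ hσ
    (G := fun ω => ENNReal.ofReal (ρ ((ω.1 + c * ω.2 - μ) / σ)))
    (hρ.comp (by fun_prop)).ennreal_ofReal]
  refine lintegral_congr fun z => lintegral_congr fun v => ?_
  dsimp only
  congr 3
  field_simp
  ring

/-- The substitution is μ = x - s z, σ = s/v. The constraint μ ≥ 0 becomes z < x/s up to a null set,
and the powers of v from the density, the prior and the Jacobian collect to v^{n+l}. -/
theorem posteriorLoss_reducedDensity (hn : 1 ≤ n) (hf : Measurable f) (hρ : Measurable ρ) (l x : ℝ)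
    {s : ℝ} (hs : 0 < s) (d : ℝ) :
    posteriorLoss (reducedDensity n f) ρ l (x, s) d =
      ENNReal.ofReal (s ^ (-(l + 1))) * truncLoss ρ f (n + l) (x / s) ((d - x) / s) := by
  have hw : Measurable fun θ : ℝ × ℝ => ENNReal.ofReal (θ.2 ^ (-(l + 1))) := by
    have : Measurable fun θ : ℝ × ℝ => θ.2 ^ (-(l + 1)) := measurable_snd.pow_const _
    exact this.ennreal_ofReal
  have hg : Measurable fun θ : ℝ × ℝ =>
      ENNReal.ofReal (ρ ((d - θ.1) / θ.2)) * reducedDensity n f θ (x, s) :=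
    (hρ.comp (by fun_prop)).ennreal_ofReal.mul
      ((measurable_reducedDensity_uncurry n hf).comp
        (by fun_prop : Measurable fun θ : ℝ × ℝ => (θ, (x, s))))
  rw [posteriorLoss, prior, lintegral_withDensity_eq_lintegral_mul _ hw hg, Θ,
    Measure.volume_eq_prod, ← Measure.prod_restrict, lintegral_prod_symm _ (hw.mul hg).aemeasurable,
    lintegral_Ioi_eq_div hs, truncLoss]
  have hm := (measurable_rayLoss_integrand hρ hf (n + l)).comp
    (by fun_prop : Measurable fun q : ℝ × ℝ => ((q.1, (d - x) / s), q.2))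
  have hswap : ∫⁻ z in Iio (x / s), rayLoss ρ f (n + l) z ((d - x) / s) =
      ∫⁻ v in Ioi (0 : ℝ), ∫⁻ z in Iio (x / s), ENNReal.ofReal (ρ (v * (z + (d - x) / s))) *
        ENNReal.ofReal (v ^ (n + l) * f (v ^ 2 * (z ^ 2 + 1))) :=
    lintegral_lintegral_swap hm.aemeasurable
  rw [hswap, ← lintegral_const_mul' _ _ ENNReal.ofReal_ne_top]
  refine setLIntegral_congr_fun measurableSet_Ioi fun v hv => ?_
  have hv : 0 < v := hv
  rw [setLIntegral_congr Ioi_ae_eq_Ici.symm, lintegral_Ioi_sub_mul hs x, ← mul_assoc,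
    ← ENNReal.ofReal_mul (by positivity), ← lintegral_const_mul' _ _ ENNReal.ofReal_ne_top,
    ← lintegral_const_mul' _ _ ENNReal.ofReal_ne_top]
  refine lintegral_congr fun z => ?_
  obtain ⟨m, rfl⟩ : ∃ m, n = m + 1 := ⟨n - 1, by omega⟩
  simp only [Pi.mul_apply, reducedDensity, if_pos hs, add_tsub_cancel_right]
  have e1 : (d - (x - s * z)) / (s / v) = v * (z + (d - x) / s) := by field_simp; ring
  have e2 : ((x - (x - s * z)) ^ 2 + s ^ 2) / (s / v) ^ 2 = v ^ 2 * (z ^ 2 + 1) := by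
    field_simp; ring
  rw [e1, e2]
  have e3 : s / v ^ 2 * s * (s / v) ^ (-(l + 1)) * (s ^ m / (s / v) ^ (m + 1 + 1)) =
      s ^ (-(l + 1)) * v ^ (((m + 1 : ℕ) : ℝ) + l) := by
    rw [Real.div_rpow hs.le hv.le, div_pow, Real.rpow_add hv, Real.rpow_natCast, Real.rpow_neg hv.le,
      Real.rpow_add hv l, Real.rpow_one]
    have := (Real.rpow_pos_of_pos hv l).ne'
    field_simp
    ring
  set R := ENNReal.ofReal (ρ (v * (z + (d - x) / s)))
  set F := f (v ^ 2 * (z ^ 2 + 1))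
  rw [mul_left_comm _ R, mul_left_comm _ R, mul_left_comm _ R]
  congr 1
  rw [← ENNReal.ofReal_mul (by positivity),
    ← ENNReal.ofReal_mul (by positivity), ← ENNReal.ofReal_mul (by positivity)]
  congr 1
  linear_combination F * e3

end Reduced

end BoundedMean

namespace BoundedMean

/-- Finite minimizers of the posterior loss with weight `b` lie strictly above the leaders
with weight `a`. -/
structure LeadersBelowBayes (ρ f : ℝ → ℝ) (a b : ℝ) : Prop where
  interior : LeadersInterior ρ f a
  lt : ∀ t g₀ g, IsLeader ρ f a t g₀ → truncLoss ρ f b t g ≠ ∞ →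
    (∀ g', truncLoss ρ f b t g ≤ truncLoss ρ f b t g') → g₀ < g

theorem not_isMinimax_of_lt {Ω : Type*} [MeasureSpace Ω] {p : ℝ × ℝ → Ω → ℝ≥0∞} {ρ : ℝ → ℝ}
    {δ δ' : Ω → ℝ} (hδ' : Measurable δ') {C : ℝ≥0∞} (h : ∀ θ ∈ Θ, risk p ρ δ' θ ≤ C) {θ : ℝ × ℝ}
    (hθ : θ ∈ Θ) (hlt : C < risk p ρ δ θ) : ¬IsMinimax p ρ δ := fun hmm =>
  ((le_iSup₂_of_le θ hθ le_rfl).trans ((hmm δ' hδ').trans (iSup₂_le h))).not_gt hlt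

/-! ### Boundary risk and minimaxity when (X, S) is observed -/

section Reduced

variable {n : ℕ} {f ρ : ℝ → ℝ} {l : ℝ}

theorem IsGeneralizedBayes.forall_truncLoss_le (hn : 1 ≤ n) (hf : Measurable f) (hρ : Measurable ρ)
    {x s d : ℝ} (hs : 0 < s) (hfin : posteriorLoss (reducedDensity n f) ρ l (x, s) d < ∞)
    (hmin : ∀ d', posteriorLoss (reducedDensity n f) ρ l (x, s) d ≤
      posteriorLoss (reducedDensity n f) ρ l (x, s) d') :
    truncLoss ρ f (n + l) (x / s) ((d - x) / s) ≠ ∞ ∧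
      ∀ g', truncLoss ρ f (n + l) (x / s) ((d - x) / s) ≤ truncLoss ρ f (n + l) (x / s) g' := by
  have hpos : ENNReal.ofReal (s ^ (-(l + 1))) ≠ 0 := by
    rw [ne_eq, ENNReal.ofReal_eq_zero, not_le]; exact Real.rpow_pos_of_pos hs _
  simp only [posteriorLoss_reducedDensity hn hf hρ l x hs] at hfin hmin
  refine ⟨fun h => ?_, fun g' => ?_⟩
  · rw [h, ENNReal.mul_top hpos] at hfin
    exact hfin.ne rfl
  · have := hmin (x + s * g')
    rw [add_sub_cancel_left, mul_div_cancel_left₀ _ hs.ne'] at this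
    exact (ENNReal.mul_le_mul_iff_right hpos ENNReal.ofReal_ne_top).1 this

/-- At μ = 0 the ray variable is z = x/s. The estimate may still vary along the ray, but at almost
every point it exceeds the nonnegative estimate of each leader and so has a larger loss. The Bayes
property is required only for s > 0, so that slices of an estimator based on (X,U) qualify. -/
theorem lintegral_rayLoss_zero_lt_of_isGeneralizedBayes (hn : 1 ≤ n) (hf : IsDecreasingGenerator f)
    (hρ : IsEvenLoss ρ) (hfin : ∫⁻ z, rayLoss ρ f n z 0 ≠ ∞)
    (hlb : LeadersBelowBayes ρ f n (n + l)) {δ : ℝ × ℝ → ℝ} (hδ : Measurable δ)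
    (hGB : ∀ᵐ ω : ℝ × ℝ, 0 < ω.2 → posteriorLoss (reducedDensity n f) ρ l ω (δ ω) < ∞ ∧
      ∀ d, posteriorLoss (reducedDensity n f) ρ l ω (δ ω) ≤
        posteriorLoss (reducedDensity n f) ρ l ω d) {σ : ℝ} (hσ : 0 < σ) :
    ∫⁻ z, rayLoss ρ f n z 0 <
      ∫⁻ ω, reducedDensity n f (0, σ) ω * ENNReal.ofReal (ρ ((δ ω - 0) / σ)) := by
  have hρm := hρ.cont.measurable
  have hfm := hf.meas
  have hG : Measurable fun ω : ℝ × ℝ => ENNReal.ofReal (ρ ((δ ω - 0) / σ)) :=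
    (hρm.comp (by fun_prop)).ennreal_ofReal
  have hw : Measurable fun q : ℝ × ℝ =>
      ENNReal.ofReal (q.2 ^ (n : ℝ) * f (q.2 ^ 2 * (q.1 ^ 2 + 1))) := by
    have h1 : Measurable fun q : ℝ × ℝ => q.2 ^ (n : ℝ) := measurable_snd.pow_const _
    exact (h1.mul (hfm.comp (by fun_prop))).ennreal_ofReal
  have hm : Measurable fun q : ℝ × ℝ =>
      ENNReal.ofReal (ρ ((δ (0 + σ * q.2 * q.1, σ * q.2) - 0) / σ)) *
        ENNReal.ofReal (q.2 ^ (n : ℝ) * f (q.2 ^ 2 * (q.1 ^ 2 + 1))) :=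
    (hG.comp (by fun_prop : Measurable fun q : ℝ × ℝ => (0 + σ * q.2 * q.1, σ * q.2))).mul hw
  rw [lintegral_reducedDensity_mul hn hfm 0 hσ hG]
  refine lintegral_rayLoss_zero_lt hρ hf hfin hlb.interior
    (hm.lintegral_prod_right' (ν := volume.restrict (Ioi (0 : ℝ)))) ?_
  filter_upwards [ae_halfPlane hGB 0 hσ] with z hz g₀ hg₀
  refine lintegral_strict_mono (by simp)
    (hm.comp (by fun_prop : Measurable fun v : ℝ => (z, v))).aemeasurable
    (hlb.interior.continuousAt hρ hf hg₀).2 ((ae_restrict_iff' measurableSet_Ioi).2 ?_)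
  filter_upwards [hz] with v hv hv0
  have hv0 : 0 < v := hv0
  have hσv : 0 < σ * v := mul_pos hσ hv0
  obtain ⟨h1, h2⟩ := IsGeneralizedBayes.forall_truncLoss_le hn hfm hρm hσv
    (hv hv0).1 (hv hv0).2
  rw [zero_add, mul_div_cancel_left₀ _ hσv.ne'] at h1 h2
  set d := δ (σ * v * z, σ * v) with hd
  have hlt := hlb.lt z g₀ _ hg₀ h1 h2
  have hwpos : 0 < v ^ (n : ℝ) * f (v ^ 2 * (z ^ 2 + 1)) :=
    mul_pos (Real.rpow_pos_of_pos hv0 _) (hf.pos _ (by positivity))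
  have e : (d - 0) / σ = v * (z + (d - σ * v * z) / (σ * v)) := by field_simp; ring
  have h0 := hg₀.add_nonneg
  simp only [zero_add]
  rw [← hd, e]
  refine (ENNReal.mul_lt_mul_iff_left (ENNReal.ofReal_pos.2 hwpos).ne' ENNReal.ofReal_ne_top).2
    ((ENNReal.ofReal_lt_ofReal_iff_of_nonneg (hρ.nonneg _)).2 (hρ.lt ?_))
  rw [abs_of_nonneg (by positivity), abs_of_pos (mul_pos hv0 (by linarith))]
  gcongr

theorem lintegral_rayLoss_one_ne_zero (hf : IsDecreasingGenerator f) (a : ℝ) :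
    ∫⁻ z, rayLoss (fun _ => 1) f a z 0 ≠ 0 := by
  rw [← setLIntegral_univ]
  refine (setLIntegral_pos MeasurableSet.univ (by simp) (measurable_rayLoss measurable_const
    hf.meas a 0) fun z _ => ?_).ne'
  refine setLIntegral_pos measurableSet_Ioi (by simp)
    ((measurable_rayLoss_integrand measurable_const hf.meas a).comp
      (by fun_prop : Measurable fun v : ℝ => ((z, (0 : ℝ)), v))) fun v hv => ?_
  have hv : 0 < v := hv
  simp only [ENNReal.ofReal_one, one_mul]
  exact ENNReal.ofReal_pos.2 (mul_pos (Real.rpow_pos_of_pos hv _) (hf.pos _ (by positivity)))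

theorem risk_reducedDensity_equivariant (hn : 1 ≤ n) (hf : Measurable f) (hρ : Measurable ρ)
    (c : ℝ) {θ : ℝ × ℝ} (hθ : 0 < θ.2) :
    risk (reducedDensity n f) ρ (fun ω => ω.1 + c * ω.2) θ =
      (∫⁻ z, rayLoss (fun _ => 1) f n z 0)⁻¹ * ∫⁻ z, rayLoss ρ f n z c := by
  rw [risk_eq (measurable_reducedDensity n hf θ) hρ (by fun_prop),
    lintegral_reducedDensity hn hf θ.1 hθ, lintegral_reducedDensity_equivariant hn hf hρ c θ.1 hθ]

/-- Symmetrization over the whole line makes c = 0 a minimizer, so c₀ attains the same finite value;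
c₀ itself need not be identified. -/
theorem IsMREConstant.lintegral_rayLoss_eq (hn : 1 ≤ n) (hf : IsDecreasingGenerator f)
    (hρ : IsEvenLoss ρ) (hZ : ∫⁻ z, rayLoss (fun _ => 1) f n z 0 ≠ ∞) {c₀ : ℝ}
    (hc₀ : IsMREConstant n f ρ c₀) :
    ∫⁻ z, rayLoss ρ f n z 0 ≠ ∞ ∧ ∫⁻ z, rayLoss ρ f n z c₀ = ∫⁻ z, rayLoss ρ f n z 0 := by
  have hZ0 := ENNReal.inv_ne_zero.2 hZ
  have hZt := ENNReal.inv_ne_top.2 (lintegral_rayLoss_one_ne_zero hf n)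
  have hle : ∫⁻ z, rayLoss ρ f n z 0 ≤ ∫⁻ z, rayLoss ρ f n z c₀ := by
    simpa only [Measure.restrict_univ] using
      setLIntegral_rayLoss_zero_le hρ hf n c₀ MeasurableSet.univ (by simp)
  obtain ⟨h1, h2⟩ := hc₀
  simp only [fun c => risk_reducedDensity_equivariant hn hf.meas hρ.cont.measurable c
    (θ := (0, 1)) one_pos] at h1 h2
  have hge := (ENNReal.mul_le_mul_iff_right hZ0 hZt).1 (h2 0)
  refine ⟨ne_top_of_le_ne_top (fun h => ?_) hle, le_antisymm hge hle⟩
  rw [h, ENNReal.mul_top hZ0] at h1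
  exact h1.ne rfl

theorem reduced_not_isMinimax_and_risk_lt (hn : 1 ≤ n) (hf : IsDecreasingGenerator f)
    (hρ : IsEvenLoss ρ) (hZ : ∫⁻ z, rayLoss (fun _ => 1) f n z 0 ≠ ∞)
    (hlb : LeadersBelowBayes ρ f n (n + l)) {c₀ : ℝ} (hc₀ : IsMREConstant n f ρ c₀)
    {δ : ℝ × ℝ → ℝ} (hδ : Measurable δ) (hGB : IsGeneralizedBayes (reducedDensity n f) ρ l δ) :
    ¬IsMinimax (reducedDensity n f) ρ δ ∧ ∀ σ : ℝ, 0 < σ →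
      risk (reducedDensity n f) ρ (fun ω => ω.1 + c₀ * ω.2) (0, σ) <
        risk (reducedDensity n f) ρ δ (0, σ) := by
  have hρm := hρ.cont.measurable
  obtain ⟨hfin, heq⟩ := hc₀.lintegral_rayLoss_eq hn hf hρ hZ
  have hZ0 := ENNReal.inv_ne_zero.2 hZ
  have hZt := ENNReal.inv_ne_top.2 (lintegral_rayLoss_one_ne_zero hf n)
  have hlt : ∀ σ : ℝ, 0 < σ → (∫⁻ z, rayLoss (fun _ => 1) f n z 0)⁻¹ *
      ∫⁻ z, rayLoss ρ f n z c₀ < risk (reducedDensity n f) ρ δ (0, σ) := fun σ hσ => by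
    rw [risk_eq (measurable_reducedDensity n hf.meas _) hρm hδ,
      lintegral_reducedDensity hn hf.meas 0 hσ, heq]
    exact (ENNReal.mul_lt_mul_iff_right hZ0 hZt).2
      (lintegral_rayLoss_zero_lt_of_isGeneralizedBayes hn hf hρ hfin hlb hδ
        (hGB.mono fun ω h _ => h) hσ)
  refine ⟨?_, fun σ hσ => ?_⟩
  · refine not_isMinimax_of_lt (δ' := fun ω : ℝ × ℝ => ω.1 + c₀ * ω.2) (by fun_prop)
      (fun θ hθ => (risk_reducedDensity_equivariant hn hf.meas hρm c₀ hθ.2).le)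
      (θ := (0, 1)) (by simp [Θ]) (hlt 1 one_pos)
  · rw [risk_reducedDensity_equivariant hn hf.meas hρm c₀ hσ]
    exact hlt σ hσ

end Reduced

/-! ### Polar coordinates for the residual vector -/

section Polar

variable {n : ℕ}

/-- The surface measure on the unit sphere of `ℝⁿ`. -/
noncomputable abbrev sphereMeasure (n : ℕ) :
    Measure (Metric.sphere (0 : EuclideanSpace ℝ (Fin n)) 1) :=
  (volume : Measure (EuclideanSpace ℝ (Fin n))).toSphere

theorem lintegral_euclidean_polar (hn : 1 ≤ n) {H : EuclideanSpace ℝ (Fin n) → ℝ≥0∞}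
    (hH : Measurable H) :
    ∫⁻ u, H u = ∫⁻ ϑ, (∫⁻ s in Ioi (0 : ℝ), ENNReal.ofReal (s ^ (n - 1)) *
      H (s • (ϑ : EuclideanSpace ℝ (Fin n)))) ∂sphereMeasure n := by
  have : Nonempty (Fin n) := ⟨⟨0, hn⟩⟩
  have hdim : Module.finrank ℝ (EuclideanSpace ℝ (Fin n)) = n := by simp
  have hmp := (volume : Measure (EuclideanSpace ℝ (Fin n))).measurePreserving_homeomorphUnitSphereProd
  set e := homeomorphUnitSphereProd (EuclideanSpace ℝ (Fin n))
  have h1 : ∫⁻ u, H u = ∫⁻ x : ({0}ᶜ : Set (EuclideanSpace ℝ (Fin n))), H x ∂(volume : Measure (EuclideanSpace ℝ (Fin n))).comap (↑) := by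
    rw [lintegral_subtype_comap (measurableSet_singleton _).compl, restrict_compl_singleton]
  have h2 := hmp.lintegral_comp_emb e.measurableEmbedding fun q => H (e.symm q)
  simp only [Homeomorph.symm_apply_apply] at h2
  have hme : Measurable fun q : Metric.sphere (0 : (EuclideanSpace ℝ (Fin n))) 1 × Ioi (0 : ℝ) => H (e.symm q) :=
    (hH.comp measurable_subtype_coe).comp e.symm.measurable
  rw [h1, h2, lintegral_prod _ hme.aemeasurable, hdim]
  refine lintegral_congr fun ϑ => ?_
  have hpow : Measurable fun r : Ioi (0 : ℝ) => ENNReal.ofReal ((r : ℝ) ^ (n - 1)) := by fun_prop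
  have hme' : Measurable fun r : Ioi (0 : ℝ) => H (e.symm (ϑ, r)) :=
    hme.comp (by fun_prop : Measurable fun r : Ioi (0 : ℝ) => (ϑ, r))
  rw [Measure.volumeIoiPow, lintegral_withDensity_eq_lintegral_mul _ hpow hme',
    ← lintegral_subtype_comap measurableSet_Ioi]
  rfl

theorem measurable_smul_sphere {H : ℝ × EuclideanSpace ℝ (Fin n) → ℝ≥0∞} (hH : Measurable H) :
    Measurable fun q : Metric.sphere (0 : EuclideanSpace ℝ (Fin n)) 1 × (ℝ × ℝ) =>
      H (q.2.1, q.2.2 • (q.1 : EuclideanSpace ℝ (Fin n))) := by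
  refine hH.comp (Measurable.prodMk (by fun_prop) ?_)
  exact (measurable_snd.comp measurable_snd).smul (measurable_subtype_coe.comp measurable_fst)

theorem lintegral_prod_polar (hn : 1 ≤ n) {H : ℝ × EuclideanSpace ℝ (Fin n) → ℝ≥0∞}
    (hH : Measurable H) :
    ∫⁻ ω, H ω = ∫⁻ ϑ, (∫⁻ ω, {ω : ℝ × ℝ | 0 < ω.2}.indicator (fun ω =>
      ENNReal.ofReal (ω.2 ^ (n - 1)) * H (ω.1, ω.2 • (ϑ : EuclideanSpace ℝ (Fin n)))) ω)
        ∂sphereMeasure n := by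
  have hS : MeasurableSet {ω : ℝ × ℝ | 0 < ω.2} := measurableSet_lt measurable_const measurable_snd
  have hm : Measurable fun q : Metric.sphere (0 : EuclideanSpace ℝ (Fin n)) 1 × (ℝ × ℝ) =>
      ENNReal.ofReal (q.2.2 ^ (n - 1)) * H (q.2.1, q.2.2 • (q.1 : EuclideanSpace ℝ (Fin n))) :=
    Measurable.mul (by fun_prop) (measurable_smul_sphere hH)
  rw [Measure.volume_eq_prod, lintegral_prod _ hH.aemeasurable]
  have h1 : ∀ x, ∫⁻ u, H (x, u) = ∫⁻ ϑ, (∫⁻ s in Ioi (0 : ℝ), ENNReal.ofReal (s ^ (n - 1)) *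
      H (x, s • (ϑ : EuclideanSpace ℝ (Fin n)))) ∂sphereMeasure n := fun x =>
    lintegral_euclidean_polar hn (hH.comp (by fun_prop : Measurable fun u => (x, u)))
  simp only [h1]
  have hm2 : Measurable fun q : (ℝ × Metric.sphere (0 : EuclideanSpace ℝ (Fin n)) 1) × ℝ =>
      ENNReal.ofReal (q.2 ^ (n - 1)) * H (q.1.1, q.2 • (q.1.2 : EuclideanSpace ℝ (Fin n))) :=
    hm.comp (by fun_prop : Measurable fun q : (ℝ × Metric.sphere (0 : EuclideanSpace ℝ (Fin n)) 1)
      × ℝ => (q.1.2, (q.1.1, q.2)))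
  rw [lintegral_lintegral_swap
    (hm2.lintegral_prod_right' (ν := volume.restrict (Ioi (0 : ℝ)))).aemeasurable]
  refine lintegral_congr fun ϑ => ?_
  have hm3 : Measurable ({ω : ℝ × ℝ | 0 < ω.2}.indicator fun ω =>
      ENNReal.ofReal (ω.2 ^ (n - 1)) * H (ω.1, ω.2 • (ϑ : EuclideanSpace ℝ (Fin n)))) :=
    (hm.comp (by fun_prop : Measurable fun ω : ℝ × ℝ => (ϑ, ω))).indicator hS
  rw [Measure.volume_eq_prod, lintegral_prod _ hm3.aemeasurable]
  refine lintegral_congr fun x => ?_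
  rw [← lintegral_indicator measurableSet_Ioi]
  refine lintegral_congr fun s => ?_
  by_cases hs : 0 < s
  · rw [indicator_of_mem (mem_Ioi.2 hs), indicator_of_mem (show (x, s) ∈ {ω : ℝ × ℝ | 0 < ω.2}
      from hs)]
  · rw [indicator_of_notMem (by simpa using hs), indicator_of_notMem
      (s := {ω : ℝ × ℝ | 0 < ω.2}) hs]

theorem ae_polar (hn : 1 ≤ n) {P : ℝ × EuclideanSpace ℝ (Fin n) → Prop} (hP : ∀ᵐ ω, P ω) :
    ∀ᵐ ϑ : Metric.sphere (0 : EuclideanSpace ℝ (Fin n)) 1 ∂sphereMeasure n, ∀ᵐ ω : ℝ × ℝ, 0 < ω.2 →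
      P (ω.1, ω.2 • (ϑ : EuclideanSpace ℝ (Fin n))) := by
  have hS : MeasurableSet {ω : ℝ × ℝ | 0 < ω.2} := measurableSet_lt measurable_const measurable_snd
  set T := toMeasurable volume {ω | ¬P ω} with hT
  have hTm : MeasurableSet T := measurableSet_toMeasurable _ _
  have hT0 : volume T = 0 := by rw [hT, measure_toMeasurable]; exact hP
  set H : ℝ × EuclideanSpace ℝ (Fin n) → ℝ≥0∞ := T.indicator 1 with hH
  have hHm : Measurable H := measurable_one.indicator hTm
  have h0 : ∫⁻ ω, H ω = 0 := by rw [hH, lintegral_indicator_one hTm, hT0]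
  have hm : Measurable fun q : Metric.sphere (0 : EuclideanSpace ℝ (Fin n)) 1 × (ℝ × ℝ) =>
      {ω : ℝ × ℝ | 0 < ω.2}.indicator (fun ω =>
        ENNReal.ofReal (ω.2 ^ (n - 1)) * H (ω.1, ω.2 • (q.1 : EuclideanSpace ℝ (Fin n)))) q.2 := by
    have h1 : Measurable fun q : Metric.sphere (0 : EuclideanSpace ℝ (Fin n)) 1 × (ℝ × ℝ) =>
        ENNReal.ofReal (q.2.2 ^ (n - 1)) * H (q.2.1, q.2.2 • (q.1 : EuclideanSpace ℝ (Fin n))) :=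
      Measurable.mul (by fun_prop) (measurable_smul_sphere hHm)
    exact h1.indicator (hS.preimage measurable_snd)
  rw [lintegral_prod_polar hn hHm] at h0
  filter_upwards [(lintegral_eq_zero_iff hm.lintegral_prod_right').1 h0] with ϑ hϑ
  have h2 := (lintegral_eq_zero_iff (hm.comp (by fun_prop : Measurable
    fun ω : ℝ × ℝ => (ϑ, ω)))).1 hϑ
  filter_upwards [h2] with ω hω hpos
  simp only [Function.comp_apply, Pi.zero_apply] at hω
  rw [indicator_of_mem (show ω ∈ {ω : ℝ × ℝ | 0 < ω.2} from hpos), mul_eq_zero,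
    ENNReal.ofReal_eq_zero] at hω
  have h3 := hω.resolve_left (pow_pos hpos _).not_ge
  by_contra hcon
  rw [hH, indicator_of_mem (subset_toMeasurable _ _ hcon)] at h3
  simp at h3

end Polar

end BoundedMean

namespace BoundedMean

/-! ### Boundary risk and minimaxity when (X, U) is observed -/

section Full

variable {n : ℕ} {f ρ : ℝ → ℝ} {l : ℝ}

theorem measurable_fullDensity (n : ℕ) (hf : Measurable f) (θ : ℝ × ℝ) :
    Measurable (fullDensity n f θ) := by
  unfold fullDensity
  exact (Measurable.mul measurable_const (hf.comp (by fun_prop))).ennreal_ofReal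

theorem norm_smul_sphere {s : ℝ} (hs : 0 < s)
    (ϑ : Metric.sphere (0 : EuclideanSpace ℝ (Fin n)) 1) :
    ‖s • (ϑ : EuclideanSpace ℝ (Fin n))‖ = s := by
  rw [norm_smul, norm_eq_of_mem_sphere, mul_one, Real.norm_of_nonneg hs.le]

theorem reducedDensity_eq_mul_fullDensity {s : ℝ} (hs : 0 < s) (x : ℝ) (θ : ℝ × ℝ)
    (ϑ : Metric.sphere (0 : EuclideanSpace ℝ (Fin n)) 1) :
    reducedDensity n f θ (x, s) = ENNReal.ofReal (s ^ (n - 1)) *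
      fullDensity n f θ (x, s • (ϑ : EuclideanSpace ℝ (Fin n))) := by
  rw [reducedDensity, if_pos hs, fullDensity, ← ENNReal.ofReal_mul (by positivity)]
  dsimp only
  rw [norm_smul_sphere hs]
  congr 1
  ring

theorem lintegral_fullDensity_mul (hn : 1 ≤ n) (hf : Measurable f) (θ : ℝ × ℝ)
    {G : ℝ × EuclideanSpace ℝ (Fin n) → ℝ≥0∞} (hG : Measurable G) :
    ∫⁻ ω, fullDensity n f θ ω * G ω = ∫⁻ ϑ, (∫⁻ ω, reducedDensity n f θ ω *
      G (ω.1, ω.2 • (ϑ : EuclideanSpace ℝ (Fin n)))) ∂sphereMeasure n := by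
  have hm : Measurable fun ω => fullDensity n f θ ω * G ω := (measurable_fullDensity n hf θ).mul hG
  rw [lintegral_prod_polar hn hm]
  refine lintegral_congr fun ϑ => lintegral_congr fun ω => ?_
  by_cases hω : 0 < ω.2
  · rw [indicator_of_mem (show ω ∈ {ω : ℝ × ℝ | 0 < ω.2} from hω),
      show ω = (ω.1, ω.2) from rfl, reducedDensity_eq_mul_fullDensity hω ω.1 θ ϑ, mul_assoc]
  · rw [indicator_of_notMem (s := {ω : ℝ × ℝ | 0 < ω.2}) hω, reducedDensity, if_neg hω, zero_mul]

theorem posteriorLoss_reducedDensity_eq_mul {s : ℝ} (hs : 0 < s) (x d : ℝ)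
    (ϑ : Metric.sphere (0 : EuclideanSpace ℝ (Fin n)) 1) :
    posteriorLoss (reducedDensity n f) ρ l (x, s) d = ENNReal.ofReal (s ^ (n - 1)) *
      posteriorLoss (fullDensity n f) ρ l (x, s • (ϑ : EuclideanSpace ℝ (Fin n))) d := by
  rw [posteriorLoss, posteriorLoss, ← lintegral_const_mul' _ _ ENNReal.ofReal_ne_top]
  refine lintegral_congr fun θ => ?_
  rw [reducedDensity_eq_mul_fullDensity hs x θ ϑ, mul_left_comm]

/-- Given the direction, the posterior losses at (x, sϑ) and at (x, s) differ by the factor s^{n-1},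
which does not involve d and is finite. -/
theorem IsGeneralizedBayes.ae_slice (hn : 1 ≤ n) {δ : ℝ × EuclideanSpace ℝ (Fin n) → ℝ}
    (hGB : IsGeneralizedBayes (fullDensity n f) ρ l δ) :
    ∀ᵐ ϑ : Metric.sphere (0 : EuclideanSpace ℝ (Fin n)) 1 ∂sphereMeasure n, ∀ᵐ ω : ℝ × ℝ,
      0 < ω.2 →
        posteriorLoss (reducedDensity n f) ρ l ω
          (δ (ω.1, ω.2 • (ϑ : EuclideanSpace ℝ (Fin n)))) < ∞ ∧
        ∀ d, posteriorLoss (reducedDensity n f) ρ l ω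
            (δ (ω.1, ω.2 • (ϑ : EuclideanSpace ℝ (Fin n)))) ≤
          posteriorLoss (reducedDensity n f) ρ l ω d := by
  filter_upwards [ae_polar hn hGB] with ϑ hϑ
  filter_upwards [hϑ] with ω hω hpos
  obtain ⟨h1, h2⟩ := hω hpos
  have e := fun d => posteriorLoss_reducedDensity_eq_mul (n := n) (f := f) (ρ := ρ) (l := l) hpos
    ω.1 d ϑ
  simp only [Prod.mk.eta] at e
  simp only [e]
  exact ⟨ENNReal.mul_lt_top ENNReal.ofReal_lt_top h1, fun d => by gcongr; exact h2 d⟩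

theorem sphereMeasure_univ_ne_zero (hn : 1 ≤ n) : sphereMeasure n univ ≠ 0 := by
  have : Nonempty (Fin n) := ⟨⟨0, hn⟩⟩
  exact Measure.measure_univ_ne_zero.2
    (Measure.toSphere_ne_zero (volume : Measure (EuclideanSpace ℝ (Fin n))))

theorem lintegral_fullDensity (hn : 1 ≤ n) (hf : Measurable f) (μ : ℝ) {σ : ℝ} (hσ : 0 < σ) :
    ∫⁻ ω, fullDensity n f (μ, σ) ω =
      (∫⁻ z, rayLoss (fun _ => 1) f n z 0) * sphereMeasure n univ := by
  have := lintegral_fullDensity_mul hn hf (μ, σ) (G := fun _ => 1) measurable_const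
  simp only [mul_one, lintegral_reducedDensity hn hf μ hσ, lintegral_const] at this
  exact this

theorem risk_fullDensity_equivariant (hn : 1 ≤ n) (hf : Measurable f) (hρ : Measurable ρ)
    (c : ℝ) {θ : ℝ × ℝ} (hθ : 0 < θ.2) :
    risk (fullDensity n f) ρ (fun ω => ω.1 + c * ‖ω.2‖) θ =
      ((∫⁻ z, rayLoss (fun _ => 1) f n z 0) * sphereMeasure n univ)⁻¹ *
        ((∫⁻ z, rayLoss ρ f n z c) * sphereMeasure n univ) := by
  rw [risk_eq (measurable_fullDensity n hf θ) hρ (by fun_prop),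
    lintegral_fullDensity hn hf θ.1 hθ, lintegral_fullDensity_mul hn hf θ
      (G := fun ω => ENNReal.ofReal (ρ ((ω.1 + c * ‖ω.2‖ - θ.1) / θ.2)))
      (hρ.comp (by fun_prop)).ennreal_ofReal]
  congr 1
  rw [← lintegral_const]
  refine lintegral_congr fun ϑ => ?_
  rw [← lintegral_reducedDensity_equivariant hn hf hρ c θ.1 hθ]
  refine lintegral_congr fun ω => ?_
  by_cases hω : 0 < ω.2
  · dsimp only
    rw [norm_smul_sphere hω]
  · simp only [reducedDensity, if_neg hω, zero_mul]

theorem full_not_isMinimax_and_risk_lt (hn : 1 ≤ n) (hf : IsDecreasingGenerator f)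
    (hρ : IsEvenLoss ρ) (hZ : ∫⁻ z, rayLoss (fun _ => 1) f n z 0 ≠ ∞)
    (hlb : LeadersBelowBayes ρ f n (n + l)) {c₀ : ℝ} (hc₀ : IsMREConstant n f ρ c₀)
    {δ : ℝ × EuclideanSpace ℝ (Fin n) → ℝ} (hδ : Measurable δ)
    (hGB : IsGeneralizedBayes (fullDensity n f) ρ l δ) :
    ¬IsMinimax (fullDensity n f) ρ δ ∧ ∀ σ : ℝ, 0 < σ →
      risk (fullDensity n f) ρ (fun ω => ω.1 + c₀ * ‖ω.2‖) (0, σ) <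
        risk (fullDensity n f) ρ δ (0, σ) := by
  have hρm := hρ.cont.measurable
  obtain ⟨hfin, heq⟩ := hc₀.lintegral_rayLoss_eq hn hf hρ hZ
  set A := sphereMeasure n univ with hA
  have hA0 : A ≠ 0 := sphereMeasure_univ_ne_zero hn
  have hAt : A ≠ ∞ := measure_ne_top _ _
  have hZ0 := ENNReal.inv_ne_zero.2 (ENNReal.mul_ne_top hZ hAt)
  have hZt := ENNReal.inv_ne_top.2 (mul_ne_zero (lintegral_rayLoss_one_ne_zero hf n) hA0)
  have hlt : ∀ σ : ℝ, 0 < σ → ((∫⁻ z, rayLoss (fun _ => 1) f n z 0) * A)⁻¹ *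
      ((∫⁻ z, rayLoss ρ f n z c₀) * A) < risk (fullDensity n f) ρ δ (0, σ) := fun σ hσ => by
    have hG : Measurable fun ω => ENNReal.ofReal (ρ ((δ ω - 0) / σ)) :=
      (hρm.comp (by fun_prop)).ennreal_ofReal
    have hm : Measurable fun q : Metric.sphere (0 : EuclideanSpace ℝ (Fin n)) 1 × (ℝ × ℝ) =>
        reducedDensity n f (0, σ) q.2 * ENNReal.ofReal
          (ρ ((δ (q.2.1, q.2.2 • (q.1 : EuclideanSpace ℝ (Fin n))) - 0) / σ)) :=
      ((measurable_reducedDensity n hf.meas (0, σ)).comp measurable_snd).mul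
        (measurable_smul_sphere hG)
    rw [risk_eq (measurable_fullDensity n hf.meas _) hρm hδ,
      lintegral_fullDensity hn hf.meas 0 hσ, heq]
    refine (ENNReal.mul_lt_mul_iff_right hZ0 hZt).2 ?_
    rw [lintegral_fullDensity_mul hn hf.meas (0, σ) hG, hA, ← lintegral_const]
    -- The strict inequality for almost every direction integrates to a strict one because the
    -- sphere has positive finite measure and the smaller side is finite.
    refine lintegral_strict_mono (Measure.measure_univ_ne_zero.1 hA0) hm.lintegral_prod_right'.aemeasurable
      (by rw [lintegral_const]; exact ENNReal.mul_ne_top hfin hAt) ?_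
    filter_upwards [hGB.ae_slice hn] with ϑ hϑ
    refine lintegral_rayLoss_zero_lt_of_isGeneralizedBayes hn hf hρ hfin hlb
      (δ := fun ω => δ (ω.1, ω.2 • (ϑ : EuclideanSpace ℝ (Fin n)))) (hδ.comp ?_) hϑ hσ
    exact measurable_fst.prodMk (measurable_snd.smul_const _)
  refine ⟨?_, fun σ hσ => ?_⟩
  · refine not_isMinimax_of_lt
      (δ' := fun ω : ℝ × EuclideanSpace ℝ (Fin n) => ω.1 + c₀ * ‖ω.2‖) (by fun_prop)
      (fun θ hθ => (risk_fullDensity_equivariant hn hf.meas hρm c₀ hθ.2).le)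
      (θ := (0, 1)) (by simp [Θ]) (hlt 1 one_pos)
  · rw [risk_fullDensity_equivariant hn hf.meas hρm c₀ hσ]
    exact hlt σ hσ

end Full

/-! ### Replacing the generator by one that agrees on (0,∞) -/

section Congr

variable {Ω : Type*} [MeasureSpace Ω] {p p' : ℝ × ℝ → Ω → ℝ≥0∞} {ρ : ℝ → ℝ} {l : ℝ} {δ : Ω → ℝ}

theorem risk_congr (h : ∀ᵐ ω, ∀ θ ∈ Θ, p θ ω = p' θ ω) (δ : Ω → ℝ) {θ : ℝ × ℝ} (hθ : θ ∈ Θ) :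
    risk p ρ δ θ = risk p' ρ δ θ := by
  have h1 : p θ =ᵐ[volume] p' θ := h.mono fun ω hω => hω θ hθ
  rw [risk, risk, law, law, lintegral_congr_ae h1, withDensity_congr_ae h1]

theorem IsMinimax.congr (h : ∀ᵐ ω, ∀ θ ∈ Θ, p θ ω = p' θ ω) (hδ : IsMinimax p ρ δ) :
    IsMinimax p' ρ δ := fun δ' hδ' => by
  have h1 : ∀ δ, ⨆ θ ∈ Θ, risk p' ρ δ θ = ⨆ θ ∈ Θ, risk p ρ δ θ := fun δ =>
    iSup_congr fun θ => iSup_congr fun hθ => (risk_congr h δ hθ).symm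
  rw [h1, h1]
  exact hδ δ' hδ'

theorem IsGeneralizedBayes.congr (h : ∀ᵐ ω, ∀ θ ∈ Θ, p θ ω = p' θ ω)
    (hδ : IsGeneralizedBayes p ρ l δ) : IsGeneralizedBayes p' ρ l δ := by
  have hΘ : MeasurableSet Θ := measurableSet_Ici.prod measurableSet_Ioi
  have h1 : ∀ᵐ θ ∂prior l, θ ∈ Θ :=
    (withDensity_absolutelyContinuous _ _).ae_le (ae_restrict_mem hΘ)
  filter_upwards [h, hδ] with ω hω hδω
  have h2 : ∀ d, posteriorLoss p' ρ l ω d = posteriorLoss p ρ l ω d := fun d =>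
    lintegral_congr_ae (h1.mono fun θ hθ => by simp only [hω θ hθ])
  simp only [h2]
  exact hδω

end Congr

section Generator

variable {n : ℕ} {f f' : ℝ → ℝ}

theorem reducedDensity_congr (h : ∀ t, 0 < t → f t = f' t) (ω : ℝ × ℝ) {θ : ℝ × ℝ} (hθ : θ ∈ Θ) :
    reducedDensity n f θ ω = reducedDensity n f' θ ω := by
  have hσ : 0 < θ.2 := hθ.2
  unfold reducedDensity
  split_ifs with hω
  · rw [h _ (by positivity)]
  · rfl

/-- The argument of the generator vanishes only if u = 0, which is a null event; there the two
generators may differ. -/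
theorem fullDensity_congr (hn : 1 ≤ n) (h : ∀ t, 0 < t → f t = f' t) :
    ∀ᵐ ω, ∀ θ ∈ Θ, fullDensity n f θ ω = fullDensity n f' θ ω := by
  have : Nonempty (Fin n) := ⟨⟨0, hn⟩⟩
  have h1 : ∀ᵐ ω : ℝ × EuclideanSpace ℝ (Fin n), ω.2 ≠ 0 :=
    Measure.quasiMeasurePreserving_snd.ae (Measure.ae_ne volume 0)
  filter_upwards [h1] with ω hω θ hθ
  have hσ : 0 < θ.2 := hθ.2
  have hu : 0 < ‖ω.2‖ := norm_pos_iff.2 hω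
  rw [fullDensity, fullDensity, h _ (by positivity)]

end Generator

end BoundedMean

namespace BoundedMean

/-! ### Constant factors in the generator -/

section ConstMul

variable {ρ f : ℝ → ℝ} {C a b t : ℝ}

theorem rayLoss_const_mul (hC : 0 ≤ C) (a z g : ℝ) :
    rayLoss ρ (fun t => C * f t) a z g = ENNReal.ofReal C * rayLoss ρ f a z g := by
  rw [rayLoss, rayLoss, ← lintegral_const_mul' _ _ ENNReal.ofReal_ne_top]
  refine lintegral_congr fun v => ?_
  rw [mul_left_comm (v ^ a), ENNReal.ofReal_mul hC, mul_left_comm]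

theorem lintegral_rayLoss_const_mul (hC : 0 ≤ C) (a g : ℝ) :
    ∫⁻ z, rayLoss ρ (fun t => C * f t) a z g = ENNReal.ofReal C * ∫⁻ z, rayLoss ρ f a z g := by
  simp only [rayLoss_const_mul hC]
  exact lintegral_const_mul' _ _ ENNReal.ofReal_ne_top

theorem truncLoss_const_mul (hC : 0 ≤ C) (a t g : ℝ) :
    truncLoss ρ (fun t => C * f t) a t g = ENNReal.ofReal C * truncLoss ρ f a t g := by
  simp only [truncLoss, rayLoss_const_mul hC]
  exact lintegral_const_mul' _ _ ENNReal.ofReal_ne_top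

theorem ne_top_of_ofReal_mul_ne_top (hC : 0 < C) {x : ℝ≥0∞} (h : ENNReal.ofReal C * x ≠ ∞) :
    x ≠ ∞ := fun hx => h (by rw [hx, ENNReal.mul_top (ENNReal.ofReal_pos.2 hC).ne'])

theorem LeadersBelowBayes.const_mul (hC : 0 < C) (h : LeadersBelowBayes ρ f a b) :
    LeadersBelowBayes ρ (fun t => C * f t) a b := by
  have hle : ∀ c t g g', truncLoss ρ (fun t => C * f t) c t g ≤
      truncLoss ρ (fun t => C * f t) c t g' → truncLoss ρ f c t g ≤ truncLoss ρ f c t g' :=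
    fun c t g g' hle => by
      rw [truncLoss_const_mul hC.le, truncLoss_const_mul hC.le] at hle
      exact (ENNReal.mul_le_mul_iff_right (ENNReal.ofReal_pos.2 hC).ne' ENNReal.ofReal_ne_top).1 hle
  have hlead : ∀ t g, IsLeader ρ (fun t => C * f t) a t g → IsLeader ρ f a t g := fun t g hg =>
    ⟨hg.nonneg, hg.add_nonneg, fun g' hg' => hle _ _ _ _ (hg.le g' hg')⟩
  refine ⟨fun t g hg => ?_, fun t g₀ g hg₀ hg hmin => h.lt t g₀ g (hlead t g₀ hg₀) ?_
    fun g' => hle _ _ _ _ (hmin g')⟩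
  · obtain ⟨q, hq, hq'⟩ := h.interior t g (hlead t g hg)
    exact ⟨q, hq, by
      rw [rayLoss_const_mul hC.le]; exact ENNReal.mul_ne_top ENNReal.ofReal_ne_top hq'⟩
  · rw [truncLoss_const_mul hC.le] at hg
    exact ne_top_of_ofReal_mul_ne_top hC hg

theorem IsDecreasingGenerator.const_mul (hC : 0 < C) (hf : IsDecreasingGenerator f) :
    IsDecreasingGenerator fun t => C * f t where
  pos t ht := mul_pos hC (hf.pos t ht)
  meas := hf.meas.const_mul C
  anti _ hx _ hy hxy := mul_le_mul_of_nonneg_left (hf.anti hx hy hxy) hC.le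

end ConstMul

/-! ### The two cases of the hypothesis -/

section Cases

variable {n : ℕ} {f ρ : ℝ → ℝ} {l : ℝ}

theorem leadersBelowBayes_normal {a b : ℝ} (hρ : IsEvenLoss ρ) (hc : ConvexOn ℝ univ ρ)
    (hfin : ∫⁻ z, rayLoss ρ normalGenerator a z 0 ≠ ∞) (hb : 0 < b) (hba : b < a) :
    LeadersBelowBayes ρ normalGenerator a b := by
  have hi := integrable_of_lintegral_rayLoss_normal_ne_top hρ hfin
  exact ⟨leadersInterior_normal hρ hc hi (hb.trans hba), fun t g₀ g h₀ hg hmin =>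
    h₀.lt_of_forall_le_normal hρ hc hi hb hba hg hmin⟩

theorem leadersBelowBayes_powLoss {p a b : ℝ} (hp : 0 < p) (hf : IsDecreasingGenerator f)
    (hfin : ∫⁻ z, rayLoss (powLoss p) f a z 0 ≠ ∞) (hb : 0 < b) (hba : b < a) :
    LeadersBelowBayes (powLoss p) f a b := by
  have hκ := rayLoss_powLoss_one_ne_top hp hf hfin
  exact ⟨leadersInterior_powLoss hκ, fun t g₀ g h₀ hg hmin =>
    h₀.lt_of_forall_le_powLoss hp hf hb hba hκ hg hmin⟩

theorem lintegral_rayLoss_one_normal_ne_top {a : ℝ} (ha : 0 < a) :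
    ∫⁻ z, rayLoss (fun _ => 1) normalGenerator a z 0 ≠ ∞ := by
  rw [lintegral_rayLoss_normal measurable_const fun _ => zero_le_one]
  refine ENNReal.mul_ne_top (lintegral_rpow_mul_gaussian_ne_top ha) ?_
  have hi : Integrable fun x : ℝ => 1 * Real.exp (-x ^ 2 / 2) := by
    simpa using integrable_gaussian_mul one_pos
  exact ((hasFiniteIntegral_iff_ofReal (Eventually.of_forall fun x => by positivity)).1 hi.2).ne

/-- Convexity and ρ 0 = 0 give ρ x ≤ (x/y) ρ y for 0 ≤ x ≤ y. With ρ > 0 off 0 this yields both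
strict growth and at least linear growth. -/
theorem IsStrictlyBowlShaped.isEvenLoss (h : IsStrictlyBowlShaped ρ) (he : Function.Even ρ)
    (hc : ConvexOn ℝ univ ρ) : IsEvenLoss ρ := by
  have hscale : ∀ x y : ℝ, 0 ≤ x → x ≤ y → 0 < y → ρ x ≤ x / y * ρ y := fun x y hx hxy hy => by
    have h1 := hc.2 (mem_univ 0) (mem_univ y) (sub_nonneg.2 ((div_le_one hy).2 hxy))
      (div_nonneg hx hy.le) (by ring)
    simpa [h.zero, div_mul_cancel₀ x hy.ne'] using h1
  have hpos : ∀ y, 0 < y → 0 < ρ y := fun y hy => by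
    -- A zero at y > 0 would make ρ vanish on (0,y), contrary to ρ' > 0 almost everywhere.
    refine (h.nonneg y).lt_of_ne fun h0 => ?_
    have hzero : ∀ x ∈ Ioo 0 y, ρ x = 0 := fun x hx => by
      have := hscale x y hx.1.le hx.2.le hy
      rw [← h0, mul_zero] at this
      exact le_antisymm this (h.nonneg x)
    have hne : ∃ᵐ x : ℝ, x ∈ Ioo 0 y := frequently_ae_mem_iff.2 (by simpa using hy)
    obtain ⟨x, hx, hd⟩ := (hne.and_eventually h.deriv_pos).exists
    have h1 : ρ =ᶠ[𝓝 x] fun _ => 0 := by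
      filter_upwards [Ioo_mem_nhds hx.1 hx.2] with z hz using hzero z hz
    have := hd hx.1
    rw [h1.deriv_eq, deriv_const] at this
    exact this.false
  refine ⟨he, h.zero, continuousOn_univ.1 (hc.continuousOn isOpen_univ), fun x hx y _ hxy => ?_, ?_⟩
  · have hx : 0 ≤ x := hx
    have hy : 0 < y := hx.trans_lt hxy
    refine (hscale x y hx hxy.le hy).trans_lt ?_
    calc x / y * ρ y < 1 * ρ y := mul_lt_mul_of_pos_right ((div_lt_one hy).2 hxy) (hpos y hy)
      _ = ρ y := one_mul _
  · refine tendsto_atTop_mono' _ ?_ (tendsto_id.atTop_mul_const (hpos 1 one_pos))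
    filter_upwards [eventually_ge_atTop (1 : ℝ)] with y hy
    have hy0 : 0 < y := by linarith
    have := hscale 1 y zero_le_one hy hy0
    rw [div_mul_eq_mul_div, one_mul, le_div_iff₀ hy0] at this
    simpa [mul_comm] using this

/-- Off (0,∞) the function f is arbitrary and perhaps not measurable, so it is extended by 0. A
nonzero `deriv` implies differentiability, hence continuity on (0,∞). -/
theorem IsGenerator.isDecreasingGenerator (h : IsGenerator n f) :
    IsDecreasingGenerator ((Ioi 0).indicator f) := by
  have hd : ∀ t, 0 < t → DifferentiableAt ℝ f t := fun t ht =>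
    differentiableAt_of_deriv_ne_zero (h.deriv_neg t ht).ne
  have hcont : ContinuousOn f (Ioi 0) := fun t ht => (hd t ht).continuousAt.continuousWithinAt
  have hanti : StrictAntiOn f (Ioi 0) := strictAntiOn_of_deriv_neg (convex_Ioi 0) hcont
    fun t ht => h.deriv_neg t (by simpa using ht)
  refine ⟨fun t ht => ?_, ?_, fun x hx y hy hxy => ?_⟩
  · rw [indicator_of_mem (mem_Ioi.2 ht)]
    exact h.pos t ht
  · rw [← piecewise_eq_indicator]
    exact hcont.measurable_piecewise continuousOn_const measurableSet_Ioi
  · rw [indicator_of_mem hx, indicator_of_mem hy]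
    exact hanti.antitoneOn hx hy hxy

theorem IsGenerator.lintegral_rayLoss_one_ne_top (hn : 1 ≤ n) (h : IsGenerator n f) :
    ∫⁻ z, rayLoss (fun _ => 1) ((Ioi 0).indicator f) n z 0 ≠ ∞ := by
  have hS : MeasurableSet ((univ : Set ℝ) ×ˢ Ioi (0 : ℝ)) := MeasurableSet.univ.prod measurableSet_Ioi
  have heq : ∀ t, 0 < t → (Ioi 0).indicator f t = f t := fun t ht => indicator_of_mem ht f
  rw [← lintegral_reducedDensity hn h.isDecreasingGenerator.meas 0 one_pos]
  refine ne_of_eq_of_ne ?_ h.integrable.ne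
  rw [← lintegral_indicator hS]
  refine lintegral_congr fun ω => ?_
  by_cases hω : 0 < ω.2
  · rw [indicator_of_mem (show ω ∈ (univ : Set ℝ) ×ˢ Ioi (0 : ℝ) from ⟨mem_univ _, hω⟩),
      reducedDensity, if_pos hω]
    dsimp only
    rw [heq _ (by positivity)]
    simp
  · rw [indicator_of_notMem (fun h => hω h.2), reducedDensity, if_neg hω]

/-- The conclusion for a generator `f` that agrees on `(0,∞)` with a measurable one. -/
theorem not_isMinimax_and_risk_lt {f' : ℝ → ℝ} (hn : 1 ≤ n) (hff' : ∀ t, 0 < t → f t = f' t)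
    (hf : IsDecreasingGenerator f') (hρ : IsEvenLoss ρ)
    (hZ : ∫⁻ z, rayLoss (fun _ => 1) f' n z 0 ≠ ∞)
    (hlb : ∫⁻ z, rayLoss ρ f' n z 0 ≠ ∞ → LeadersBelowBayes ρ f' n (n + l)) {c₀ : ℝ}
    (hc₀ : IsMREConstant n f ρ c₀) :
    (∀ δ : ℝ × EuclideanSpace ℝ (Fin n) → ℝ, Measurable δ →
      IsGeneralizedBayes (fullDensity n f) ρ l δ →
        ¬IsMinimax (fullDensity n f) ρ δ ∧ ∀ σ : ℝ, 0 < σ →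
          risk (fullDensity n f) ρ (fun ω => ω.1 + c₀ * ‖ω.2‖) (0, σ) <
            risk (fullDensity n f) ρ δ (0, σ)) ∧
    (∀ δ : ℝ × ℝ → ℝ, Measurable δ → IsGeneralizedBayes (reducedDensity n f) ρ l δ →
        ¬IsMinimax (reducedDensity n f) ρ δ ∧ ∀ σ : ℝ, 0 < σ →
          risk (reducedDensity n f) ρ (fun ω => ω.1 + c₀ * ω.2) (0, σ) <
            risk (reducedDensity n f) ρ δ (0, σ)) := by
  have hred : ∀ᵐ ω : ℝ × ℝ, ∀ θ ∈ Θ, reducedDensity n f θ ω = reducedDensity n f' θ ω :=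
    Eventually.of_forall fun ω θ hθ => reducedDensity_congr hff' ω hθ
  have hfull := fullDensity_congr hn hff'
  have hΘ : ∀ σ : ℝ, 0 < σ → ((0 : ℝ), σ) ∈ Θ := fun σ hσ => by simpa [Θ] using hσ
  have hc₀' : IsMREConstant n f' ρ c₀ := by
    simpa only [IsMREConstant, risk_congr hred _ (hΘ 1 one_pos)] using hc₀
  have hlb' := hlb (hc₀'.lintegral_rayLoss_eq hn hf hρ hZ).1
  refine ⟨fun δ hδ hGB => ?_, fun δ hδ hGB => ?_⟩
  · obtain ⟨h1, h2⟩ := full_not_isMinimax_and_risk_lt hn hf hρ hZ hlb' hc₀' hδ (hGB.congr hfull)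
    refine ⟨fun h => h1 (h.congr hfull), fun σ hσ => ?_⟩
    rw [risk_congr hfull _ (hΘ σ hσ), risk_congr hfull _ (hΘ σ hσ)]
    exact h2 σ hσ
  · obtain ⟨h1, h2⟩ := reduced_not_isMinimax_and_risk_lt hn hf hρ hZ hlb' hc₀' hδ (hGB.congr hred)
    refine ⟨fun h => h1 (h.congr hred), fun σ hσ => ?_⟩
    rw [risk_congr hred _ (hΘ σ hσ), risk_congr hred _ (hΘ σ hσ)]
    exact h2 σ hσ

end Cases

end BoundedMean

theorem corollary2 (n : ℕ) (hn : 1 ≤ n) (f ρ : ℝ → ℝ) (l : ℝ)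
    (hl : -((n : ℝ) - 1) ≤ l) (hl0 : l < 0)
    (hcase :
      (BoundedMean.IsNormalGenerator f ∧ BoundedMean.IsStrictlyBowlShaped ρ ∧
        Function.Even ρ ∧ ConvexOn ℝ Set.univ ρ) ∨
      (BoundedMean.IsGenerator n f ∧ ∃ p : ℝ, 0 < p ∧ ∀ t : ℝ, ρ t = |t| ^ p))
    (c₀ : ℝ) (hc₀ : BoundedMean.IsMREConstant n f ρ c₀) :
    (∀ δ : ℝ × EuclideanSpace ℝ (Fin n) → ℝ, Measurable δ →
      BoundedMean.IsGeneralizedBayes (BoundedMean.fullDensity n f) ρ l δ →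
        ¬ BoundedMean.IsMinimax (BoundedMean.fullDensity n f) ρ δ ∧
        ∀ σ : ℝ, 0 < σ →
          BoundedMean.risk (BoundedMean.fullDensity n f) ρ
              (fun ω => ω.1 + c₀ * ‖ω.2‖) (0, σ) <
            BoundedMean.risk (BoundedMean.fullDensity n f) ρ δ (0, σ)) ∧
    (∀ δ : ℝ × ℝ → ℝ, Measurable δ →
      BoundedMean.IsGeneralizedBayes (BoundedMean.reducedDensity n f) ρ l δ →
        ¬ BoundedMean.IsMinimax (BoundedMean.reducedDensity n f) ρ δ ∧
        ∀ σ : ℝ, 0 < σ →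
          BoundedMean.risk (BoundedMean.reducedDensity n f) ρ
              (fun ω => ω.1 + c₀ * ω.2) (0, σ) <
            BoundedMean.risk (BoundedMean.reducedDensity n f) ρ δ (0, σ)) := by
  have hnpos : (0 : ℝ) < n := by exact_mod_cast hn
  -- The bound on l gives n + l ≥ 1, so the Bayes weight is positive; l < 0 makes it smaller than
  -- the weight n of the risk.
  have hb : 0 < (n : ℝ) + l := by linarith
  have hba : (n : ℝ) + l < n := by linarith
  rcases hcase with ⟨⟨C, hC, hf⟩, hbowl, heven, hconv⟩ | ⟨hf, p, hp, hρ⟩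
  · have hρ := hbowl.isEvenLoss heven hconv
    refine BoundedMean.not_isMinimax_and_risk_lt
      (f' := fun t => C * BoundedMean.normalGenerator t) hn hf
      (BoundedMean.isDecreasingGenerator_normal.const_mul hC) hρ ?_ (fun hfin => ?_) hc₀
    · rw [BoundedMean.lintegral_rayLoss_const_mul hC.le]
      exact ENNReal.mul_ne_top ENNReal.ofReal_ne_top
        (BoundedMean.lintegral_rayLoss_one_normal_ne_top hnpos)
    · rw [BoundedMean.lintegral_rayLoss_const_mul hC.le] at hfin
      exact (BoundedMean.leadersBelowBayes_normal hρ hconv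
        (BoundedMean.ne_top_of_ofReal_mul_ne_top hC hfin) hb hba).const_mul hC
  · obtain rfl : ρ = BoundedMean.powLoss p := funext hρ
    exact BoundedMean.not_isMinimax_and_risk_lt hn
      (fun t ht => (indicator_of_mem (mem_Ioi.2 ht) f).symm) hf.isDecreasingGenerator
      (BoundedMean.isEvenLoss_powLoss hp) (hf.lintegral_rayLoss_one_ne_top hn)
      (fun hfin => BoundedMean.leadersBelowBayes_powLoss hp hf.isDecreasingGenerator hfin hb hba) hc₀
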